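/- **Setting.** Let $n\ge 0$, let $a=\mathrm{diag}(a_1,\dots,a_n)\in u(n)$ (so every $a_k$ is purely imaginary), let $b\in u(n)$ be of the form $b=p(a)$ for some polynomial $p\in\mathbb C[X]$, and let $j\ge 1$ be an integer. Put $u(n)_a=\{z\in u(n): [a,z]=0\}$ and let $u(n)_a^\perp=\{y\in u(n): \mathrm{tr}(zy)=0 \text{ for all } z\in u(n)_a\}$. *The flow.* For $u$ in the Schwartz class $\mathcal S(\mathbb R,u(n)_a^\perp)$ let $m\sim I+m_1(x)\lambda^{-1}+m_2(x)\lambda^{-2}+\cdots$ be the expansion at $\lambda=\infty$ of its reduced wave function, that is, the unique formal series with $m_0=I$, $[a,m_{k+1}]+(m_k)_x=m_k u$ for $k\ge 0$ (equivalently $\psi=e^{a\lambda x}m$ satisfies $\psi_x=\psi(a\lambda+u)$), and $\lim_{x\to-\infty}m_k(x)=0$ for $k\ge 1$. Let $Q_{b,k}(u)$ be the coefficient of $\lambda^{-k}$ in $m^{-1}bm$. Let $\mathcal M_{a,b,j}$ be the set of smooth maps $u:\mathbb R^2\to u(n)_a^\perp$, $(x,t)\mapsto u(x,t)$, such that $u(\cdot,t)$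 is in the Schwartz class for every $t\in\mathbb R$ and $$u_t=(Q_{b,j}(u))_x+[u,Q_{b,j}(u)].$$ A *trivialization* of $u\in\mathcal M_{a,b,j}$ (normalized at $(0,0)$) is a map $E(x,t,\lambda)$, $(x,t)\in\mathbb R^2$, $\lambda\in\mathbb C$, with values in the complex $n\times n$ matrices and $$E_x=E(a\lambda+u),\qquad E_t=E\bigl(b\lambda^j+Q_{b,1}(u)\lambda^{j-1}+\cdots+Q_{b,j}(u)\bigr),\qquad E(0,0,\lambda)=I.$$ *The groups.* $G_+$ is the group of holomorphic maps $f:\mathbb C\to GL(n,\mathbb C)$ with $f(\bar\lambda)^*f(\lambda)=I$. $G_-^m$ is the group of rational maps $g$ of $\lambda$ into $GL(n,\mathbb C)$ (matrices of rational functions) with $g(\infty)=I$ and $g(\bar\lambda)^*g(\lambda)=I$. **Theorem.** Every $u\in\mathcal M_{a,b,j}$ has exactly one trivialization. For every $g\in G_-^m$ and every $u\in\mathcal M_{a,b,j}$ with trivialization $E$, writing $E(x,t)=E(x,t,\cdot)$: 1. for every $(x,t)\in\mathbb R^2$ the product $gE(x,t)$ factors uniquely as $$gE(x,t)=\tilde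 E(x,t)\,\tilde g(x,t),\qquad \tilde E(x,t)\in G_+,\quad \tilde g(x,t)\in G_-^m$$ (an identity of meromorphic functions of $\lambda$), and $\tilde E(0,0)=I$; 2. $\tilde E^{-1}\tilde E_x=a\lambda+\tilde u(x,t)$ for some $\tilde u\in\mathcal M_{a,b,j}$; 3. $g*u=\tilde u$ defines an action of the group $G_-^m$ on the set $\mathcal M_{a,b,j}$, i.e. $I*u=u$ and $(gh)*u=g*(h*u)$ for all $g,h\in G_-^m$ and $u\in\mathcal M_{a,b,j}$; 4. $\tilde E$ is the trivialization of $\tilde u$. -/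

import Mathlib

open Filter Topology MeasureTheory
open scoped Matrix ContDiff SchwartzMap ComplexConjugate

noncomputable section

namespace UnHierarchy

/-- Complex `n × n` matrices, `gl(n, ℂ)`. -/
abbrev Mat (n : ℕ) : Type := Matrix (Fin n) (Fin n) ℂ

variable {n : ℕ}

/-! ### Calculus of matrix-valued functions of a real variable, entry by entry -/

/-- The matrix-valued function `F` has derivative `F'` at `x`. -/
def HasMatDerivAt (F : ℝ → Mat n) (F' : Mat n) (x : ℝ) : Prop :=
  ∀ i j, HasDerivAt (fun y => F y i j) (F' i j) x

/-- The derivative of a matrix-valued function. -/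
def matDeriv (F : ℝ → Mat n) (x : ℝ) : Mat n :=
  Matrix.of fun i j => deriv (fun y => F y i j) x

/-- `F` lies in the Schwartz class. -/
def IsSchwartz (F : ℝ → Mat n) : Prop :=
  ∀ i j, ∃ f : 𝓢(ℝ, ℂ), ∀ x, f x = F x i j

/-! ### The phase space -/

/-- The orthogonal complement `u(n)_a^⊥`, with respect to the trace form, of the centralizer
`u(n)_a = {z ∈ u(n) | [a, z] = 0}` of `a = diag(a₁, …, aₙ)` in `u(n)`. -/
def centralizerPerp (a : Fin n → ℂ) : Set (Mat n) :=
  {y | yᴴ = -y ∧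
    ∀ z : Mat n, zᴴ = -z → Matrix.diagonal a * z = z * Matrix.diagonal a → (z * y).trace = 0}

/-! ### The differential operators `Q_{b,k}`

A reduced wave function `m(x, λ)` of `u` has an expansion
`m ~ I + m₁(x) λ⁻¹ + m₂(x) λ⁻² + ⋯` at `λ = ∞`, tends to `I` as `x → -∞`, and
`ψ = e^{aλx} m` satisfies `ψ_x = ψ (aλ + u)`. On coefficients this reads
`[a, m_{k+1}] + (m_k)_x = m_k u`, and `m_k → 0` as `x → -∞` for `k ≥ 1`. The entries `(i, j)` with
`a_i ≠ a_j` of this equation give the corresponding entries of `m_{k+1}`; the entries with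
`a_i = a_j` of the next equation give the derivative of the remaining entries of `m_{k+1}`,
which are then found by integration from `-∞`. -/

/-- The entries `(i, j)` with `a_i ≠ a_j` of `m_{k+1}`, computed from `m = m_k`: the solution `P` of
`[a, P] = m u - m_x` on these entries, extended by `0`. -/
def waveOff (a : Fin n → ℂ) (u m : ℝ → Mat n) (x : ℝ) : Mat n :=
  Matrix.of fun i j =>
    if a i = a j then 0 else ((m x * u x) i j - matDeriv m x i j) / (a i - a j)

/-- The coefficients `m_k(x)` of the expansion of the reduced wave function of `u` at `λ = ∞`. -/
def waveCoeff (a : Fin n → ℂ) (u : ℝ → Mat n) : ℕ → ℝ → Mat n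
  | 0 => fun _ => 1
  | k + 1 => fun x =>
      waveOff a u (waveCoeff a u k) x +
        Matrix.of fun i j =>
          if a i = a j then
            ∫ y in Set.Iic x, (waveOff a u (waveCoeff a u k) y * u y) i j
          else 0

/-- The expansion of the reduced wave function at the point `x`, as a power series in `λ⁻¹`. -/
def waveSeries (a : Fin n → ℂ) (u : ℝ → Mat n) (x : ℝ) : PowerSeries (Mat n) :=
  PowerSeries.mk fun k => waveCoeff a u k x

/-- `Q_{b,k}(u)(x)`: the coefficient of `λ^{-k}` in the expansion of `m⁻¹ b m` at `λ = ∞`. -/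
def Q (a : Fin n → ℂ) (b : Mat n) (u : ℝ → Mat n) (k : ℕ) (x : ℝ) : Mat n :=
  PowerSeries.coeff k
    (PowerSeries.invOfUnit (waveSeries a u x) 1 * PowerSeries.C b * waveSeries a u x)

/-! ### Solutions of the `j`-th flow and their trivializations -/

/-- `u(x, t)` is a smooth solution on `ℝ²` of the `j`-th flow
`u_t = (Q_{b,j}(u))_x + [u, Q_{b,j}(u)]` defined by `b` in the `u(n)`-hierarchy on
the Schwartz class `𝓢(ℝ, u(n)_a^⊥)`. -/
structure IsSolution (a : Fin n → ℂ) (b : Mat n) (j : ℕ) (u : ℝ → ℝ → Mat n) : Prop where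
  smooth : ∀ k l, ContDiff ℝ ∞ (fun p : ℝ × ℝ => u p.1 p.2 k l)
  mem_perp : ∀ x t, u x t ∈ centralizerPerp a
  schwartz : ∀ t, IsSchwartz (fun x => u x t)
  flow : ∀ x t, HasMatDerivAt (fun s => u x s)
    (matDeriv (Q a b (fun y => u y t) j) x +
      (u x t * Q a b (fun y => u y t) j x - Q a b (fun y => u y t) j x * u x t)) t

/-- The space `M_{a,b,j}` of solutions of the `j`-th flow. -/
def solutionSpace (a : Fin n → ℂ) (b : Mat n) (j : ℕ) : Set (ℝ → ℝ → Mat n) :=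
  {u | IsSolution a b j u}

/-- `E(x, t, λ)` is a trivialization of `u` normalized at `(0, 0)`. -/
structure IsTrivialization (a : Fin n → ℂ) (b : Mat n) (j : ℕ) (u : ℝ → ℝ → Mat n)
    (E : ℝ → ℝ → ℂ → Mat n) : Prop where
  deriv_x : ∀ x t l, HasMatDerivAt (fun y => E y t l)
    (E x t l * (l • Matrix.diagonal a + u x t)) x
  deriv_t : ∀ x t l, HasMatDerivAt (fun s => E x s l)
    (E x t l * ∑ k ∈ Finset.range (j + 1), l ^ (j - k) • Q a b (fun y => u y t) k x) t
  base : ∀ l, E 0 0 l = 1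

/-! ### The loop groups -/

/-- `f ∈ G_+`: `f` is a holomorphic map from `ℂ` to `GL(n, ℂ)` with `f(λ̄)* f(λ) = I`
(which contains the invertibility of `f(λ)`). -/
structure IsGPlus (f : ℂ → Mat n) : Prop where
  holo : ∀ i j, Differentiable ℂ (fun l => f l i j)
  reality : ∀ l, (f (conj l))ᴴ * f l = 1

/-- The value at `λ` of a matrix of rational functions (meaningful off the finite set of poles). -/
def evalAt (g : Matrix (Fin n) (Fin n) (RatFunc ℂ)) (l : ℂ) : Mat n :=
  g.map (RatFunc.eval (RingHom.id ℂ) l)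

theorem eventually_denom_ne_zero (r : RatFunc ℂ) :
    ∀ᶠ l in cofinite, Polynomial.eval₂ (RingHom.id ℂ) l r.denom ≠ 0 := by
  have h : {l : ℂ | r.denom.IsRoot l}.Finite := Polynomial.finite_setOfPred_isRoot r.denom_ne_zero
  filter_upwards [h.eventually_cofinite_notMem] with l hl h0
  exact hl h0

theorem eventually_eval_sum {ι : Type} (s : Finset ι) (f : ι → RatFunc ℂ) :
    ∀ᶠ l in cofinite, RatFunc.eval (RingHom.id ℂ) l (∑ i ∈ s, f i) =
      ∑ i ∈ s, RatFunc.eval (RingHom.id ℂ) l (f i) := by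
  classical
  induction s using Finset.induction_on with
  | empty => simp
  | insert i s hi ih =>
    filter_upwards [ih, eventually_denom_ne_zero (f i),
      eventually_denom_ne_zero (∑ i ∈ s, f i)] with l h1 h2 h3
    rw [Finset.sum_insert hi, Finset.sum_insert hi, RatFunc.eval_add _ _ h2 h3, h1]

theorem eventually_evalAt_mul (g h : Matrix (Fin n) (Fin n) (RatFunc ℂ)) :
    ∀ᶠ l in cofinite, evalAt (g * h) l = evalAt g l * evalAt h l := by
  have h1 : ∀ᶠ l in cofinite, ∀ i j,
      RatFunc.eval (RingHom.id ℂ) l (∑ k, g i k * h k j) =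
      ∑ k, RatFunc.eval (RingHom.id ℂ) l (g i k * h k j) :=
    eventually_all.2 fun i => eventually_all.2 fun j => eventually_eval_sum _ _
  have h2 : ∀ᶠ l in cofinite, ∀ i j,
      Polynomial.eval₂ (RingHom.id ℂ) l (g i j).denom ≠ 0 :=
    eventually_all.2 fun i => eventually_all.2 fun j => eventually_denom_ne_zero _
  have h3 : ∀ᶠ l in cofinite, ∀ i j,
      Polynomial.eval₂ (RingHom.id ℂ) l (h i j).denom ≠ 0 :=
    eventually_all.2 fun i => eventually_all.2 fun j => eventually_denom_ne_zero _
  filter_upwards [h1, h2, h3] with l h1 h2 h3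
  ext i j
  simp only [evalAt, Matrix.map_apply, Matrix.mul_apply]
  rw [h1]
  exact Finset.sum_congr rfl fun k _ => RatFunc.eval_mul _ _ (h2 i k) (h3 k j)

theorem evalAt_one (l : ℂ) : evalAt (1 : Matrix (Fin n) (Fin n) (RatFunc ℂ)) l = 1 :=
  Matrix.map_one _ (RatFunc.eval_zero _ _) (RatFunc.eval_one _ _)

theorem tendsto_conj_cofinite : Tendsto (fun l : ℂ => conj l) cofinite cofinite :=
  (star_injective (R := ℂ)).tendsto_cofinite

/-- The group `G_-^m` of rational maps `g` with values in `GL(n, ℂ)` such that `g(∞) = I` and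
`g(λ̄)* g(λ) = I`. Its elements are matrices of rational functions of `λ`, and the last identity is
one between rational functions, that is, it holds for all but finitely many `λ`. -/
def GMinus (n : ℕ) : Subgroup (Matrix (Fin n) (Fin n) (RatFunc ℂ))ˣ where
  carrier := {g | (∀ᶠ l in cofinite, (evalAt g.val (conj l))ᴴ * evalAt g.val l = 1) ∧
    Tendsto (evalAt g.val) (cocompact ℂ) (𝓝 1)}
  one_mem' := by
    refine ⟨Eventually.of_forall fun l => ?_, ?_⟩
    · simp [evalAt_one]
    · exact tendsto_const_nhds.congr fun l => by simp [evalAt_one]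
  mul_mem' := by
    rintro g h ⟨hg, hg'⟩ ⟨hh, hh'⟩
    have hm := eventually_evalAt_mul g.val h.val
    refine ⟨?_, ?_⟩
    · filter_upwards [hg, hh, hm, tendsto_conj_cofinite.eventually hm] with l h1 h2 h3 h4
      rw [Units.val_mul, h3, h4, Matrix.conjTranspose_mul, Matrix.mul_assoc,
        ← Matrix.mul_assoc _ (evalAt g.val l), h1, Matrix.one_mul, h2]
    · have h1 := hg'.mul hh'
      rw [one_mul] at h1
      refine h1.congr' ?_
      filter_upwards [cocompact_le_cofinite hm] with l hl
      exact hl.symm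
  inv_mem' := by
    rintro g ⟨hg, hg'⟩
    have hm := eventually_evalAt_mul g.val g.inv
    rw [g.val_inv] at hm
    have key : ∀ᶠ l in cofinite, evalAt g.inv l = (evalAt g.val (conj l))ᴴ := by
      filter_upwards [hg, hm] with l h1 h2
      rw [evalAt_one] at h2
      calc evalAt g.inv l
          = ((evalAt g.val (conj l))ᴴ * evalAt g.val l) * evalAt g.inv l := by
            rw [h1, Matrix.one_mul]
        _ = _ := by rw [Matrix.mul_assoc, ← h2, Matrix.mul_one]
    refine ⟨?_, ?_⟩
    · filter_upwards [hg, key, tendsto_conj_cofinite.eventually key] with l h1 h2 h3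
      change (evalAt g.inv (conj l))ᴴ * evalAt g.inv l = 1
      rw [h2, h3, Complex.conj_conj, Matrix.conjTranspose_conjTranspose]
      exact mul_eq_one_comm.1 h1
    · have hc : Tendsto (fun l : ℂ => conj l) (cocompact ℂ) (cocompact ℂ) :=
        Complex.conjCLE.toHomeomorph.isClosedEmbedding.tendsto_cocompact
      have h1 : Tendsto (fun l => (evalAt g.val (conj l))ᴴ) (cocompact ℂ) (𝓝 (1 : Mat n)ᴴ) :=
        (Continuous.tendsto (by fun_prop) (1 : Mat n)).comp (hg'.comp hc)
      rw [Matrix.conjTranspose_one] at h1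
      refine h1.congr' ?_
      filter_upwards [cocompact_le_cofinite key] with l hl
      exact hl.symm

/-- `g f = f' g'` in `G_+ × G_-^m`: the right-hand side is a factorization of the product of `g` and
the holomorphic map `f`; the identity is one between meromorphic functions of `λ` with finitely many
poles. -/
def IsFactorization (g : GMinus n) (f f' : ℂ → Mat n) (g' : GMinus n) : Prop :=
  IsGPlus f' ∧
    ∀ᶠ l in cofinite, evalAt g.1.val l * f l = f' l * evalAt g'.1.val l

end UnHierarchy

end

/-
Factorizations are unique by Liouville's theorem, so everything composes: it suffices to dress by
generators of `G_-^m`. These are the simple elements `π^⊥ + (λ - z) / (λ - z̄) π` with `π` an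
orthogonal projection of rank one, because a polynomial numerator of `g` that is singular but
nonzero at a root of the denominator can be made more singular by such a factor.

For a simple element with residue line `ℂ v`, the factorization is explicit: the new simple element
has the same poles and the line spanned by `w = E(z)⁻¹ v`, and `ũ = u + [S, a]` for the Darboux
matrix `S` of `w`. Two facts make `ũ` a solution. First, `m⁻¹ b m` is a combination of the spectral
projections `m⁻¹ e m`, whose coefficients are local formulas in `u`, so conjugation by `λ + S` maps
`Q(u)` to `Q(ũ)`. Second, the projection `π` onto `ℂ w` satisfies a Riccati equation in `x`, and
the squared moduli of the coordinates of a unit vector spanning `ℂ w` satisfy a replicator equation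
up to a rapidly decreasing error; hence `[π, a]` is rapidly decreasing, which places `ũ` in the
Schwartz class.
-/

noncomputable section

namespace UnHierarchy

open PowerSeries (coeff C X constantCoeff invOfUnit invOfUnit_mul mul_invOfUnit)

variable {n : ℕ}

/-! ### Calculus of matrix-valued functions -/

namespace HasMatDerivAt

variable {F G : ℝ → Mat n} {F' G' : Mat n} {x : ℝ}

theorem const (M : Mat n) (x : ℝ) : HasMatDerivAt (fun _ => M) 0 x := fun i j => by
  simpa using! hasDerivAt_const x (M i j)

theorem add (hF : HasMatDerivAt F F' x) (hG : HasMatDerivAt G G' x) :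
    HasMatDerivAt (fun y => F y + G y) (F' + G') x := fun i j => (hF i j).add (hG i j)

theorem sub (hF : HasMatDerivAt F F' x) (hG : HasMatDerivAt G G' x) :
    HasMatDerivAt (fun y => F y - G y) (F' - G') x := fun i j => (hF i j).sub (hG i j)

theorem mul (hF : HasMatDerivAt F F' x) (hG : HasMatDerivAt G G' x) :
    HasMatDerivAt (fun y => F y * G y) (F' * G x + F x * G') x := fun i j => by
  simp only [Matrix.mul_apply, Matrix.add_apply, ← Finset.sum_add_distrib]
  exact HasDerivAt.fun_sum fun k _ => (hF i k).mul (hG k j)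

theorem const_mul (M : Mat n) (hF : HasMatDerivAt F F' x) :
    HasMatDerivAt (fun y => M * F y) (M * F') x := by
  simpa using (const M x).mul hF

theorem mul_const (hF : HasMatDerivAt F F' x) (M : Mat n) :
    HasMatDerivAt (fun y => F y * M) (F' * M) x := by
  simpa using hF.mul (const M x)

theorem const_smul (c : ℂ) (hF : HasMatDerivAt F F' x) :
    HasMatDerivAt (fun y => c • F y) (c • F') x := fun i j => (hF i j).const_mul c

theorem sum {ι : Type*} {s : Finset ι} {F : ι → ℝ → Mat n} {F' : ι → Mat n}
    (h : ∀ k ∈ s, HasMatDerivAt (F k) (F' k) x) :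
    HasMatDerivAt (fun y => ∑ k ∈ s, F k y) (∑ k ∈ s, F' k) x := fun i j => by
  simp only [Matrix.sum_apply]
  exact HasDerivAt.fun_sum fun k hk => h k hk i j

theorem conjTranspose (hF : HasMatDerivAt F F' x) :
    HasMatDerivAt (fun y => (F y)ᴴ) F'ᴴ x := fun i j => (hF j i).star

theorem unique (hF : HasMatDerivAt F F' x) (hG : HasMatDerivAt F G' x) : F' = G' := by
  ext i j
  exact (hF i j).unique (hG i j)

theorem matDeriv (hF : HasMatDerivAt F F' x) : matDeriv F x = F' := by
  ext i j
  exact (hF i j).deriv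

theorem congr_deriv (hF : HasMatDerivAt F F' x) (h : F' = G') : HasMatDerivAt F G' x := h ▸ hF

theorem eq_of_zero {F : ℝ → Mat n} (hF : ∀ x, HasMatDerivAt F 0 x) (x y : ℝ) : F x = F y := by
  ext i j
  exact is_const_of_deriv_eq_zero (fun z => (hF z i j).differentiableAt)
    (fun z => (hF z i j).deriv) x y

end HasMatDerivAt

/-! ### Linear differential equations with a parameter -/

section LinearODE

variable {P 𝔸 : Type*} [NormedRing 𝔸] [NormedAlgebra ℝ 𝔸]

/-- The terms of the Dyson series of the equation `Y' = Y A`, `Y(0) = 1`. -/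
def dysonTerm (A : ℝ → P → 𝔸) : ℕ → ℝ → P → 𝔸
  | 0 => fun _ _ => 1
  | k + 1 => fun x p => ∫ s in (0 : ℝ)..x, dysonTerm A k s p * A s p

/-- The Dyson series, which solves `Y' = Y A`, `Y(0) = 1`. -/
def dyson (A : ℝ → P → 𝔸) (x : ℝ) (p : P) : 𝔸 := ∑' k, dysonTerm A k x p

variable {A : ℝ → P → 𝔸}

theorem dyson_zero (A : ℝ → P → 𝔸) (p : P) : dyson A 0 p = 1 := by
  rw [dyson, tsum_eq_single 0]
  · rfl
  · intro k hk
    obtain ⟨k, rfl⟩ := Nat.exists_eq_succ_of_ne_zero hk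
    exact intervalIntegral.integral_same

theorem norm_dysonTerm_le {M R : ℝ} {p : P} (hM : ∀ s, |s| ≤ R → ‖A s p‖ ≤ M) (k : ℕ) :
    ∀ x, |x| ≤ R → ‖dysonTerm A k x p‖ ≤ ‖(1 : 𝔸)‖ * ((M * |x|) ^ k / k.factorial) := by
  induction k with
  | zero => intro x _; simp [dysonTerm]
  | succ k ih =>
    intro x hx
    have hsub : ∀ s ∈ Set.uIoc 0 x, |s| ≤ |x| := fun s hs => by
      simpa using Set.abs_sub_left_of_mem_uIcc (Set.uIoc_subset_uIcc hs)
    have hbound : ∀ s ∈ Set.uIoc 0 x, ‖dysonTerm A k s p * A s p‖ ≤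
        ‖(1 : 𝔸)‖ * (M ^ (k + 1) / k.factorial) * |s - 0| ^ k := fun s hs => by
      have hs' := (hsub s hs).trans hx
      calc ‖dysonTerm A k s p * A s p‖ ≤ ‖dysonTerm A k s p‖ * ‖A s p‖ := norm_mul_le _ _
        _ ≤ (‖(1 : 𝔸)‖ * ((M * |s|) ^ k / k.factorial)) * M :=
          mul_le_mul (ih s hs') (hM s hs') (norm_nonneg _) ((norm_nonneg _).trans (ih s hs'))
        _ = _ := by rw [sub_zero, mul_pow]; ring
    have hint : IntegrableOn (fun s : ℝ => ‖(1 : 𝔸)‖ * (M ^ (k + 1) / k.factorial) * |s - 0| ^ k)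
        (Set.uIoc 0 x) :=
      (by fun_prop : Continuous fun s : ℝ =>
        ‖(1 : 𝔸)‖ * (M ^ (k + 1) / k.factorial) * |s - 0| ^ k).integrableOn_uIoc
    calc ‖dysonTerm A (k + 1) x p‖
        ≤ ∫ s in Set.uIoc 0 x, ‖dysonTerm A k s p * A s p‖ :=
          intervalIntegral.norm_integral_le_integral_norm_uIoc
      _ ≤ ∫ s in Set.uIoc 0 x, ‖(1 : 𝔸)‖ * (M ^ (k + 1) / k.factorial) * |s - 0| ^ k :=
          integral_mono_of_nonneg (Eventually.of_forall fun _ => norm_nonneg _) hint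
            ((ae_restrict_iff' measurableSet_uIoc).2 (Eventually.of_forall hbound))
      _ = ‖(1 : 𝔸)‖ * ((M * |x|) ^ (k + 1) / (k + 1).factorial) := by
          rw [integral_const_mul, integral_pow_abs_sub_uIoc, Nat.factorial_succ, mul_pow, sub_zero]
          push_cast
          field_simp

variable [TopologicalSpace P]

theorem continuous_dysonTerm (hA : Continuous fun q : ℝ × P => A q.1 q.2) (k : ℕ) :
    Continuous fun q : ℝ × P => dysonTerm A k q.1 q.2 := by
  induction k with
  | zero => exact continuous_const
  | succ k ih =>
    refine intervalIntegral.continuous_parametric_intervalIntegral_of_continuous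
      (f := fun (q : ℝ × P) s => dysonTerm A k s q.2 * A s q.2) ?_ continuous_fst
    have h : Continuous fun r : (ℝ × P) × ℝ => (r.2, r.1.2) := by fun_prop
    exact (ih.comp h).mul (hA.comp h)

theorem hasDerivAt_dysonTerm_succ [CompleteSpace 𝔸] (hA : Continuous fun q : ℝ × P => A q.1 q.2)
    (k : ℕ) (x : ℝ) (p : P) :
    HasDerivAt (fun y => dysonTerm A (k + 1) y p) (dysonTerm A k x p * A x p) x := by
  have hc : Continuous fun s => dysonTerm A k s p * A s p :=
    ((continuous_dysonTerm hA k).mul hA).comp (by fun_prop : Continuous fun s : ℝ => (s, p))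
  exact hc.integral_hasStrictDerivAt 0 x |>.hasDerivAt

variable [WeaklyLocallyCompactSpace P]

theorem exists_dyson_bound (hA : Continuous fun q : ℝ × P => A q.1 q.2) (R : ℝ) (p : P) :
    ∃ K ∈ 𝓝 p, ∃ M : ℝ, ∀ s, |s| ≤ R → ∀ q ∈ K, ‖A s q‖ ≤ M ∧
      ∀ k, ‖dysonTerm A k s q‖ ≤ ‖(1 : 𝔸)‖ * ((M * R) ^ k / k.factorial) := by
  obtain ⟨K, hK, hp⟩ := exists_compact_mem_nhds p
  obtain ⟨M, hM⟩ := ((isCompact_Icc (a := -R) (b := R)).prod hK).exists_bound_of_continuousOn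
    hA.continuousOn
  have hM' : ∀ s, |s| ≤ R → ∀ q ∈ K, ‖A s q‖ ≤ M := fun s hs q hq => hM (s, q) ⟨abs_le.1 hs, hq⟩
  refine ⟨K, hp, M, fun s hs q hq => ⟨hM' s hs q hq, fun k => ?_⟩⟩
  have hM0 : 0 ≤ M := (norm_nonneg _).trans (hM' s hs q hq)
  refine (norm_dysonTerm_le (R := R) (fun s hs => hM' s hs q hq) k s hs).trans ?_
  gcongr

variable [CompleteSpace 𝔸]

theorem continuous_dyson (hA : Continuous fun q : ℝ × P => A q.1 q.2) :
    Continuous fun q : ℝ × P => dyson A q.1 q.2 := by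
  refine continuous_iff_continuousAt.2 fun ⟨x, p⟩ => ?_
  obtain ⟨K, hK, M, h⟩ := exists_dyson_bound hA (|x| + 1) p
  have hs : Set.Icc (-(|x| + 1)) (|x| + 1) ∈ 𝓝 x :=
    Icc_mem_nhds (by linarith [neg_abs_le x]) (by linarith [le_abs_self x])
  refine ContinuousOn.continuousAt (s := Set.Icc (-(|x| + 1)) (|x| + 1) ×ˢ K) ?_
    (prod_mem_nhds hs hK)
  refine continuousOn_tsum (fun k => (continuous_dysonTerm hA k).continuousOn)
    ((Real.summable_pow_div_factorial (M * (|x| + 1))).mul_left ‖(1 : 𝔸)‖) ?_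
  rintro k ⟨s, q⟩ ⟨hs, hq⟩
  exact (h s (abs_le.2 hs) q hq).2 k

theorem summable_dysonTerm (hA : Continuous fun q : ℝ × P => A q.1 q.2) (x : ℝ) (p : P) :
    Summable fun k => dysonTerm A k x p := by
  obtain ⟨K, hK, M, h⟩ := exists_dyson_bound hA |x| p
  exact .of_norm_bounded ((Real.summable_pow_div_factorial (M * |x|)).mul_left ‖(1 : 𝔸)‖)
    fun k => (h x le_rfl p (mem_of_mem_nhds hK)).2 k

theorem dyson_eq_one_add_tsum (hA : Continuous fun q : ℝ × P => A q.1 q.2) (x : ℝ) (p : P) :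
    dyson A x p = 1 + ∑' k, dysonTerm A (k + 1) x p :=
  (summable_dysonTerm hA x p).tsum_eq_zero_add

theorem hasDerivAt_dyson (hA : Continuous fun q : ℝ × P => A q.1 q.2) (x : ℝ) (p : P) :
    HasDerivAt (fun y => dyson A y p) (dyson A x p * A x p) x := by
  obtain ⟨K, hK, M, h⟩ := exists_dyson_bound hA (|x| + 1) p
  have hxm : x ∈ Set.Ioo (-(|x| + 1)) (|x| + 1) := abs_lt.1 (by linarith)
  have hbound : ∀ k, ∀ y ∈ Set.Ioo (-(|x| + 1)) (|x| + 1), ‖dysonTerm A k y p * A y p‖ ≤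
      ‖(1 : 𝔸)‖ * ((M * (|x| + 1)) ^ k / k.factorial) * M := fun k y hy => by
    obtain ⟨hAy, hdy⟩ := h y (abs_lt.2 hy).le p (mem_of_mem_nhds hK)
    exact (norm_mul_le _ _).trans
      (mul_le_mul (hdy k) hAy (norm_nonneg _) ((norm_nonneg _).trans (hdy k)))
  have hsum := ((Real.summable_pow_div_factorial (M * (|x| + 1))).mul_left ‖(1 : 𝔸)‖).mul_right M
  have hderiv := hasDerivAt_tsum_of_isPreconnected hsum isOpen_Ioo isPreconnected_Ioo
    (fun k y _ => hasDerivAt_dysonTerm_succ hA k y p) hbound hxm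
    ((summable_nat_add_iff 1).2 (summable_dysonTerm hA x p)) hxm
  rw [(summable_dysonTerm hA x p).tsum_mul_right] at hderiv
  simp only [dyson_eq_one_add_tsum hA _ p]
  rw [← dyson_eq_one_add_tsum hA x p]
  exact hderiv.const_add 1

end LinearODE

/-! ### Fundamental solutions -/

/-- `Y` is the fundamental solution of the linear equation `Y' = Y A`, `Y(0) = 1`, whose
coefficient depends on a parameter, and `Z` is its inverse. -/
structure IsFundamentalSolution {P 𝔸 : Type*} [TopologicalSpace P] [NormedRing 𝔸]
    [NormedAlgebra ℝ 𝔸] (A Y Z : ℝ → P → 𝔸) : Prop where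
  continuous : Continuous fun q : ℝ × P => Y q.1 q.2
  continuous_inv : Continuous fun q : ℝ × P => Z q.1 q.2
  deriv : ∀ x p, HasDerivAt (fun y => Y y p) (Y x p * A x p) x
  deriv_inv : ∀ x p, HasDerivAt (fun y => Z y p) (-(A x p * Z x p)) x
  base : ∀ p, Y 0 p = 1
  mul_inv : ∀ x p, Y x p * Z x p = 1
  inv_mul : ∀ x p, Z x p * Y x p = 1

theorem hasDerivAt_of_sub_eq_smul {𝕜 E : Type*} [NontriviallyNormedField 𝕜] [NormedAddCommGroup E]
    [NormedSpace 𝕜 E] {f G : 𝕜 → E} {p : 𝕜} (h : ∀ q, f q - f p = (q - p) • G q)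
    (hG : ContinuousAt G p) : HasDerivAt f (G p) p := by
  rw [hasDerivAt_iff_tendsto_slope]
  refine (hG.tendsto.mono_left nhdsWithin_le_nhds).congr' ?_
  filter_upwards [self_mem_nhdsWithin] with q hq
  rw [slope_def_module, h, smul_smul, inv_mul_cancel₀ (sub_ne_zero.2 hq), one_smul]

/-- Hadamard's lemma. -/
theorem exists_continuous_difference_quotient {E : Type*} [NormedAddCommGroup E] [NormedSpace ℝ E]
    [CompleteSpace E] {f f' : ℝ → ℝ → E} (hf : ∀ x t, HasDerivAt (f x) (f' x t) t)
    (hc : Continuous fun q : ℝ × ℝ => f' q.1 q.2) (t : ℝ) :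
    ∃ D : ℝ → ℝ → E, (Continuous fun q : ℝ × ℝ => D q.1 q.2) ∧
      (∀ x s, f x s - f x t = (s - t) • D x s) ∧ ∀ x, D x t = f' x t := by
  refine ⟨fun x s => ∫ θ in (0 : ℝ)..1, f' x (t + θ * (s - t)), ?_, fun x s => ?_, fun x => ?_⟩
  · exact intervalIntegral.continuous_parametric_intervalIntegral_of_continuous'
      (f := fun (r : ℝ × ℝ) θ => f' r.1 (t + θ * (r.2 - t)))
      (hc.comp (by fun_prop : Continuous fun r : (ℝ × ℝ) × ℝ => (r.1.1, t + r.2 * (r.1.2 - t)))) 0 1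
  · have hpath : ∀ θ : ℝ, HasDerivAt (fun θ => f x (t + θ * (s - t)))
        ((s - t) • f' x (t + θ * (s - t))) θ := fun θ =>
      (hf x _).scomp θ (by simpa using ((hasDerivAt_id θ).mul_const (s - t)).const_add t)
    have hcont : Continuous fun θ : ℝ => f' x (t + θ * (s - t)) :=
      hc.comp (by fun_prop : Continuous fun θ : ℝ => (x, t + θ * (s - t)))
    have hFTC := intervalIntegral.integral_eq_sub_of_hasDerivAt (a := 0) (b := 1)
      (fun θ _ => hpath θ) ((hcont.const_smul (s - t)).intervalIntegrable _ _)
    rw [intervalIntegral.integral_smul] at hFTC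
    rw [hFTC]
    simp
  · simp

namespace IsFundamentalSolution

variable {P 𝔸 : Type*} [TopologicalSpace P] [NormedRing 𝔸] [NormedAlgebra ℝ 𝔸]

theorem comp {P' : Type*} [TopologicalSpace P'] {A Y Z : ℝ → P → 𝔸}
    (h : IsFundamentalSolution A Y Z) {φ : P' → P} (hφ : Continuous φ) :
    IsFundamentalSolution (fun x p => A x (φ p)) (fun x p => Y x (φ p)) fun x p => Z x (φ p) where
  continuous := h.continuous.comp (by fun_prop : Continuous fun q : ℝ × P' => (q.1, φ q.2))
  continuous_inv := h.continuous_inv.comp (by fun_prop : Continuous fun q : ℝ × P' => (q.1, φ q.2))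
  deriv x p := h.deriv x (φ p)
  deriv_inv x p := h.deriv_inv x (φ p)
  base p := h.base (φ p)
  mul_inv x p := h.mul_inv x (φ p)
  inv_mul x p := h.inv_mul x (φ p)

theorem inv_base {A Y Z : ℝ → P → 𝔸} (h : IsFundamentalSolution A Y Z) (p : P) : Z 0 p = 1 := by
  simpa only [h.base, one_mul] using h.mul_inv 0 p

variable [CompleteSpace 𝔸]

theorem sub_eq_smul_integral {𝕜 : Type*} [NontriviallyNormedField 𝕜] [NormedAlgebra 𝕜 𝔸]
    [SMulCommClass ℝ 𝕜 𝔸] {A Y Z D : ℝ → 𝕜 → 𝔸} {p : 𝕜} (h : IsFundamentalSolution A Y Z)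
    (hDc : Continuous fun q : ℝ × 𝕜 => D q.1 q.2)
    (hD : ∀ x q, A x q - A x p = (q - p) • D x q) (x : ℝ) (q : 𝕜) :
    Y x q - Y x p =
      (q - p) • ((∫ s in (0 : ℝ)..x, Y s q * D s q * Z s p) * Y x p) := by
  have hderiv : ∀ s, HasDerivAt (fun s => Y s q * Z s p)
      ((q - p) • (Y s q * D s q * Z s p)) s := fun s =>
    ((h.deriv s q).mul (h.deriv_inv s p)).congr_deriv (by
      rw [← smul_mul_assoc, ← mul_smul_comm, ← hD]
      noncomm_ring)
  have hcont : Continuous fun s => (q - p) • (Y s q * D s q * Z s p) :=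
    ((((h.continuous.mul hDc).comp (by fun_prop : Continuous fun s : ℝ => (s, q))).mul
      (h.continuous_inv.comp (by fun_prop : Continuous fun s : ℝ => (s, p))))).const_smul _
  have hFTC := intervalIntegral.integral_eq_sub_of_hasDerivAt (a := 0) (b := x)
    (fun s _ => hderiv s) (hcont.intervalIntegrable _ _)
  rw [intervalIntegral.integral_smul, h.base, h.inv_base, one_mul] at hFTC
  rw [← smul_mul_assoc, hFTC, sub_mul, one_mul, mul_assoc, h.inv_mul, mul_one]

theorem hasDerivAt_parameter {𝕜 : Type*} [NontriviallyNormedField 𝕜] [NormedAlgebra 𝕜 𝔸]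
    [SMulCommClass ℝ 𝕜 𝔸] {A Y Z D : ℝ → 𝕜 → 𝔸} {p : 𝕜} (h : IsFundamentalSolution A Y Z)
    (hDc : Continuous fun q : ℝ × 𝕜 => D q.1 q.2)
    (hD : ∀ x q, A x q - A x p = (q - p) • D x q) (x : ℝ) :
    HasDerivAt (Y x) ((∫ s in (0 : ℝ)..x, Y s p * D s p * Z s p) * Y x p) p := by
  refine hasDerivAt_of_sub_eq_smul
    (G := fun q => (∫ s in (0 : ℝ)..x, Y s q * D s q * Z s p) * Y x p)
    (h.sub_eq_smul_integral hDc hD x) (Continuous.continuousAt ?_)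
  have hcont : Continuous fun r : 𝕜 × ℝ => Y r.2 r.1 * D r.2 r.1 * Z r.2 p :=
    ((h.continuous.mul hDc).comp (by fun_prop : Continuous fun r : 𝕜 × ℝ => (r.2, r.1))).mul
      (h.continuous_inv.comp (by fun_prop : Continuous fun r : 𝕜 × ℝ => (r.2, p)))
  exact (intervalIntegral.continuous_parametric_intervalIntegral_of_continuous'
    (f := fun q s => Y s q * D s q * Z s p) hcont 0 x).mul continuous_const

/-- If `∂_x - A` and `∂_t - B` commute, then the fundamental solution in the `x`-direction is
parallel in the `t`-direction up to its value at `x = 0`. -/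
theorem hasDerivAt_of_zero_curvature {A B A' Y Z : ℝ → ℝ → 𝔸} (h : IsFundamentalSolution A Y Z)
    (hA : ∀ x t, HasDerivAt (A x) (A' x t) t) (hA' : Continuous fun q : ℝ × ℝ => A' q.1 q.2)
    (hB : ∀ x t, HasDerivAt (fun y => B y t) (B x t * A x t - A x t * B x t + A' x t) x)
    (x t : ℝ) : HasDerivAt (Y x) (Y x t * B x t - B 0 t * Y x t) t := by
  obtain ⟨D, hDc, hD, hDt⟩ := exists_continuous_difference_quotient hA hA' t
  refine (h.hasDerivAt_parameter hDc hD x).congr_deriv ?_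
  have hconj : ∀ s, HasDerivAt (fun s => Y s t * B s t * Z s t) (Y s t * D s t * Z s t) s :=
    fun s => (((h.deriv s t).fun_mul (hB s t)).fun_mul (h.deriv_inv s t)).congr_deriv (by
      rw [hDt]
      noncomm_ring)
  have hcont : Continuous fun s => Y s t * D s t * Z s t :=
    ((h.continuous.mul hDc).mul h.continuous_inv).comp
      (by fun_prop : Continuous fun s : ℝ => (s, t))
  rw [intervalIntegral.integral_eq_sub_of_hasDerivAt (fun s _ => hconj s)
    (hcont.intervalIntegrable _ _), h.base, h.inv_base, one_mul, mul_one, sub_mul, mul_assoc,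
    h.inv_mul, mul_one]

end IsFundamentalSolution

open MulOpposite in
theorem exists_isFundamentalSolution {P 𝔸 : Type*} [TopologicalSpace P]
    [WeaklyLocallyCompactSpace P] [NormedRing 𝔸] [NormedAlgebra ℝ 𝔸] [CompleteSpace 𝔸]
    [IsDedekindFiniteMonoid 𝔸] {A : ℝ → P → 𝔸} (hA : Continuous fun q : ℝ × P => A q.1 q.2) :
    ∃ Y Z : ℝ → P → 𝔸, IsFundamentalSolution A Y Z := by
  have hA' : Continuous fun q : ℝ × P => op (-A q.1 q.2) := continuous_op.comp hA.neg
  let Y := dyson A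
  let Z : ℝ → P → 𝔸 := fun x p => unop (dyson (fun s p => op (-A s p)) x p)
  have hY : ∀ x p, HasDerivAt (fun y => Y y p) (Y x p * A x p) x := hasDerivAt_dyson hA
  have hZ : ∀ x p, HasDerivAt (fun y => Z y p) (-(A x p * Z x p)) x := fun x p =>
    ((opContinuousLinearEquiv ℝ (M := 𝔸)).symm.hasFDerivAt.comp_hasDerivAt x
      (hasDerivAt_dyson hA' x p)).congr_deriv (by simp [Z])
  have hYZ : ∀ x p, Y x p * Z x p = 1 := fun x p => by
    have hconst : ∀ x, HasDerivAt (fun x => Y x p * Z x p) 0 x := fun x =>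
      ((hY x p).mul (hZ x p)).congr_deriv (by noncomm_ring)
    rw [is_const_of_deriv_eq_zero (fun y => (hconst y).differentiableAt)
      (fun y => (hconst y).deriv) x 0]
    simp [Y, Z, dyson_zero]
  exact ⟨Y, Z, continuous_dyson hA, continuous_unop.comp (continuous_dyson hA'), hY, hZ,
    dyson_zero A, hYZ, fun x p => mul_eq_one_comm.1 (hYZ x p)⟩

theorem hasMatDerivAt_iff_hasDerivAt {F : ℝ → Mat n} {F' : Mat n} {x : ℝ} :
    HasMatDerivAt F F' x ↔ HasDerivAt F F' x :=
  ⟨fun h => hasDerivAt_pi.2 fun i => hasDerivAt_pi.2 (h i),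
    fun h i => hasDerivAt_pi.1 (hasDerivAt_pi.1 h i)⟩

/-! ### Bounded and rapidly decreasing functions -/

/-- The bounded functions on the line. -/
def boundedFun : Submodule ℂ (ℝ → ℂ) where
  carrier := {f | ∃ C, ∀ x, ‖f x‖ ≤ C}
  add_mem' := by
    rintro f g ⟨C, hC⟩ ⟨D, hD⟩
    exact ⟨C + D, fun x => (norm_add_le _ _).trans (add_le_add (hC x) (hD x))⟩
  zero_mem' := ⟨0, fun x => by simp⟩
  smul_mem' := by
    rintro c f ⟨C, hC⟩
    refine ⟨‖c‖ * C, fun x => ?_⟩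
    rw [Pi.smul_apply, norm_smul]
    gcongr
    exact hC x

/-- The rapidly decreasing functions on the line. -/
def rapidFun : Submodule ℂ (ℝ → ℂ) where
  carrier := {f | ∀ N : ℕ, ∃ C, ∀ x, |x| ^ N * ‖f x‖ ≤ C}
  add_mem' := by
    intro f g hf hg N
    obtain ⟨C, hC⟩ := hf N
    obtain ⟨D, hD⟩ := hg N
    refine ⟨C + D, fun x => ?_⟩
    calc |x| ^ N * ‖f x + g x‖ ≤ |x| ^ N * (‖f x‖ + ‖g x‖) := by
          gcongr; exact norm_add_le _ _
      _ ≤ C + D := by rw [mul_add]; exact add_le_add (hC x) (hD x)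
  zero_mem' := fun _ => ⟨0, fun x => by simp⟩
  smul_mem' := by
    intro c f hf N
    obtain ⟨C, hC⟩ := hf N
    refine ⟨‖c‖ * C, fun x => ?_⟩
    rw [Pi.smul_apply, norm_smul, mul_left_comm]
    gcongr
    exact hC x

theorem boundedFun_mul_rapidFun {f g : ℝ → ℂ} (hf : f ∈ boundedFun) (hg : g ∈ rapidFun) :
    (fun x => f x * g x) ∈ rapidFun := by
  obtain ⟨C, hC⟩ := hf
  intro N
  obtain ⟨D, hD⟩ := hg N
  refine ⟨C * D, fun x => ?_⟩
  rw [norm_mul, mul_left_comm]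
  exact mul_le_mul (hC x) (hD x) (by positivity) ((norm_nonneg _).trans (hC x))

theorem rapidFun_mul_boundedFun {f g : ℝ → ℂ} (hf : f ∈ rapidFun) (hg : g ∈ boundedFun) :
    (fun x => f x * g x) ∈ rapidFun := by
  simpa only [mul_comm] using boundedFun_mul_rapidFun hg hf

theorem rapidFun_le_boundedFun : rapidFun ≤ boundedFun := fun f hf => by
  obtain ⟨C, hC⟩ := hf 0
  exact ⟨C, fun x => by simpa using hC x⟩

/-- `f` and its derivatives of order at most `m` lie in `K`. -/
def DerivsIn (K : Submodule ℂ (ℝ → ℂ)) : ℕ → (ℝ → ℂ) → Prop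
  | 0, f => f ∈ K
  | m + 1, f => f ∈ K ∧ Differentiable ℝ f ∧ DerivsIn K m (deriv f)

namespace DerivsIn

variable {K K₁ K₂ : Submodule ℂ (ℝ → ℂ)} {m : ℕ} {f g : ℝ → ℂ}

theorem mem (h : DerivsIn K m f) : f ∈ K := by
  cases m with
  | zero => exact h
  | succ m => exact h.1

theorem of_succ (h : DerivsIn K (m + 1) f) : DerivsIn K m f := by
  induction m generalizing f with
  | zero => exact h.1
  | succ m ih => exact ⟨h.1, h.2.1, ih h.2.2⟩

theorem mono (hK : K₁ ≤ K₂) (h : DerivsIn K₁ m f) : DerivsIn K₂ m f := by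
  induction m generalizing f with
  | zero => exact hK h
  | succ m ih => exact ⟨hK h.1, h.2.1, ih h.2.2⟩

theorem add (hf : DerivsIn K m f) (hg : DerivsIn K m g) : DerivsIn K m (fun x => f x + g x) := by
  induction m generalizing f g with
  | zero => exact K.add_mem hf hg
  | succ m ih =>
    refine ⟨K.add_mem hf.1 hg.1, hf.2.1.add hg.2.1, ?_⟩
    have : deriv (fun x => f x + g x) = fun x => deriv f x + deriv g x :=
      funext fun x => deriv_fun_add (hf.2.1 x) (hg.2.1 x)
    rw [this]
    exact ih hf.2.2 hg.2.2

theorem const_mul (c : ℂ) (hf : DerivsIn K m f) : DerivsIn K m (fun x => c * f x) := by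
  induction m generalizing f with
  | zero => exact K.smul_mem c hf
  | succ m ih =>
    refine ⟨K.smul_mem c hf.1, hf.2.1.const_mul c, ?_⟩
    have : deriv (fun x => c * f x) = fun x => c * deriv f x :=
      funext fun x => deriv_const_mul c (hf.2.1 x)
    rw [this]
    exact ih hf.2.2

theorem neg (hf : DerivsIn K m f) : DerivsIn K m (fun x => -f x) := by
  simpa using hf.const_mul (-1)

theorem sub (hf : DerivsIn K m f) (hg : DerivsIn K m g) : DerivsIn K m (fun x => f x - g x) := by
  simpa only [sub_eq_add_neg] using hf.add hg.neg

theorem zero : DerivsIn K m (fun _ => 0) := by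
  induction m with
  | zero => exact K.zero_mem
  | succ m ih => exact ⟨K.zero_mem, differentiable_const _, by simpa using ih⟩

theorem sum {ι : Type*} {s : Finset ι} {f : ι → ℝ → ℂ} (h : ∀ i ∈ s, DerivsIn K m (f i)) :
    DerivsIn K m (fun x => ∑ i ∈ s, f i x) := by
  classical
  induction s using Finset.induction_on with
  | empty => simpa using zero
  | insert i s hi ih =>
    simp only [Finset.sum_insert hi]
    exact (h i (Finset.mem_insert_self _ _)).add
      (ih fun k hk => h k (Finset.mem_insert_of_mem hk))

theorem mul {K₃ : Submodule ℂ (ℝ → ℂ)}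
    (hK : ∀ f ∈ K₁, ∀ g ∈ K₂, (fun x => f x * g x) ∈ K₃)
    (hf : DerivsIn K₁ m f) (hg : DerivsIn K₂ m g) : DerivsIn K₃ m (fun x => f x * g x) := by
  induction m generalizing f g with
  | zero => exact hK f hf g hg
  | succ m ih =>
    refine ⟨hK f hf.1 g hg.1, hf.2.1.mul hg.2.1, ?_⟩
    have : deriv (fun x => f x * g x) = fun x => deriv f x * g x + f x * deriv g x :=
      funext fun x => deriv_fun_mul (hf.2.1 x) (hg.2.1 x)
    rw [this]
    exact (ih hf.2.2 hg.of_succ).add (ih hf.of_succ hg.2.2)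

theorem const (c : ℂ) : DerivsIn boundedFun m (fun _ => c) := by
  cases m with
  | zero => exact ⟨‖c‖, fun _ => le_rfl⟩
  | succ m =>
    exact ⟨⟨‖c‖, fun _ => le_rfl⟩, differentiable_const _, by simpa using zero⟩

theorem contDiff (h : ∀ m, DerivsIn K m f) : ContDiff ℝ ∞ f := by
  rw [contDiff_infty]
  intro m
  induction m generalizing f with
  | zero => exact contDiff_zero.2 (h 1).2.1.continuous
  | succ m ih =>
    push_cast
    exact contDiff_succ_iff_deriv.2 ⟨(h 1).2.1, by simp, ih fun m => (h (m + 1)).2.2⟩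

theorem iteratedDeriv_mem (h : DerivsIn K m f) : iteratedDeriv m f ∈ K := by
  induction m generalizing f with
  | zero => simpa using h.mem
  | succ m ih => rw [iteratedDeriv_succ']; exact ih h.2.2

theorem of_schwartz (f : 𝓢(ℝ, ℂ)) (m : ℕ) : DerivsIn rapidFun m f := by
  induction m generalizing f with
  | zero =>
    intro N
    obtain ⟨C, _, hC⟩ := f.decay N 0
    exact ⟨C, fun x => by simpa using hC x⟩
  | succ m ih =>
    refine ⟨(ih f).mem, f.differentiable, ?_⟩
    exact ih (SchwartzMap.derivCLM ℝ ℂ f)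

theorem exists_schwartz (h : ∀ m, DerivsIn rapidFun m f) : ∃ F : 𝓢(ℝ, ℂ), ∀ x, F x = f x := by
  refine ⟨⟨f, contDiff h, fun k m => ?_⟩, fun x => rfl⟩
  obtain ⟨C, hC⟩ := (h m).iteratedDeriv_mem k
  refine ⟨C, fun x => ?_⟩
  rw [norm_iteratedFDeriv_eq_norm_iteratedDeriv]
  exact hC x

theorem integrable (h : ∀ m, DerivsIn rapidFun m f) : Integrable f := by
  obtain ⟨F, hF⟩ := exists_schwartz h
  exact (funext hF : (F : ℝ → ℂ) = f) ▸ F.integrable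

theorem hasDerivAt_integral_Iic (h : ∀ m, DerivsIn rapidFun m f) (x : ℝ) :
    HasDerivAt (fun x => ∫ y in Set.Iic x, f y) (f x) x := by
  have hsplit : (fun x => ∫ y in Set.Iic x, f y) =
      fun x => (∫ y in Set.Iic 0, f y) + ∫ y in (0 : ℝ)..x, f y := funext fun x => by
    rw [← intervalIntegral.integral_Iic_sub_Iic (integrable h).integrableOn
      (integrable h).integrableOn]
    ring
  rw [hsplit]
  exact ((contDiff h).continuous.integral_hasStrictDerivAt 0 x).hasDerivAt.const_add _

theorem integral_Iic (h : ∀ m, DerivsIn rapidFun m f) (m : ℕ) :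
    DerivsIn boundedFun m (fun x => ∫ y in Set.Iic x, f y) := by
  have hbdd : (fun x => ∫ y in Set.Iic x, f y) ∈ boundedFun :=
    ⟨∫ y, ‖f y‖, fun x => (norm_integral_le_integral_norm _).trans
      (setIntegral_le_integral (integrable h).norm (Eventually.of_forall fun y => norm_nonneg _))⟩
  have hd := hasDerivAt_integral_Iic h
  cases m with
  | zero => exact hbdd
  | succ m =>
    refine ⟨hbdd, fun x => (hd x).differentiableAt, ?_⟩
    rw [show deriv (fun x => ∫ y in Set.Iic x, f y) = f from funext fun x => (hd x).deriv]
    exact (h m).mono rapidFun_le_boundedFun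

end DerivsIn

/-- The entries of `F` and their derivatives of order at most `m` lie in `K`. -/
def MatDerivsIn (K : Submodule ℂ (ℝ → ℂ)) (m : ℕ) (F : ℝ → Mat n) : Prop :=
  ∀ i j, DerivsIn K m (fun x => F x i j)

namespace MatDerivsIn

variable {K K₁ K₂ : Submodule ℂ (ℝ → ℂ)} {m : ℕ} {F G : ℝ → Mat n}

theorem mono (hK : K₁ ≤ K₂) (h : MatDerivsIn K₁ m F) : MatDerivsIn K₂ m F :=
  fun i j => (h i j).mono hK

theorem add (hF : MatDerivsIn K m F) (hG : MatDerivsIn K m G) :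
    MatDerivsIn K m (fun x => F x + G x) := fun i j => (hF i j).add (hG i j)

theorem sub (hF : MatDerivsIn K m F) (hG : MatDerivsIn K m G) :
    MatDerivsIn K m (fun x => F x - G x) := fun i j => (hF i j).sub (hG i j)

theorem const (M : Mat n) : MatDerivsIn boundedFun m (fun _ => M) := fun i j => .const (M i j)

theorem mul {K₃ : Submodule ℂ (ℝ → ℂ)}
    (hK : ∀ f ∈ K₁, ∀ g ∈ K₂, (fun x => f x * g x) ∈ K₃)
    (hF : MatDerivsIn K₁ m F) (hG : MatDerivsIn K₂ m G) :
    MatDerivsIn K₃ m (fun x => F x * G x) := fun i j => by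
  simp only [Matrix.mul_apply]
  exact .sum fun k _ => (hF i k).mul hK (hG k j)

theorem bounded_mul_rapid (hF : MatDerivsIn boundedFun m F) (hG : MatDerivsIn rapidFun m G) :
    MatDerivsIn rapidFun m (fun x => F x * G x) :=
  hF.mul (fun _ hf _ hg => boundedFun_mul_rapidFun hf hg) hG

theorem rapid_mul_bounded (hF : MatDerivsIn rapidFun m F) (hG : MatDerivsIn boundedFun m G) :
    MatDerivsIn rapidFun m (fun x => F x * G x) :=
  hF.mul (fun _ hf _ hg => rapidFun_mul_boundedFun hf hg) hG

theorem succ {F' : ℝ → Mat n} (hF : MatDerivsIn K 0 F) (hd : ∀ x, HasMatDerivAt F (F' x) x)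
    (hF' : MatDerivsIn K m F') : MatDerivsIn K (m + 1) F := fun i j => by
  refine ⟨hF i j, fun x => (hd x i j).differentiableAt, ?_⟩
  rw [show deriv (fun x => F x i j) = fun x => F' x i j from funext fun x => (hd x i j).deriv]
  exact hF' i j

theorem hasMatDerivAt (h : MatDerivsIn K (m + 1) F) (x : ℝ) :
    HasMatDerivAt F (matDeriv F x) x := fun i j => ((h i j).2.1 x).hasDerivAt

theorem matDeriv (h : MatDerivsIn K (m + 1) F) : MatDerivsIn K m (matDeriv F) :=
  fun i j => (h i j).2.2

end MatDerivsIn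

theorem isSchwartz_iff {F : ℝ → Mat n} : IsSchwartz F ↔ ∀ m, MatDerivsIn rapidFun m F := by
  refine ⟨fun h m i j => ?_, fun h i j => DerivsIn.exists_schwartz fun m => h m i j⟩
  obtain ⟨f, hf⟩ := h i j
  rw [← show (f : ℝ → ℂ) = fun x => F x i j from funext hf]
  exact .of_schwartz f m

/-! ### Power series with matrix coefficients that depend on a variable -/

/-- The power series of matrix-valued functions `F` has coefficientwise derivative `F'` at `x`. -/
def HasSeriesDerivAt (F : ℝ → PowerSeries (Mat n)) (F' : PowerSeries (Mat n)) (x : ℝ) : Prop :=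
  ∀ k, HasMatDerivAt (fun y => coeff k (F y)) (coeff k F') x

namespace HasSeriesDerivAt

variable {F G : ℝ → PowerSeries (Mat n)} {F' G' : PowerSeries (Mat n)} {x : ℝ}

theorem const (M : PowerSeries (Mat n)) (x : ℝ) : HasSeriesDerivAt (fun _ => M) 0 x := fun k => by
  simpa using HasMatDerivAt.const (coeff k M) x

theorem mul (hF : HasSeriesDerivAt F F' x) (hG : HasSeriesDerivAt G G' x) :
    HasSeriesDerivAt (fun y => F y * G y) (F' * G x + F x * G') x := fun k => by
  simp only [PowerSeries.coeff_mul, map_add, ← Finset.sum_add_distrib]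
  exact .sum fun p _ => (hF p.1).mul (hG p.2)

theorem unique (hF : HasSeriesDerivAt F F' x) (hG : HasSeriesDerivAt F G' x) : F' = G' :=
  PowerSeries.ext fun k => (hF k).unique (hG k)

theorem congr_deriv (hF : HasSeriesDerivAt F F' x) (h : F' = G') : HasSeriesDerivAt F G' x :=
  h ▸ hF

theorem exists_invOfUnit (hF : HasSeriesDerivAt F F' x) :
    ∃ W', HasSeriesDerivAt (fun y => invOfUnit (F y) 1) W' x := by
  suffices hd : ∀ k, ∃ D, HasMatDerivAt (fun y => coeff k (invOfUnit (F y) 1)) D x by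
    choose D hD using hd
    exact ⟨PowerSeries.mk D, fun k => by simpa using hD k⟩
  intro k
  induction k using Nat.strong_induction_on with
  | _ k ih =>
    rcases Nat.eq_zero_or_pos k with rfl | hk
    · exact ⟨0, by simpa using HasMatDerivAt.const 1 x⟩
    choose! D hD using ih
    have hrec : ∀ y, coeff k (invOfUnit (F y) 1) = -1 * ∑ p ∈ Finset.HasAntidiagonal.antidiagonal k,
        if p.2 < k then coeff p.1 (F y) * coeff p.2 (invOfUnit (F y) 1) else 0 := fun y => by
      rw [PowerSeries.coeff_invOfUnit, if_neg hk.ne', inv_one, Units.val_one]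
    simp only [hrec]
    refine ⟨_, .const_mul (-1) (.sum (F' := fun p => if p.2 < k then
      coeff p.1 F' * coeff p.2 (invOfUnit (F x) 1) + coeff p.1 (F x) * D p.2 else 0) fun p _ => ?_)⟩
    split_ifs with hp
    · exact (hF p.1).mul (hD p.2 hp)
    · exact .const _ x

theorem inv (h1 : ∀ y, constantCoeff (F y) = 1) (hF : HasSeriesDerivAt F F' x) :
    HasSeriesDerivAt (fun y => invOfUnit (F y) 1)
      (-(invOfUnit (F x) 1 * F' * invOfUnit (F x) 1)) x := by
  obtain ⟨W', hW⟩ := hF.exists_invOfUnit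
  refine hW.congr_deriv ?_
  have hprod : HasSeriesDerivAt (fun y => F y * invOfUnit (F y) 1) 0 x := by
    simpa only [fun y => mul_invOfUnit (F y) 1 (h1 y)] using const 1 x
  have hzero : F' * invOfUnit (F x) 1 + F x * W' = 0 := (hF.mul hW).unique hprod
  calc W' = invOfUnit (F x) 1 * F x * W' := by rw [invOfUnit_mul _ _ (h1 x), one_mul]
    _ = invOfUnit (F x) 1 * (F' * invOfUnit (F x) 1 + F x * W') -
          invOfUnit (F x) 1 * F' * invOfUnit (F x) 1 := by noncomm_ring
    _ = _ := by rw [hzero, mul_zero, zero_sub]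

end HasSeriesDerivAt

/-! ### Intertwiners of Lax operators -/

/-- The operator `a λ + u`, multiplied by `X = λ⁻¹`. -/
def laxSeries (a : Fin n → ℂ) (u : Mat n) : PowerSeries (Mat n) :=
  C (Matrix.diagonal a) + C u * X

/-- The power series `K` in `X = λ⁻¹` intertwines two Lax operators:
`K (∂ + aλ + u) = (∂ + aλ + v) K`, that is, `K_x = K (aλ + u) - (aλ + v) K`. This equation is
multiplied by `X`, so that it only involves power series. -/
def IsIntertwiner (a : Fin n → ℂ) (u v : ℝ → Mat n) (K : ℝ → PowerSeries (Mat n)) : Prop :=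
  ∀ x, ∃ K', HasSeriesDerivAt K K' x ∧
    K' * X = K x * laxSeries a (u x) - laxSeries a (v x) * K x

theorem mul_mul_X_comm (φ ψ : PowerSeries (Mat n)) : φ * ψ * X = φ * X * ψ := by
  rw [mul_assoc, ← PowerSeries.X_mul, mul_assoc]

theorem mul_laxSeries_sub (a : Fin n → ℂ) (u v : Mat n) (K : PowerSeries (Mat n)) :
    K * laxSeries a u - laxSeries a v * K =
      K * C (Matrix.diagonal a) - C (Matrix.diagonal a) * K + (K * C u - C v * K) * X := by
  rw [laxSeries, laxSeries, add_mul, ← mul_mul_X_comm]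
  noncomm_ring

theorem isIntertwiner_iff {a : Fin n → ℂ} {u v : ℝ → Mat n} {K : ℝ → PowerSeries (Mat n)} :
    IsIntertwiner a u v K ↔
      (∀ x, coeff 0 (K x) * Matrix.diagonal a = Matrix.diagonal a * coeff 0 (K x)) ∧
      ∀ k x, HasMatDerivAt (fun y => coeff k (K y))
        (coeff (k + 1) (K x) * Matrix.diagonal a - Matrix.diagonal a * coeff (k + 1) (K x) +
          (coeff k (K x) * u x - v x * coeff k (K x))) x := by
  constructor
  · refine fun h => ⟨fun x => ?_, fun k x => ?_⟩ <;> obtain ⟨K', hK', hX⟩ := h x <;>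
      rw [mul_laxSeries_sub] at hX
    · have h0 := congrArg (coeff 0) hX
      simp only [map_add, map_sub, PowerSeries.coeff_zero_mul_X, PowerSeries.coeff_mul_C,
        PowerSeries.coeff_C_mul, add_zero] at h0
      exact (sub_eq_zero.1 h0.symm)
    · refine (hK' k).congr_deriv ?_
      rw [← PowerSeries.coeff_succ_mul_X, hX, map_add, PowerSeries.coeff_succ_mul_X]
      simp only [map_sub, PowerSeries.coeff_mul_C, PowerSeries.coeff_C_mul]
  · rintro ⟨h0, hd⟩ x
    refine ⟨PowerSeries.mk fun k => coeff (k + 1) (K x) * Matrix.diagonal a -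
      Matrix.diagonal a * coeff (k + 1) (K x) + (coeff k (K x) * u x - v x * coeff k (K x)),
      fun k => by simpa only [PowerSeries.coeff_mk] using hd k x, PowerSeries.ext fun k => ?_⟩
    rw [mul_laxSeries_sub]
    cases k with
    | zero =>
      simp only [map_add, map_sub, PowerSeries.coeff_zero_mul_X, PowerSeries.coeff_mul_C,
        PowerSeries.coeff_C_mul, add_zero, h0, sub_self]
    | succ k =>
      simp only [map_add, map_sub, PowerSeries.coeff_succ_mul_X, PowerSeries.coeff_mk,
        PowerSeries.coeff_mul_C, PowerSeries.coeff_C_mul]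

namespace IsIntertwiner

variable {a : Fin n → ℂ} {u v w : ℝ → Mat n} {K L : ℝ → PowerSeries (Mat n)}

theorem mul (hL : IsIntertwiner a v w L) (hK : IsIntertwiner a u v K) :
    IsIntertwiner a u w fun x => L x * K x := fun x => by
  obtain ⟨L', hL', hLX⟩ := hL x
  obtain ⟨K', hK', hKX⟩ := hK x
  refine ⟨_, hL'.mul hK', ?_⟩
  calc (L' * K x + L x * K') * X = L' * X * K x + L x * (K' * X) := by
        rw [add_mul, mul_mul_X_comm, mul_assoc (L x)]
    _ = L x * K x * laxSeries a (u x) - laxSeries a (w x) * (L x * K x) := by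
        rw [hLX, hKX]; noncomm_ring

theorem inv (h1 : ∀ x, constantCoeff (K x) = 1) (hK : IsIntertwiner a u v K) :
    IsIntertwiner a v u fun x => invOfUnit (K x) 1 := fun x => by
  obtain ⟨K', hK', hKX⟩ := hK x
  refine ⟨_, hK'.inv h1, ?_⟩
  have hWK := invOfUnit_mul (K x) 1 (h1 x)
  have hKW := mul_invOfUnit (K x) 1 (h1 x)
  beta_reduce
  generalize invOfUnit (K x) 1 = W at *
  calc -(W * K' * W) * X = -(W * (K' * X) * W) := by
        rw [neg_mul, mul_mul_X_comm, mul_assoc W K']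
    _ = -((W * K x) * laxSeries a (u x) * W - W * laxSeries a (v x) * (K x * W)) := by
        rw [hKX]; noncomm_ring
    _ = W * laxSeries a (v x) - laxSeries a (u x) * W := by rw [hWK, hKW]; noncomm_ring

theorem zero_C {M : Mat n} (hM : M * Matrix.diagonal a = Matrix.diagonal a * M) :
    IsIntertwiner a 0 0 fun _ => C M :=
  isIntertwiner_iff.2 ⟨fun _ => by simpa using hM, fun k x =>
    (HasMatDerivAt.const _ x).congr_deriv (by simp [PowerSeries.coeff_succ_C])⟩

theorem one_add_C_mul_X {S : ℝ → Mat n} (hS : ∀ x, HasMatDerivAt S (S x * u x - v x * S x) x)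
    (huv : ∀ x, v x = u x + (S x * Matrix.diagonal a - Matrix.diagonal a * S x)) :
    IsIntertwiner a u v fun x => 1 + C (S x) * X := by
  refine isIntertwiner_iff.2 ⟨fun x => by simp, fun k x => ?_⟩
  match k with
  | 0 => simpa [PowerSeries.coeff_one, PowerSeries.coeff_succ_mul_X, huv x] using
      HasMatDerivAt.const 1 x
  | 1 => simpa [PowerSeries.coeff_one, PowerSeries.coeff_succ_mul_X, PowerSeries.coeff_succ_C]
      using hS x
  | k + 2 => simpa [PowerSeries.coeff_one, PowerSeries.coeff_succ_mul_X, PowerSeries.coeff_succ_C]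
      using HasMatDerivAt.const 0 x

end IsIntertwiner

/-! ### The phase space, entry by entry -/

theorem centralizerPerp_apply_eq_zero {a : Fin n → ℂ} {y : Mat n} (hy : y ∈ centralizerPerp a)
    {i j : Fin n} (hij : a i = a j) : y i j = 0 := by
  let z : Mat n := Matrix.single i j (y i j) - Matrix.single j i (conj (y i j))
  have hz : zᴴ = -z := by
    simp [z, Matrix.conjTranspose_sub, Matrix.conjTranspose_single]
  have hcomm : Matrix.diagonal a * z = z * Matrix.diagonal a := by
    ext k l
    simp only [z, Matrix.diagonal_mul, Matrix.mul_diagonal, Matrix.sub_apply, Matrix.single_apply]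
    grind
  have hyji : y j i = -conj (y i j) := by
    rw [eq_neg_iff_add_eq_zero, add_comm, ← eq_neg_iff_add_eq_zero]
    exact congrFun (congrFun hy.1 j) i
  have htr : (z * y).trace = -2 * (Complex.normSq (y i j) : ℂ) := by
    simp only [z, Matrix.sub_mul, Matrix.trace_sub, Matrix.trace_single_mul, smul_eq_mul, hyji,
      Complex.normSq_eq_conj_mul_self]
    ring
  simpa [htr] using hy.2 z hz hcomm

theorem mem_centralizerPerp {a : Fin n → ℂ} {y : Mat n} (hy : yᴴ = -y)
    (h : ∀ i j, a i = a j → y i j = 0) : y ∈ centralizerPerp a := by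
  refine ⟨hy, fun z _ hz => ?_⟩
  simp only [Matrix.trace, Matrix.diag_apply, Matrix.mul_apply]
  refine Finset.sum_eq_zero fun i _ => Finset.sum_eq_zero fun j _ => ?_
  by_cases hij : a j = a i
  · rw [h j i hij, mul_zero]
  · have hzij := congrFun (congrFun hz i) j
    rw [Matrix.diagonal_mul, Matrix.mul_diagonal] at hzij
    have hmul : (a j - a i) * z i j = 0 := by linear_combination -hzij
    rw [(mul_eq_zero.1 hmul).resolve_left (sub_ne_zero.2 hij), zero_mul]

/-- `u` belongs to the Schwartz class `𝓢(ℝ, u(n)_a^⊥)`, the phase space of the hierarchy. -/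
structure IsPotential (a : Fin n → ℂ) (u : ℝ → Mat n) : Prop where
  schwartz : IsSchwartz u
  mem_perp : ∀ x, u x ∈ centralizerPerp a

theorem IsSolution.isPotential {a : Fin n → ℂ} {b : Mat n} {j : ℕ} {u : ℝ → ℝ → Mat n}
    (hu : IsSolution a b j u) (t : ℝ) : IsPotential a fun x => u x t :=
  ⟨hu.schwartz t, fun x => hu.mem_perp x t⟩

/-! ### The expansion of the reduced wave function -/

section Wave

variable {a : Fin n → ℂ} {u : ℝ → Mat n}

theorem waveOff_derivsIn (hu : IsSchwartz u) {m : ℝ → Mat n}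
    (hm : ∀ r, MatDerivsIn boundedFun r m) (r : ℕ) : MatDerivsIn boundedFun r (waveOff a u m) := by
  intro i j
  simp only [waveOff, Matrix.of_apply]
  split_ifs with hij
  · exact .zero
  · have hmu := ((hm r).bounded_mul_rapid (isSchwartz_iff.1 hu r)).mono rapidFun_le_boundedFun
    have hdiff := ((hmu i j).sub ((hm (r + 1)).matDeriv i j)).const_mul (a i - a j)⁻¹
    simpa only [div_eq_inv_mul] using hdiff

theorem waveOff_mul_derivsIn (hu : IsSchwartz u) {m : ℝ → Mat n}
    (hm : ∀ r, MatDerivsIn boundedFun r m) (r : ℕ) :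
    MatDerivsIn rapidFun r fun x => waveOff a u m x * u x :=
  (waveOff_derivsIn hu hm r).bounded_mul_rapid (isSchwartz_iff.1 hu r)

theorem waveCoeff_derivsIn (hu : IsSchwartz u) (k r : ℕ) :
    MatDerivsIn boundedFun r (waveCoeff a u k) := by
  induction k generalizing r with
  | zero => exact .const 1
  | succ k ih =>
    refine (waveOff_derivsIn hu ih r).add fun i j => ?_
    simp only [Matrix.of_apply]
    split_ifs with hij
    · exact .integral_Iic (fun r => waveOff_mul_derivsIn hu ih r i j) r
    · exact .zero

theorem waveCoeff_succ_apply_of_ne (k : ℕ) (x : ℝ) {i j : Fin n} (hij : a i ≠ a j) :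
    waveCoeff a u (k + 1) x i j =
      ((waveCoeff a u k x * u x) i j - matDeriv (waveCoeff a u k) x i j) / (a i - a j) := by
  simp [waveCoeff, waveOff, hij]

theorem waveCoeff_succ_apply_of_eq (k : ℕ) (x : ℝ) {i j : Fin n} (hij : a i = a j) :
    waveCoeff a u (k + 1) x i j =
      ∫ y in Set.Iic x, (waveOff a u (waveCoeff a u k) y * u y) i j := by
  simp [waveCoeff, waveOff, hij]

theorem waveCoeff_succ_mul_apply_of_eq (hu : IsPotential a u) (k : ℕ) (x : ℝ) {i j : Fin n}
    (hij : a i = a j) : (waveCoeff a u (k + 1) x * u x) i j =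
      (waveOff a u (waveCoeff a u k) x * u x) i j := by
  simp only [waveCoeff, Matrix.add_mul, Matrix.add_apply, add_eq_left]
  rw [Matrix.mul_apply]
  refine Finset.sum_eq_zero fun l _ => ?_
  simp only [Matrix.of_apply]
  split_ifs with hil
  · rw [centralizerPerp_apply_eq_zero (hu.mem_perp x) (hil.symm.trans hij), mul_zero]
  · rw [zero_mul]

theorem hasDerivAt_waveCoeff_of_eq (hu : IsPotential a u) (k : ℕ) (x : ℝ) {i j : Fin n}
    (hij : a i = a j) :
    HasDerivAt (fun y => waveCoeff a u k y i j) ((waveCoeff a u k x * u x) i j) x := by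
  cases k with
  | zero =>
    have hzero : (waveCoeff a u 0 x * u x) i j = 0 := by
      simp [waveCoeff, centralizerPerp_apply_eq_zero (hu.mem_perp x) hij]
    rw [hzero]
    exact hasDerivAt_const _ _
  | succ k =>
    rw [waveCoeff_succ_mul_apply_of_eq hu k x hij]
    simp only [waveCoeff_succ_apply_of_eq k _ hij]
    exact DerivsIn.hasDerivAt_integral_Iic (fun r => waveOff_mul_derivsIn hu.schwartz
      (waveCoeff_derivsIn hu.schwartz k) r i j) x

theorem hasMatDerivAt_waveCoeff (hu : IsPotential a u) (k : ℕ) (x : ℝ) :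
    HasMatDerivAt (waveCoeff a u k) (waveCoeff a u (k + 1) x * Matrix.diagonal a -
      Matrix.diagonal a * waveCoeff a u (k + 1) x + waveCoeff a u k x * u x) x := by
  intro i j
  simp only [Matrix.add_apply, Matrix.sub_apply, Matrix.diagonal_mul, Matrix.mul_diagonal]
  by_cases hij : a i = a j
  · refine (hasDerivAt_waveCoeff_of_eq hu k x hij).congr_deriv ?_
    rw [hij]
    ring
  · refine ((waveCoeff_derivsIn hu.schwartz k 1).hasMatDerivAt x i j).congr_deriv ?_
    have : a i - a j ≠ 0 := sub_ne_zero.2 hij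
    rw [waveCoeff_succ_apply_of_ne k x hij]
    field_simp
    ring

theorem constantCoeff_waveSeries (u : ℝ → Mat n) (x : ℝ) :
    constantCoeff (waveSeries a u x) = 1 := by
  simp [waveSeries, waveCoeff]

theorem isIntertwiner_waveSeries (hu : IsPotential a u) : IsIntertwiner a u 0 (waveSeries a u) := by
  refine isIntertwiner_iff.2 ⟨fun x => by simp [constantCoeff_waveSeries], fun k x => ?_⟩
  simpa [waveSeries] using hasMatDerivAt_waveCoeff hu k x

end Wave

/-! ### The series `m⁻¹ b m` -/

/-- The power series `m⁻¹ b m`, whose coefficients are the `Q_{b,k}(u)`. -/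
def qSeries (a : Fin n → ℂ) (b : Mat n) (u : ℝ → Mat n) (x : ℝ) : PowerSeries (Mat n) :=
  invOfUnit (waveSeries a u x) 1 * C b * waveSeries a u x

section QSeries

variable {a : Fin n → ℂ} {b : Mat n} {u : ℝ → Mat n}

theorem coeff_zero_qSeries (x : ℝ) : coeff 0 (qSeries a b u x) = b := by
  simp [qSeries, constantCoeff_waveSeries]

theorem isIntertwiner_qSeries (hb : b * Matrix.diagonal a = Matrix.diagonal a * b)
    (hu : IsPotential a u) : IsIntertwiner a u u (qSeries a b u) := by
  have hm := isIntertwiner_waveSeries hu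
  exact ((hm.inv (constantCoeff_waveSeries u)).mul (.zero_C hb)).mul hm

theorem qSeries_mul_self (hb : b * b = b) (x : ℝ) :
    qSeries a b u x * qSeries a b u x = qSeries a b u x := by
  have hm := mul_invOfUnit _ 1 (constantCoeff_waveSeries (a := a) u x)
  unfold qSeries
  generalize waveSeries a u x = m at hm ⊢
  calc invOfUnit m 1 * C b * m * (invOfUnit m 1 * C b * m)
      = invOfUnit m 1 * (C b * (m * invOfUnit m 1) * C b) * m := by noncomm_ring
    _ = invOfUnit m 1 * C b * m := by rw [hm, mul_one, ← map_mul, hb]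

theorem qSeries_sum_smul {ι : Type*} (s : Finset ι) (β : ι → ℂ) (e : ι → Mat n) (x : ℝ) :
    qSeries a (∑ c ∈ s, β c • e c) u x = ∑ c ∈ s, β c • qSeries a (e c) u x := by
  have hsmul (z : ℂ) (M : Mat n) : C (z • M) = z • C M :=
    PowerSeries.ext fun k => by cases k <;> simp [PowerSeries.coeff_C]
  simp only [qSeries, map_sum, hsmul, Finset.mul_sum, Finset.sum_mul, mul_smul_comm, smul_mul_assoc]

end QSeries

/-! ### Spectral projections -/

/-- The spectral projection of `diag(a₁, …, aₙ)` for the eigenvalue `c`. -/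
def specProj (a : Fin n → ℂ) (c : ℂ) : Mat n := Matrix.diagonal fun i => if a i = c then 1 else 0

theorem specProj_mul_self (a : Fin n → ℂ) (c : ℂ) : specProj a c * specProj a c = specProj a c := by
  simp [specProj, Matrix.diagonal_mul_diagonal]

theorem specProj_comm (a : Fin n → ℂ) (c : ℂ) :
    specProj a c * Matrix.diagonal a = Matrix.diagonal a * specProj a c := by
  simp [specProj, Matrix.diagonal_mul_diagonal, mul_comm]

theorem conjTranspose_specProj (a : Fin n → ℂ) (c : ℂ) : (specProj a c)ᴴ = specProj a c := by
  rw [specProj, Matrix.diagonal_conjTranspose]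
  congr 1
  ext i
  simp [apply_ite]

theorem conjTranspose_diagonal {a : Fin n → ℂ} (ha : ∀ i, (a i).re = 0) :
    (Matrix.diagonal a)ᴴ = -Matrix.diagonal a := by
  rw [Matrix.diagonal_conjTranspose, Matrix.diagonal_neg]
  congr 1
  exact funext fun i => Complex.ext (by simp [ha i]) (by simp)

/-- `P` is an idempotent power series in `λ⁻¹`, with constant term `e`, which commutes with
`∂ + aλ + u`. -/
structure IsLaxProjection (a : Fin n → ℂ) (e : Mat n) (u : ℝ → Mat n)
    (P : ℝ → PowerSeries (Mat n)) : Prop where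
  coeff_zero : ∀ x, coeff 0 (P x) = e
  idem : ∀ x, P x * P x = P x
  intertwines : IsIntertwiner a u u P

theorem isLaxProjection_qSeries {a : Fin n → ℂ} (c : ℂ) {u : ℝ → Mat n} (hu : IsPotential a u) :
    IsLaxProjection a (specProj a c) u (qSeries a (specProj a c) u) :=
  ⟨coeff_zero_qSeries, qSeries_mul_self (specProj_mul_self a c),
    isIntertwiner_qSeries (specProj_comm a c) hu⟩

theorem IsLaxProjection.conj {a : Fin n → ℂ} {e : Mat n} {u v : ℝ → Mat n}
    {P K : ℝ → PowerSeries (Mat n)} (hP : IsLaxProjection a e u P) (hK : IsIntertwiner a u v K)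
    (h1 : ∀ x, constantCoeff (K x) = 1) :
    IsLaxProjection a e v fun x => K x * P x * invOfUnit (K x) 1 where
  coeff_zero x := by
    have h0 := hP.coeff_zero x
    rw [PowerSeries.coeff_zero_eq_constantCoeff_apply] at h0 ⊢
    simp [h1, h0]
  idem x := by
    calc K x * P x * invOfUnit (K x) 1 * (K x * P x * invOfUnit (K x) 1)
        = K x * P x * (invOfUnit (K x) 1 * K x) * P x * invOfUnit (K x) 1 := by noncomm_ring
      _ = K x * (P x * P x) * invOfUnit (K x) 1 := by
        rw [invOfUnit_mul _ _ (h1 x)]; noncomm_ring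
      _ = K x * P x * invOfUnit (K x) 1 := by rw [hP.idem]
  intertwines := (hK.mul hP.intertwines).mul (hK.inv h1)

/-! ### Lax projections are determined by local formulas -/

section Local

variable {a : Fin n → ℂ} {c : ℂ} {u : ℝ → Mat n} {P P' : ℝ → PowerSeries (Mat n)}

namespace IsLaxProjection

theorem coeff_succ_of_ne {e : Mat n} (hP : IsLaxProjection a e u P) (k : ℕ) (x : ℝ) {i j : Fin n}
    (hij : a i ≠ a j) : coeff (k + 1) (P x) i j =
      (deriv (fun y => coeff k (P y) i j) x - (coeff k (P x) * u x - u x * coeff k (P x)) i j) *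
        (a j - a i)⁻¹ := by
  rw [((isIntertwiner_iff.1 hP.intertwines).2 k x i j).deriv, Matrix.add_apply,
    add_sub_cancel_right, Matrix.sub_apply, Matrix.mul_diagonal, Matrix.diagonal_mul]
  have : a j - a i ≠ 0 := sub_ne_zero.2 hij.symm
  field_simp

-- On the block `a i = a j`, the coefficient enters `P * P = P` as `e p + p e - p = ± p`.
theorem coeff_succ_of_eq (hP : IsLaxProjection a (specProj a c) u P) (k : ℕ) (x : ℝ) {i j : Fin n}
    (hij : a i = a j) : coeff (k + 1) (P x) i j =
      (if a i = c then -1 else 1) *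
        (∑ l ∈ Finset.range k, coeff (l + 1) (P x) * coeff (k - l) (P x)) i j := by
  have hidem := congrArg (coeff (k + 1)) (hP.idem x)
  rw [PowerSeries.coeff_mul, Finset.Nat.sum_antidiagonal_eq_sum_range_succ
    (fun p q => coeff p (P x) * coeff q (P x)), Finset.sum_range_succ,
    Finset.sum_range_succ'] at hidem
  simp only [Nat.sub_self, Nat.sub_zero, hP.coeff_zero, Nat.add_sub_add_right] at hidem
  have hidem_ij := congrFun (congrFun hidem i) j
  simp only [Matrix.add_apply, specProj, Matrix.diagonal_mul, Matrix.mul_diagonal] at hidem_ij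
  rw [← hij] at hidem_ij
  split_ifs at hidem_ij ⊢ with hc
  · linear_combination hidem_ij
  · linear_combination -hidem_ij

theorem coeff_unique (hP : IsLaxProjection a (specProj a c) u P)
    (hP' : IsLaxProjection a (specProj a c) u P') (k : ℕ) (x : ℝ) :
    coeff k (P x) = coeff k (P' x) := by
  induction k using Nat.strong_induction_on generalizing x with
  | _ k ih =>
    cases k with
    | zero => rw [hP.coeff_zero, hP'.coeff_zero]
    | succ k =>
      ext i j
      by_cases hij : a i = a j
      · have hsum : ∑ l ∈ Finset.range k, coeff (l + 1) (P x) * coeff (k - l) (P x) =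
            ∑ l ∈ Finset.range k, coeff (l + 1) (P' x) * coeff (k - l) (P' x) := by
          refine Finset.sum_congr rfl fun l hl => ?_
          have hl := Finset.mem_range.1 hl
          rw [ih (l + 1) (by omega), ih (k - l) (by omega)]
        rw [hP.coeff_succ_of_eq k x hij, hP'.coeff_succ_of_eq k x hij, hsum]
      · rw [hP.coeff_succ_of_ne k x hij, hP'.coeff_succ_of_ne k x hij]
        simp only [ih k k.lt_succ_self]

theorem unique (hP : IsLaxProjection a (specProj a c) u P)
    (hP' : IsLaxProjection a (specProj a c) u P') (x : ℝ) : P x = P' x :=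
  PowerSeries.ext fun k => hP.coeff_unique hP' k x

theorem conjTranspose (ha : ∀ i, (a i).re = 0) (hu : ∀ x, (u x)ᴴ = -u x)
    (hP : IsLaxProjection a (specProj a c) u P) :
    IsLaxProjection a (specProj a c) u fun x => PowerSeries.mk fun k => (coeff k (P x))ᴴ where
  coeff_zero x := by rw [PowerSeries.coeff_mk, hP.coeff_zero, conjTranspose_specProj]
  idem x := by
    refine PowerSeries.ext fun k => ?_
    conv_rhs => rw [PowerSeries.coeff_mk, ← hP.idem x]
    rw [PowerSeries.coeff_mul, PowerSeries.coeff_mul, Matrix.conjTranspose_sum,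
      ← Finset.Nat.sum_antidiagonal_swap]
    simp
  intertwines := by
    have haH := conjTranspose_diagonal ha
    obtain ⟨hcomm, hd⟩ := isIntertwiner_iff.1 hP.intertwines
    simp only [isIntertwiner_iff, PowerSeries.coeff_mk]
    refine ⟨fun x => ?_, fun k x => (hd k x).conjTranspose.congr_deriv ?_⟩
    · have hcommH := congrArg Matrix.conjTranspose (hcomm x)
      simp only [Matrix.conjTranspose_mul, haH, mul_neg, neg_mul, neg_inj] at hcommH
      exact hcommH.symm
    · simp only [Matrix.conjTranspose_add, Matrix.conjTranspose_sub, Matrix.conjTranspose_mul, haH,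
        hu x]
      noncomm_ring

theorem conjTranspose_coeff (ha : ∀ i, (a i).re = 0) (hu : ∀ x, (u x)ᴴ = -u x)
    (hP : IsLaxProjection a (specProj a c) u P) (k : ℕ) (x : ℝ) :
    (coeff k (P x))ᴴ = coeff k (P x) := by
  simpa using hP.conjTranspose ha hu |>.coeff_unique hP k x

end IsLaxProjection

theorem contDiff_deriv_fst {f : ℝ × ℝ → ℂ} (hf : ContDiff ℝ ∞ f) :
    ContDiff ℝ ∞ fun p : ℝ × ℝ => deriv (fun y => f (y, p.2)) p.1 := by
  have hpartial : (fun p : ℝ × ℝ => deriv (fun y => f (y, p.2)) p.1) =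
      fun p => fderiv ℝ f p (1, 0) := funext fun p => by
    have hf' : HasFDerivAt f (fderiv ℝ f p) p := (hf.differentiable (by simp) p).hasFDerivAt
    have hline : HasDerivAt (fun y : ℝ => (y, p.2)) ((1 : ℝ), (0 : ℝ)) p.1 :=
      (hasDerivAt_id _).prodMk (hasDerivAt_const _ _)
    exact (hf'.comp_hasDerivAt p.1 hline).deriv
  rw [hpartial]
  exact (hf.fderiv_right (m := ∞) (by simp)).clm_apply contDiff_const

theorem contDiff_mul_apply {F G : ℝ × ℝ → Mat n} {m : WithTop ℕ∞}
    (hF : ∀ i j, ContDiff ℝ m fun p => F p i j)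
    (hG : ∀ i j, ContDiff ℝ m fun p => G p i j) (i j : Fin n) :
    ContDiff ℝ m fun p => (F p * G p) i j := by
  simp only [Matrix.mul_apply]
  exact ContDiff.sum fun k _ => (hF i k).mul (hG k j)

theorem IsLaxProjection.contDiff {u : ℝ → ℝ → Mat n} {P : ℝ → ℝ → PowerSeries (Mat n)}
    (hu : ∀ i j, ContDiff ℝ ∞ fun p : ℝ × ℝ => u p.1 p.2 i j)
    (hP : ∀ t, IsLaxProjection a (specProj a c) (fun x => u x t) (fun x => P x t)) (k : ℕ)
    (i j : Fin n) : ContDiff ℝ ∞ fun p : ℝ × ℝ => coeff k (P p.1 p.2) i j := by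
  induction k using Nat.strong_induction_on generalizing i j with
  | _ k ih =>
    cases k with
    | zero =>
      simp only [fun p : ℝ × ℝ => (hP p.2).coeff_zero p.1]
      exact contDiff_const
    | succ k =>
      by_cases hij : a i = a j
      · simp only [fun p : ℝ × ℝ => (hP p.2).coeff_succ_of_eq k p.1 hij, Matrix.sum_apply]
        refine contDiff_const.mul (ContDiff.sum fun l hl => ?_)
        have hl := Finset.mem_range.1 hl
        exact contDiff_mul_apply (ih (l + 1) (by omega)) (ih (k - l) (by omega)) i j
      · simp only [fun p : ℝ × ℝ => (hP p.2).coeff_succ_of_ne k p.1 hij]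
        have hk := ih k k.lt_succ_self
        exact ((contDiff_deriv_fst (hk i j)).sub ((contDiff_mul_apply hk hu i j).sub
          (contDiff_mul_apply hu hk i j))).mul contDiff_const

end Local

/-! ### Properties of `Q` -/

/-- `b` is a combination `∑ β_c e_c`, with imaginary coefficients, of the spectral projections of
`diag(a₁, …, aₙ)`. -/
def IsSpectral (a : Fin n → ℂ) (b : Mat n) : Prop :=
  ∃ (s : Finset ℂ) (β : ℂ → ℂ), (∀ c ∈ s, conj (β c) = -β c) ∧ b = ∑ c ∈ s, β c • specProj a c

theorem aeval_diagonal (a : Fin n → ℂ) (p : Polynomial ℂ) :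
    Polynomial.aeval (Matrix.diagonal a) p = Matrix.diagonal fun i => p.eval (a i) := by
  have hdiag : Matrix.diagonal a = Matrix.diagonalAlgHom ℂ a := rfl
  rw [hdiag, Polynomial.aeval_algHom_apply, Matrix.diagonalAlgHom_apply]
  congr 1
  ext i
  rw [← Polynomial.coe_aeval_eq_eval]
  exact (Polynomial.aeval_algHom_apply (Pi.evalAlgHom ℂ (fun _ : Fin n => ℂ) i) a p).symm

theorem diagonal_comp_eq_sum_specProj (a : Fin n → ℂ) (f : ℂ → ℂ) :
    (Matrix.diagonal fun i => f (a i)) = ∑ c ∈ Finset.univ.image a, f c • specProj a c := by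
  ext i j
  simp only [Matrix.sum_apply, Matrix.smul_apply, specProj, Matrix.diagonal_apply, smul_eq_mul]
  split_ifs <;> simp

theorem isSpectral_aeval {a : Fin n → ℂ} {b : Mat n} (hb : bᴴ = -b) {p : Polynomial ℂ}
    (hp : b = Polynomial.aeval (Matrix.diagonal a) p) : IsSpectral a b := by
  rw [aeval_diagonal] at hp
  refine ⟨Finset.univ.image a, fun c => p.eval c, fun c hc => ?_,
    hp.trans (diagonal_comp_eq_sum_specProj a fun c => p.eval c)⟩
  obtain ⟨i, -, rfl⟩ := Finset.mem_image.1 hc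
  simpa [hp] using congrFun (congrFun hb i) i

theorem IsSpectral.comm {a : Fin n → ℂ} {b : Mat n} (hb : IsSpectral a b) :
    b * Matrix.diagonal a = Matrix.diagonal a * b := by
  obtain ⟨s, β, -, rfl⟩ := hb
  simp only [Finset.sum_mul, Finset.mul_sum, smul_mul_assoc, mul_smul_comm, specProj_comm]

section Q

variable {a : Fin n → ℂ} {b : Mat n}

theorem Q_zero (u : ℝ → Mat n) (x : ℝ) : Q a b u 0 x = b := coeff_zero_qSeries x

theorem hasMatDerivAt_Q (hb : b * Matrix.diagonal a = Matrix.diagonal a * b) {u : ℝ → Mat n}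
    (hu : IsPotential a u) (k : ℕ) (x : ℝ) :
    HasMatDerivAt (Q a b u k) (Q a b u (k + 1) x * Matrix.diagonal a -
      Matrix.diagonal a * Q a b u (k + 1) x + (Q a b u k x * u x - u x * Q a b u k x)) x :=
  (isIntertwiner_iff.1 (isIntertwiner_qSeries hb hu)).2 k x

theorem Q_sum_smul {ι : Type*} (s : Finset ι) (β : ι → ℂ) (e : ι → Mat n) (u : ℝ → Mat n) (k : ℕ)
    (x : ℝ) : Q a (∑ c ∈ s, β c • e c) u k x = ∑ c ∈ s, β c • coeff k (qSeries a (e c) u x) := by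
  change coeff k (qSeries a _ u x) = _
  simp only [qSeries_sum_smul, map_sum, PowerSeries.coeff_smul]

theorem conjTranspose_Q (ha : ∀ i, (a i).re = 0) (hb : IsSpectral a b) {u : ℝ → Mat n}
    (hu : IsPotential a u) (k : ℕ) (x : ℝ) : (Q a b u k x)ᴴ = -Q a b u k x := by
  obtain ⟨s, β, hβ, rfl⟩ := hb
  rw [Q_sum_smul, Matrix.conjTranspose_sum, ← Finset.sum_neg_distrib]
  refine Finset.sum_congr rfl fun c hc => ?_
  rw [Matrix.conjTranspose_smul, RCLike.star_def, hβ c hc, neg_smul,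
    (isLaxProjection_qSeries c hu).conjTranspose_coeff ha fun x => (hu.mem_perp x).1]

theorem contDiff_Q (hb : IsSpectral a b) {u : ℝ → ℝ → Mat n}
    (hsmooth : ∀ i j, ContDiff ℝ ∞ fun p : ℝ × ℝ => u p.1 p.2 i j)
    (hu : ∀ t, IsPotential a fun x => u x t) (k : ℕ) (i j : Fin n) :
    ContDiff ℝ ∞ fun p : ℝ × ℝ => Q a b (fun x => u x p.2) k p.1 i j := by
  obtain ⟨s, β, -, rfl⟩ := hb
  simp only [Q_sum_smul, Matrix.sum_apply, Matrix.smul_apply]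
  refine ContDiff.sum fun c _ => ContDiff.const_smul _ ?_
  exact IsLaxProjection.contDiff (P := fun x t => qSeries a (specProj a c) (fun y => u y t) x)
    hsmooth (fun t => isLaxProjection_qSeries c (hu t)) k i j

-- `K (m⁻¹ e m) K⁻¹` is a Lax projection for `v`, hence the one that defines `Q(v)`.
theorem qSeries_mul_intertwiner (hb : IsSpectral a b) {u v : ℝ → Mat n}
    {K : ℝ → PowerSeries (Mat n)} (hu : IsPotential a u) (hv : IsPotential a v)
    (hK : IsIntertwiner a u v K) (h1 : ∀ x, constantCoeff (K x) = 1) (x : ℝ) :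
    qSeries a b v x * K x = K x * qSeries a b u x := by
  obtain ⟨s, β, -, rfl⟩ := hb
  simp only [qSeries_sum_smul, Finset.sum_mul, Finset.mul_sum, smul_mul_assoc, mul_smul_comm]
  refine Finset.sum_congr rfl fun c _ => congrArg (β c • ·) ?_
  have hconj := (isLaxProjection_qSeries c hu).conj hK h1
  rw [(isLaxProjection_qSeries c hv).unique hconj x, mul_assoc, invOfUnit_mul _ _ (h1 x), mul_one]

theorem Q_darboux (hb : IsSpectral a b) {u v S : ℝ → Mat n} (hu : IsPotential a u)
    (hv : IsPotential a v) (hS : ∀ x, HasMatDerivAt S (S x * u x - v x * S x) x)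
    (huv : ∀ x, v x = u x + (S x * Matrix.diagonal a - Matrix.diagonal a * S x)) (k : ℕ) (x : ℝ) :
    Q a b v (k + 1) x + Q a b v k x * S x = Q a b u (k + 1) x + S x * Q a b u k x := by
  have hK := congrArg (coeff (k + 1)) <|
    qSeries_mul_intertwiner hb hu hv (.one_add_C_mul_X hS huv) (fun x => by simp) x
  simp only [mul_add, add_mul, mul_one, one_mul, ← mul_mul_X_comm, ← mul_assoc, map_add,
    PowerSeries.coeff_succ_mul_X, PowerSeries.coeff_mul_C, PowerSeries.coeff_C_mul] at hK
  exact hK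

end Q

/-! ### The time component of the connection -/

/-- The polynomial `q₀ λ^j + q₁ λ^{j-1} + ⋯ + q_j`; for `q_k = Q_{b,k}(u)` it is the time component
of the flat connection of a solution `u`. -/
def timeOp (q : ℕ → Mat n) (j : ℕ) (l : ℂ) : Mat n := ∑ k ∈ Finset.range (j + 1), l ^ (j - k) • q k

theorem timeOp_zero (q : ℕ → Mat n) (l : ℂ) : timeOp q 0 l = q 0 := by simp [timeOp]

theorem timeOp_succ (q : ℕ → Mat n) (j : ℕ) (l : ℂ) :
    timeOp q (j + 1) l = l • timeOp q j l + q (j + 1) := by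
  rw [timeOp, Finset.sum_range_succ, timeOp, Finset.smul_sum]
  simp only [Nat.sub_self, pow_zero, one_smul]
  congr 1
  refine Finset.sum_congr rfl fun k hk => ?_
  have hk := Finset.mem_range.1 hk
  rw [smul_smul, ← pow_succ', show j - k + 1 = j + 1 - k by omega]

theorem conjTranspose_timeOp {q : ℕ → Mat n} (hq : ∀ k, (q k)ᴴ = -q k) (j : ℕ) (l : ℂ) :
    (timeOp q j (conj l))ᴴ = -timeOp q j l := by
  simp [timeOp, Matrix.conjTranspose_sum, Matrix.conjTranspose_smul, hq]

theorem hasMatDerivAt_timeOp {a : Fin n → ℂ} {u : ℝ → Mat n} {q : ℕ → ℝ → Mat n} {x : ℝ}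
    (h0 : q 0 x * Matrix.diagonal a = Matrix.diagonal a * q 0 x)
    (hq : ∀ k, HasMatDerivAt (q k) (q (k + 1) x * Matrix.diagonal a -
      Matrix.diagonal a * q (k + 1) x + (q k x * u x - u x * q k x)) x) (j : ℕ) (l : ℂ) :
    HasMatDerivAt (fun x => timeOp (fun k => q k x) j l)
      (timeOp (fun k => q k x) j l * (l • Matrix.diagonal a + u x) -
        (l • Matrix.diagonal a + u x) * timeOp (fun k => q k x) j l +
        (q (j + 1) x * Matrix.diagonal a - Matrix.diagonal a * q (j + 1) x)) x := by
  induction j with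
  | zero =>
    simp only [timeOp_zero]
    refine (hq 0).congr_deriv ?_
    rw [Matrix.mul_add, Matrix.add_mul, Matrix.mul_smul, Matrix.smul_mul, h0]
    abel
  | succ j ih =>
    simp only [timeOp_succ]
    refine ((ih.const_smul l).add (hq (j + 1))).congr_deriv ?_
    simp only [Matrix.mul_add, Matrix.add_mul, Matrix.mul_smul, Matrix.smul_mul, smul_add, smul_sub]
    abel

theorem continuous_timeOp {X : Type*} [TopologicalSpace X] {q : ℕ → X → Mat n} {l : X → ℂ}
    (hq : ∀ k, Continuous (q k)) (hl : Continuous l) (j : ℕ) :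
    Continuous fun x => timeOp (fun k => q k x) j (l x) :=
  continuous_finsetSum _ fun k _ => (hl.pow (j - k)).smul (hq k)

theorem timeOp_sub (q : ℕ → Mat n) (j : ℕ) (l l' : ℂ) :
    timeOp q j l' - timeOp q j l = (l' - l) • ∑ k ∈ Finset.range (j + 1),
      (∑ i ∈ Finset.range (j - k), l' ^ i * l ^ (j - k - 1 - i)) • q k := by
  rw [timeOp, timeOp, ← Finset.sum_sub_distrib, Finset.smul_sum]
  refine Finset.sum_congr rfl fun k _ => ?_
  rw [smul_smul, mul_comm, geom_sum₂_mul, sub_smul]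

theorem contDiff_of_partial {f f₁ f₂ : ℝ → ℝ → ℂ} {m : ℕ}
    (h₁ : ∀ x t, HasDerivAt (fun y => f y t) (f₁ x t) x)
    (h₂ : ∀ x t, HasDerivAt (fun s => f x s) (f₂ x t) t)
    (hc₁ : ContDiff ℝ m fun p : ℝ × ℝ => f₁ p.1 p.2)
    (hc₂ : ContDiff ℝ m fun p : ℝ × ℝ => f₂ p.1 p.2) :
    ContDiff ℝ (m + 1) fun p : ℝ × ℝ => f p.1 p.2 := by
  let L : ℂ → ℝ →L[ℝ] ℂ := fun z => (1 : ℝ →L[ℝ] ℝ).smulRight z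
  have hL : ∀ {g : ℝ × ℝ → ℂ}, ContDiff ℝ m g → ContDiff ℝ m fun p => L (g p) := fun hg =>
    contDiff_const.smulRight hg
  rw [contDiff_succ_iff_hasFDerivAt]
  refine ⟨fun p => (L (f₁ p.1 p.2)).coprod (L (f₂ p.1 p.2)), ?_, fun p => ?_⟩
  · have hcoprod : (fun p : ℝ × ℝ => (L (f₁ p.1 p.2)).coprod (L (f₂ p.1 p.2))) = fun p =>
        (ContinuousLinearMap.fst ℝ ℝ ℝ).smulRight (f₁ p.1 p.2) +
          (ContinuousLinearMap.snd ℝ ℝ ℝ).smulRight (f₂ p.1 p.2) := by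
      ext p <;> simp [L]
    rw [hcoprod]
    exact (contDiff_const.smulRight hc₁).add (contDiff_const.smulRight hc₂)
  · exact (hasStrictFDerivAt_uncurry_coprod (f := f) (f₁ := fun x t => L (f₁ x t))
      (f₂ := fun x t => L (f₂ x t))
      (Eventually.of_forall fun v => (h₁ v.1 v.2).hasFDerivAt)
      (Eventually.of_forall fun v => (h₂ v.1 v.2).hasFDerivAt)
      (hL hc₁).continuous.continuousAt (hL hc₂).continuous.continuousAt).hasFDerivAt

theorem contDiff_of_linear_system {E A B : ℝ → ℝ → Mat n}
    (hc : ∀ i j, Continuous fun p : ℝ × ℝ => E p.1 p.2 i j)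
    (hA : ∀ i j, ContDiff ℝ ∞ fun p : ℝ × ℝ => A p.1 p.2 i j)
    (hB : ∀ i j, ContDiff ℝ ∞ fun p : ℝ × ℝ => B p.1 p.2 i j)
    (hx : ∀ x t, HasMatDerivAt (fun y => E y t) (E x t * A x t) x)
    (ht : ∀ x t, HasMatDerivAt (fun s => E x s) (E x t * B x t) t) (i j : Fin n) :
    ContDiff ℝ ∞ fun p : ℝ × ℝ => E p.1 p.2 i j := by
  rw [contDiff_infty]
  intro m
  induction m generalizing i j with
  | zero => exact contDiff_zero.2 (hc i j)
  | succ m ih =>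
    exact contDiff_of_partial (fun x t => hx x t i j) (fun x t => ht x t i j)
      (contDiff_mul_apply (F := fun p => E p.1 p.2) (G := fun p => A p.1 p.2) ih
        (fun i j => contDiff_infty.1 (hA i j) m) i j)
      (contDiff_mul_apply (F := fun p => E p.1 p.2) (G := fun p => B p.1 p.2) ih
        (fun i j => contDiff_infty.1 (hB i j) m) i j)

/-! ### Trivializations -/

section Trivialization

variable {a : Fin n → ℂ} {b : Mat n} {j : ℕ} {u : ℝ → ℝ → Mat n}

/-- The time component `b λ^j + Q_{b,1}(u) λ^{j-1} + ⋯ + Q_{b,j}(u)` of the flat connection whose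
space component is `a λ + u`. -/
def flowOp (a : Fin n → ℂ) (b : Mat n) (j : ℕ) (u : ℝ → ℝ → Mat n) (x t : ℝ) (l : ℂ) : Mat n :=
  timeOp (fun k => Q a b (fun y => u y t) k x) j l

theorem IsSolution.hasMatDerivAt_flow (hb : IsSpectral a b) (hu : IsSolution a b j u) (x t : ℝ) :
    HasMatDerivAt (fun s => u x s) (Q a b (fun y => u y t) (j + 1) x * Matrix.diagonal a -
      Matrix.diagonal a * Q a b (fun y => u y t) (j + 1) x) t := by
  refine (hu.flow x t).congr_deriv ?_
  rw [(hasMatDerivAt_Q hb.comm (hu.isPotential t) j x).matDeriv]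
  abel

theorem IsSolution.hasMatDerivAt_flowOp (hb : IsSpectral a b) (hu : IsSolution a b j u)
    (x t : ℝ) (l : ℂ) :
    HasMatDerivAt (fun x => flowOp a b j u x t l)
      (flowOp a b j u x t l * (l • Matrix.diagonal a + u x t) -
        (l • Matrix.diagonal a + u x t) * flowOp a b j u x t l +
        (Q a b (fun y => u y t) (j + 1) x * Matrix.diagonal a -
          Matrix.diagonal a * Q a b (fun y => u y t) (j + 1) x)) x := by
  refine hasMatDerivAt_timeOp (u := fun x => u x t) ?_
    (hasMatDerivAt_Q hb.comm (hu.isPotential t) · x) j l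
  rw [Q_zero]
  exact hb.comm

theorem IsSolution.contDiff_Q (hb : IsSpectral a b) (hu : IsSolution a b j u) (k : ℕ)
    (i i' : Fin n) : ContDiff ℝ ∞ fun p : ℝ × ℝ => Q a b (fun x => u x p.2) k p.1 i i' :=
  UnHierarchy.contDiff_Q hb hu.smooth hu.isPotential k i i'

theorem IsSolution.contDiff_flowOp (hb : IsSpectral a b) (hu : IsSolution a b j u) (l : ℂ)
    (i i' : Fin n) : ContDiff ℝ ∞ fun p : ℝ × ℝ => flowOp a b j u p.1 p.2 l i i' := by
  simp only [flowOp, timeOp, Matrix.sum_apply, Matrix.smul_apply]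
  exact ContDiff.sum fun k _ => (hu.contDiff_Q hb k i i').const_smul _

theorem IsSolution.conjTranspose_flowOp (ha : ∀ i, (a i).re = 0) (hb : IsSpectral a b)
    (hu : IsSolution a b j u) (x t : ℝ) (l : ℂ) :
    (flowOp a b j u x t (conj l))ᴴ = -flowOp a b j u x t l :=
  conjTranspose_timeOp (fun k => conjTranspose_Q ha hb (hu.isPotential t) k x) j l

theorem IsSolution.conjTranspose_lax (ha : ∀ i, (a i).re = 0)
    (hu : IsSolution a b j u) (x t : ℝ) (l : ℂ) :
    (conj l • Matrix.diagonal a + u x t)ᴴ = -(l • Matrix.diagonal a + u x t) := by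
  rw [Matrix.conjTranspose_add, Matrix.conjTranspose_smul, conjTranspose_diagonal ha,
    (hu.mem_perp x t).1]
  simp only [RCLike.star_def, Complex.conj_conj, smul_neg]
  abel

namespace IsTrivialization

variable {E : ℝ → ℝ → ℂ → Mat n}

theorem inv_deriv_x (ha : ∀ i, (a i).re = 0) (hu : IsSolution a b j u)
    (hE : IsTrivialization a b j u E) (x t : ℝ) (l : ℂ) :
    HasMatDerivAt (fun y => (E y t (conj l))ᴴ)
      (-((l • Matrix.diagonal a + u x t) * (E x t (conj l))ᴴ)) x := by
  refine (hE.deriv_x x t (conj l)).conjTranspose.congr_deriv ?_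
  rw [Matrix.conjTranspose_mul, hu.conjTranspose_lax ha, Matrix.neg_mul]

theorem inv_deriv_t (ha : ∀ i, (a i).re = 0) (hb : IsSpectral a b)
    (hu : IsSolution a b j u) (hE : IsTrivialization a b j u E) (x t : ℝ) (l : ℂ) :
    HasMatDerivAt (fun s => (E x s (conj l))ᴴ)
      (-(flowOp a b j u x t l * (E x t (conj l))ᴴ)) t := by
  refine (hE.deriv_t x t (conj l)).conjTranspose.congr_deriv ?_
  rw [Matrix.conjTranspose_mul, ← Matrix.neg_mul, ← hu.conjTranspose_flowOp ha hb]
  rfl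

theorem mul_inv_eq (ha : ∀ i, (a i).re = 0) (hb : IsSpectral a b)
    (hu : IsSolution a b j u) (hE : IsTrivialization a b j u E) {F : ℝ → ℝ → Mat n} {l : ℂ}
    (hx : ∀ x t, HasMatDerivAt (fun y => F y t) (F x t * (l • Matrix.diagonal a + u x t)) x)
    (ht : ∀ x t, HasMatDerivAt (fun s => F x s) (F x t * flowOp a b j u x t l) t) (x t : ℝ) :
    F x t * (E x t (conj l))ᴴ = F 0 0 := by
  have hconst_x : ∀ t x, HasMatDerivAt (fun x => F x t * (E x t (conj l))ᴴ) 0 x := fun t x =>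
    ((hx x t).mul (hE.inv_deriv_x ha hu x t l)).congr_deriv (by noncomm_ring)
  have hconst_t : ∀ x t, HasMatDerivAt (fun t => F x t * (E x t (conj l))ᴴ) 0 t := fun x t =>
    ((ht x t).mul (hE.inv_deriv_t ha hb hu x t l)).congr_deriv (by noncomm_ring)
  rw [HasMatDerivAt.eq_of_zero (hconst_x t) x 0, HasMatDerivAt.eq_of_zero (hconst_t 0) t 0,
    hE.base, Matrix.conjTranspose_one, Matrix.mul_one]

theorem mul_inv (ha : ∀ i, (a i).re = 0) (hb : IsSpectral a b)
    (hu : IsSolution a b j u) (hE : IsTrivialization a b j u E) (x t : ℝ) (l : ℂ) :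
    E x t l * (E x t (conj l))ᴴ = 1 := by
  rw [hE.mul_inv_eq ha hb hu (F := fun x t => E x t l) (fun x t => hE.deriv_x x t l)
    (fun x t => hE.deriv_t x t l), hE.base]

theorem inv_mul (ha : ∀ i, (a i).re = 0) (hb : IsSpectral a b)
    (hu : IsSolution a b j u) (hE : IsTrivialization a b j u E) (x t : ℝ) (l : ℂ) :
    (E x t (conj l))ᴴ * E x t l = 1 :=
  mul_eq_one_comm.1 (hE.mul_inv ha hb hu x t l)

theorem eq_mul (ha : ∀ i, (a i).re = 0) (hb : IsSpectral a b)
    (hu : IsSolution a b j u) (hE : IsTrivialization a b j u E) {F : ℝ → ℝ → Mat n} {l : ℂ}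
    (hx : ∀ x t, HasMatDerivAt (fun y => F y t) (F x t * (l • Matrix.diagonal a + u x t)) x)
    (ht : ∀ x t, HasMatDerivAt (fun s => F x s) (F x t * flowOp a b j u x t l) t) (x t : ℝ) :
    F x t = F 0 0 * E x t l := by
  rw [← hE.mul_inv_eq ha hb hu hx ht x t, Matrix.mul_assoc, hE.inv_mul ha hb hu, Matrix.mul_one]

theorem unique (ha : ∀ i, (a i).re = 0) (hb : IsSpectral a b)
    (hu : IsSolution a b j u) (hE : IsTrivialization a b j u E) {E' : ℝ → ℝ → ℂ → Mat n}
    (hE' : IsTrivialization a b j u E') : E' = E := by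
  funext x t l
  rw [hE.eq_mul ha hb hu (F := fun x t => E' x t l) (fun x t => hE'.deriv_x x t l)
    (fun x t => hE'.deriv_t x t l), hE'.base, Matrix.one_mul]

end IsTrivialization

theorem continuous_uncurry_of_contDiff {F : ℝ → ℝ → Mat n}
    (hF : ∀ i i', ContDiff ℝ ∞ fun p : ℝ × ℝ => F p.1 p.2 i i') :
    Continuous fun p : ℝ × ℝ => F p.1 p.2 :=
  continuous_matrix fun i i' => (hF i i').continuous

theorem IsSolution.continuous_Q (hb : IsSpectral a b) (hu : IsSolution a b j u) (k : ℕ) :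
    Continuous fun p : ℝ × ℝ => Q a b (fun x => u x p.2) k p.1 :=
  continuous_uncurry_of_contDiff (F := fun x t => Q a b (fun x => u x t) k x) (hu.contDiff_Q hb k)

theorem differentiable_matrix_apply {F : ℂ → Mat n} (hF : Differentiable ℂ F)
    (i i' : Fin n) : Differentiable ℂ fun l => F l i i' := fun l =>
  (hasDerivAt_pi.1 (hasDerivAt_pi.1 (hF l).hasDerivAt i) i').differentiableAt

section Existence

attribute [local instance] Matrix.linftyOpNormedRing Matrix.linftyOpNormedAlgebra

theorem IsSolution.exists_solution_axis (hb : IsSpectral a b) (hu : IsSolution a b j u) :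
    ∃ G : ℝ → ℂ → Mat n, (Continuous fun q : ℝ × ℂ => G q.1 q.2) ∧
      (∀ t l, HasMatDerivAt (fun s => G s l) (G t l * flowOp a b j u 0 t l) t) ∧
      (∀ l, G 0 l = 1) ∧ ∀ t i i', Differentiable ℂ fun l => G t l i i' := by
  have hQ : ∀ k, Continuous fun q : ℝ × ℂ => Q a b (fun y => u y q.1) k 0 := fun k => by
    simpa only [Function.comp_def] using (hu.continuous_Q hb k).comp
      (by fun_prop : Continuous fun q : ℝ × ℂ => ((0 : ℝ), q.1))
  have hB : Continuous fun q : ℝ × ℂ => flowOp a b j u 0 q.1 q.2 :=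
    continuous_timeOp hQ continuous_snd j
  obtain ⟨G, Z, hG⟩ := exists_isFundamentalSolution (A := fun t l => flowOp a b j u 0 t l) hB
  refine ⟨G, hG.continuous, fun t l => hasMatDerivAt_iff_hasDerivAt.2 (hG.deriv t l), hG.base,
    fun t => differentiable_matrix_apply fun l => ?_⟩
  have hD : Continuous fun q : ℝ × ℂ => ∑ k ∈ Finset.range (j + 1),
      (∑ i ∈ Finset.range (j - k), q.2 ^ i * l ^ (j - k - 1 - i)) •
        Q a b (fun y => u y q.1) k 0 :=
    continuous_finsetSum _ fun k _ => Continuous.smul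
      (f := fun q : ℝ × ℂ => ∑ i ∈ Finset.range (j - k), q.2 ^ i * l ^ (j - k - 1 - i))
      (by fun_prop) (hQ k)
  exact (hG.hasDerivAt_parameter (D := fun t l' => ∑ k ∈ Finset.range (j + 1),
      (∑ i ∈ Finset.range (j - k), l' ^ i * l ^ (j - k - 1 - i)) • Q a b (fun y => u y t) k 0)
    hD (fun t l' => timeOp_sub _ j l l') t).differentiableAt

theorem IsSolution.exists_solution_lines (hb : IsSpectral a b) (hu : IsSolution a b j u) :
    ∃ F : ℝ → ℝ → ℂ → Mat n,
      (Continuous fun q : ℝ × (ℝ × ℂ) => F q.1 q.2.1 q.2.2) ∧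
      (∀ x t l, HasMatDerivAt (fun y => F y t l) (F x t l * (l • Matrix.diagonal a + u x t)) x) ∧
      (∀ t l, F 0 t l = 1) ∧ (∀ x t i i', Differentiable ℂ fun l => F x t l i i') ∧
      ∀ x t l, HasMatDerivAt (fun s => F x s l)
        (F x t l * flowOp a b j u x t l - flowOp a b j u 0 t l * F x t l) t := by
  have hA : Continuous fun q : ℝ × (ℝ × ℂ) => q.2.2 • Matrix.diagonal a + u q.1 q.2.1 :=
    ((continuous_snd.comp continuous_snd).smul continuous_const).add
      ((continuous_uncurry_of_contDiff hu.smooth).comp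
        (by fun_prop : Continuous fun q : ℝ × (ℝ × ℂ) => (q.1, q.2.1)))
  obtain ⟨F, Z, hF⟩ := exists_isFundamentalSolution
    (A := fun x (p : ℝ × ℂ) => p.2 • Matrix.diagonal a + u x p.1) hA
  refine ⟨fun x t l => F x (t, l), hF.continuous,
    fun x t l => hasMatDerivAt_iff_hasDerivAt.2 (hF.deriv x (t, l)), fun t l => hF.base (t, l),
    fun x t => differentiable_matrix_apply fun l => ((hF.comp (by fun_prop :
      Continuous fun l : ℂ => (t, l))).hasDerivAt_parameter (D := fun _ _ => Matrix.diagonal a)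
      continuous_const (fun x l' => by rw [add_sub_add_right_eq_sub, sub_smul])
      x).differentiableAt,
    fun x t l => hasMatDerivAt_iff_hasDerivAt.2 ?_⟩
  have hQ := hu.continuous_Q hb (j + 1)
  exact (hF.comp (by fun_prop : Continuous fun s : ℝ => (s, l))).hasDerivAt_of_zero_curvature
    (fun x t => (hasMatDerivAt_iff_hasDerivAt.1 (hu.hasMatDerivAt_flow hb x t)).const_add
      (l • Matrix.diagonal a))
    (by fun_prop)
    (fun x t => hasMatDerivAt_iff_hasDerivAt.1 (hu.hasMatDerivAt_flowOp hb x t l)) x t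

end Existence

theorem IsSolution.exists_trivialization (ha : ∀ i, (a i).re = 0) (hb : IsSpectral a b)
    (hu : IsSolution a b j u) : ∃ E : ℝ → ℝ → ℂ → Mat n, IsTrivialization a b j u E ∧
      (∀ x t, IsGPlus (E x t)) ∧
      ∀ l i i', ContDiff ℝ ∞ fun p : ℝ × ℝ => E p.1 p.2 l i i' := by
  obtain ⟨G, hGc, hG, hG0, hGd⟩ := hu.exists_solution_axis hb
  obtain ⟨F, hFc, hF, hF0, hFd, hFt⟩ := hu.exists_solution_lines hb
  have hE : IsTrivialization a b j u fun x t l => G t l * F x t l :=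
    { deriv_x := fun x t l => ((hF x t l).const_mul (G t l)).congr_deriv (by noncomm_ring)
      deriv_t := fun x t l => ((hG t l).mul (hFt x t l)).congr_deriv (by
        change _ = G t l * F x t l * flowOp a b j u x t l
        noncomm_ring)
      base := fun l => by rw [hG0, hF0, one_mul] }
  refine ⟨_, hE, fun x t => ⟨fun i i' => ?_, hE.inv_mul ha hb hu x t⟩, fun l => ?_⟩
  · simp only [Matrix.mul_apply]
    exact Differentiable.fun_sum fun k _ => (hGd t i k).mul (hFd x t k i')
  · have hEc : Continuous fun p : ℝ × ℝ => G p.2 l * F p.1 p.2 l :=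
      (hGc.comp (by fun_prop : Continuous fun p : ℝ × ℝ => (p.2, l))).mul
        (hFc.comp (by fun_prop : Continuous fun p : ℝ × ℝ => (p.1, (p.2, l))))
    exact contDiff_of_linear_system (fun i i' => hEc.matrix_elem i i')
      (fun i i' => contDiff_const.add (hu.smooth i i')) (hu.contDiff_flowOp hb l)
      (fun x t => hE.deriv_x x t l) (fun x t => hE.deriv_t x t l)

end Trivialization

/-! ### Decay of solutions of perturbed replicator equations -/

theorem monotoneOn_exp_neg_mul {f f' : ℝ → ℝ} {c x₀ : ℝ} (hf : ∀ x ≥ x₀, HasDerivAt f (f' x) x)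
    (hge : ∀ x ≥ x₀, c * f x ≤ f' x) :
    MonotoneOn (fun x => Real.exp (-c * x) * f x) (Set.Ici x₀) := by
  have hderiv : ∀ x ≥ x₀, HasDerivAt (fun x => Real.exp (-c * x) * f x)
      (Real.exp (-c * x) * (f' x - c * f x)) x := fun x hx =>
    ((by simpa using ((hasDerivAt_id x).const_mul (-c)).exp :
      HasDerivAt (fun x => Real.exp (-c * x)) (Real.exp (-c * x) * -c) x).mul
        (hf x hx)).congr_deriv (by ring)
  refine monotoneOn_of_hasDerivWithinAt_nonneg (convex_Ici x₀)
    (fun x hx => (hderiv x hx).continuousAt.continuousWithinAt)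
    (fun x hx => (hderiv x (interior_subset hx)).hasDerivWithinAt) fun x hx => ?_
  exact mul_nonneg (Real.exp_pos _).le (sub_nonneg.2 (hge x (interior_subset hx)))

theorem nonneg_of_mul_le_deriv {f f' : ℝ → ℝ} {c x₀ : ℝ} (hf : ∀ x ≥ x₀, HasDerivAt f (f' x) x)
    (hge : ∀ x ≥ x₀, c * f x ≤ f' x) (h0 : 0 ≤ f x₀) {x : ℝ} (hx : x₀ ≤ x) : 0 ≤ f x := by
  have hmono := monotoneOn_exp_neg_mul hf hge Set.self_mem_Ici hx hx
  exact nonneg_of_mul_nonneg_right ((mul_nonneg (Real.exp_pos _).le h0).trans hmono)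
    (Real.exp_pos _)

theorem nonpos_of_mul_le_deriv_of_le {f f' : ℝ → ℝ} {δ B x₀ : ℝ} (hδ : 0 < δ)
    (hf : ∀ x ≥ x₀, HasDerivAt f (f' x) x) (hge : ∀ x ≥ x₀, δ * f x ≤ f' x)
    (hB : ∀ x ≥ x₀, f x ≤ B) {x : ℝ} (hx : x₀ ≤ x) : f x ≤ 0 := by
  have hlim : Tendsto (fun y => Real.exp (-δ * y) * B) atTop (𝓝 0) := by
    simpa [Function.comp_def] using (Real.tendsto_exp_neg_atTop_nhds_zero.comp
      (tendsto_id.const_mul_atTop hδ)).mul_const B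
  have hle : Real.exp (-δ * x) * f x ≤ 0 := by
    refine ge_of_tendsto hlim ?_
    filter_upwards [eventually_ge_atTop x] with y hy
    exact (monotoneOn_exp_neg_mul hf hge hx (hx.trans hy) hy).trans
      (mul_le_mul_of_nonneg_left (hB y (hx.trans hy)) (Real.exp_pos _).le)
  exact nonpos_of_mul_nonpos_right hle (Real.exp_pos _)

theorem hasDerivAt_const_mul_zpow_neg (K : ℝ) (N : ℕ) {x : ℝ} (hx : 0 < x) :
    HasDerivAt (fun x : ℝ => K * x ^ (-(N : ℤ))) (-(N / x) * (K * x ^ (-(N : ℤ)))) x := by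
  refine ((hasDerivAt_zpow (-(N : ℤ)) x (Or.inl hx.ne')).const_mul K).congr_deriv ?_
  rw [zpow_sub_one₀ hx.ne']
  push_cast
  field_simp

theorem le_zpow_of_deriv_ge {q q' : ℝ → ℝ} {x₀ δ C B : ℝ} (N : ℕ) (hx₀ : 0 < x₀) (hδ : 0 < δ)
    (hC : 0 ≤ C) (hq : ∀ x ≥ x₀, q x ≤ B) (hd : ∀ x ≥ x₀, HasDerivAt q (q' x) x)
    (hge : ∀ x ≥ x₀, δ * q x - C * x ^ (-(N : ℤ)) ≤ q' x) {x : ℝ} (hx : x₀ ≤ x) :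
    q x ≤ C / δ * x ^ (-(N : ℤ)) := by
  refine sub_nonpos.1 (nonpos_of_mul_le_deriv_of_le (B := B) hδ
    (fun y hy => (hd y hy).fun_sub (hasDerivAt_const_mul_zpow_neg (C / δ) N (hx₀.trans_le hy)))
    (fun y hy => ?_) (fun y hy => ?_) hx) <;> have hy0 : 0 < y := hx₀.trans_le hy
  · have hφ : 0 ≤ N / y * (C / δ * y ^ (-(N : ℤ))) := by positivity
    have hδφ : δ * (C / δ * y ^ (-(N : ℤ))) = C * y ^ (-(N : ℤ)) := by field_simp
    linarith [hge y hy]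
  · have hφ : 0 ≤ C / δ * y ^ (-(N : ℤ)) := by positivity
    exact (sub_le_self _ hφ).trans (hq y hy)

theorem exists_le_zpow_of_deriv_le {q q' : ℝ → ℝ} {x₀ δ C : ℝ} (N : ℕ) (hx₀ : 0 < x₀) (hδ : 0 < δ)
    (hd : ∀ x ≥ x₀, HasDerivAt q (q' x) x)
    (hle : ∀ x ≥ x₀, q' x ≤ -δ * q x + C * x ^ (-(N : ℤ))) :
    ∃ K, ∃ x₁ ≥ x₀, ∀ x ≥ x₁, q x ≤ K * x ^ (-(N : ℤ)) := by
  -- Beyond `x₁` the logarithmic derivative of `x⁻ᴺ` is at least `-δ / 2`, and `K` is so large that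
  -- `K x⁻ᴺ` is a supersolution which dominates `q` at `x₁`.
  let x₁ : ℝ := max x₀ (2 * N / δ)
  let K : ℝ := max (2 * C / δ) (|q x₁| * x₁ ^ N)
  have hx₁ : 0 < x₁ := hx₀.trans_le (le_max_left _ _)
  have hK0 : 0 ≤ K := (by positivity : 0 ≤ |q x₁| * x₁ ^ N).trans (le_max_right _ _)
  have hKC : C ≤ δ / 2 * K := by
    have := (div_le_iff₀ hδ).1 (le_max_left _ _ : 2 * C / δ ≤ K)
    linarith
  refine ⟨K, x₁, le_max_left _ _, fun x hx => sub_nonneg.1 (nonneg_of_mul_le_deriv (c := -δ)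
    (fun y hy => (hasDerivAt_const_mul_zpow_neg K N (hx₁.trans_le hy)).fun_sub
      (hd y ((le_max_left _ _).trans hy))) (fun y hy => ?_) ?_ hx)⟩
  · have hy0 : 0 < y := hx₁.trans_le hy
    have hNy : N / y ≤ δ / 2 := by
      have := (div_le_iff₀ hδ).1 ((le_max_right _ _).trans hy : 2 * N / δ ≤ y)
      rw [div_le_div_iff₀ hy0 two_pos]
      linarith
    have hCy : C * y ^ (-(N : ℤ)) ≤ δ / 2 * K * y ^ (-(N : ℤ)) := by gcongr
    have hKy : N / y * (K * y ^ (-(N : ℤ))) ≤ δ / 2 * (K * y ^ (-(N : ℤ))) :=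
      mul_le_mul_of_nonneg_right hNy (mul_nonneg hK0 (zpow_nonneg hy0.le _))
    linarith [hle y ((le_max_left _ _).trans hy)]
  · rw [sub_nonneg, zpow_neg, zpow_natCast, ← div_eq_mul_inv, le_div_iff₀ (by positivity)]
    exact (mul_le_mul_of_nonneg_right (le_abs_self _) (by positivity)).trans (le_max_right _ _)

/-- `q` is a probability vector which solves the replicator equation
`q_k' = 2 (ρ_k - ∑ ρ_l q_l) q_k` up to the rapidly decreasing error `e`. -/
structure IsPerturbedReplicator {ι : Type*} [Fintype ι] (ρ : ι → ℝ) (q e : ι → ℝ → ℝ) : Prop where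
  nonneg : ∀ k x, 0 ≤ q k x
  sum_eq_one : ∀ x, ∑ k, q k x = 1
  deriv : ∀ k x, HasDerivAt (q k) (2 * (ρ k - ∑ l, ρ l * q l x) * q k x + e k x) x
  rapid : ∀ k (N : ℕ), ∃ C, ∀ x, |x| ^ N * |e k x| ≤ C

namespace IsPerturbedReplicator

variable {ι : Type*} [Fintype ι] {ρ : ι → ℝ} {q e : ι → ℝ → ℝ}

theorem le_one (h : IsPerturbedReplicator ρ q e) (k : ι) (x : ℝ) : q k x ≤ 1 := by
  rw [← h.sum_eq_one x]
  exact Finset.single_le_sum (f := fun k => q k x) (fun i _ => h.nonneg i x) (Finset.mem_univ k)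

theorem comp_neg (h : IsPerturbedReplicator ρ q e) :
    IsPerturbedReplicator (fun k => -ρ k) (fun k x => q k (-x)) fun k x => -e k (-x) where
  nonneg k x := h.nonneg k (-x)
  sum_eq_one x := h.sum_eq_one (-x)
  deriv k x := by
    refine ((h.deriv k (-x)).scomp x (hasDerivAt_neg x)).congr_deriv ?_
    simp only [neg_mul, Finset.sum_neg_distrib, smul_eq_mul]
    ring
  rapid k N := by
    obtain ⟨C, hC⟩ := h.rapid k N
    exact ⟨C, fun x => by simpa using hC (-x)⟩

theorem exists_abs_error_le (h : IsPerturbedReplicator ρ q e) (k : ι) (N : ℕ) :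
    ∃ C, 0 ≤ C ∧ ∀ x > 0, |e k x| ≤ C * x ^ (-(N : ℤ)) := by
  obtain ⟨C, hC⟩ := h.rapid k N
  refine ⟨C, (by positivity : 0 ≤ |(0 : ℝ)| ^ N * |e k 0|).trans (hC 0), fun x hx => ?_⟩
  rw [zpow_neg, zpow_natCast, ← div_eq_mul_inv, le_div_iff₀ (by positivity), mul_comm]
  simpa only [abs_of_pos hx] using hC x

theorem hasDerivAt_mean (h : IsPerturbedReplicator ρ q e) (x : ℝ) :
    HasDerivAt (fun x => ∑ l, ρ l * q l x)
      (2 * ∑ k, (ρ k - ∑ l, ρ l * q l x) ^ 2 * q k x + ∑ l, ρ l * e l x) x := by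
  refine (HasDerivAt.fun_sum fun l _ => (h.deriv l x).const_mul (ρ l)).congr_deriv ?_
  set μ := ∑ l, ρ l * q l x with hμ
  have hvar : ∑ l, ρ l * (2 * (ρ l - μ) * q l x + e l x) =
      2 * (∑ l, (ρ l - μ) ^ 2 * q l x) + 2 * μ * ((∑ l, ρ l * q l x) - μ * ∑ l, q l x) +
        ∑ l, ρ l * e l x := by
    simp only [Finset.mul_sum, ← Finset.sum_add_distrib, ← Finset.sum_sub_distrib]
    exact Finset.sum_congr rfl fun l _ => by ring
  rw [hvar, h.sum_eq_one, mul_one, ← hμ, sub_self, mul_zero, add_zero]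

theorem exists_abs_mean_error_le (h : IsPerturbedReplicator ρ q e) :
    ∃ A, 0 ≤ A ∧ ∀ x, |∑ l, ρ l * e l x| ≤ A * (1 / (1 + x ^ 2)) := by
  choose C hC using h.rapid
  have hC0 : ∀ l N, 0 ≤ C l N := fun l N =>
    (by positivity : 0 ≤ |(0 : ℝ)| ^ N * |e l 0|).trans (hC l N 0)
  have hterm : ∀ l x, |ρ l * e l x| * (1 + x ^ 2) ≤ |ρ l| * (C l 0 + C l 2) := fun l x => by
    rw [abs_mul, mul_assoc]
    refine mul_le_mul_of_nonneg_left ?_ (abs_nonneg _)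
    have h0 := hC l 0 x
    have h2 := hC l 2 x
    rw [pow_zero, one_mul] at h0
    rw [sq_abs] at h2
    linarith
  refine ⟨∑ l, |ρ l| * (C l 0 + C l 2), Finset.sum_nonneg fun l _ =>
    mul_nonneg (abs_nonneg _) (add_nonneg (hC0 l 0) (hC0 l 2)), fun x => ?_⟩
  rw [mul_one_div, le_div_iff₀ (by positivity)]
  calc |∑ l, ρ l * e l x| * (1 + x ^ 2) ≤ (∑ l, |ρ l * e l x|) * (1 + x ^ 2) := by
        gcongr
        exact Finset.abs_sum_le_sum_abs _ _
    _ ≤ ∑ l, |ρ l| * (C l 0 + C l 2) := by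
        rw [Finset.sum_mul]
        exact Finset.sum_le_sum fun l _ => hterm l x

theorem exists_tendsto_mean (h : IsPerturbedReplicator ρ q e) :
    ∃ μ, Tendsto (fun x => ∑ l, ρ l * q l x) atTop (𝓝 μ) := by
  obtain ⟨A, hA0, hA⟩ := h.exists_abs_mean_error_le
  -- The derivative of the mean is a variance up to an error, which `A arctan` absorbs.
  let F : ℝ → ℝ := fun x => ∑ l, ρ l * q l x + A * Real.arctan x
  have hFd : ∀ x, HasDerivAt F _ x := fun x =>
    (h.hasDerivAt_mean x).add ((Real.hasDerivAt_arctan x).const_mul A)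
  have hF : Monotone F := by
    refine monotone_of_deriv_nonneg (fun x => (hFd x).differentiableAt) fun x => ?_
    rw [(hFd x).deriv]
    have hvar : 0 ≤ ∑ k, (ρ k - ∑ l, ρ l * q l x) ^ 2 * q k x :=
      Finset.sum_nonneg fun l _ => mul_nonneg (sq_nonneg _) (h.nonneg l x)
    have herr := (abs_le.1 (hA x)).1
    linarith
  have hbdd : BddAbove (Set.range F) := by
    refine ⟨(∑ l, |ρ l|) + A * (Real.pi / 2), ?_⟩
    rintro _ ⟨x, rfl⟩
    refine add_le_add (Finset.sum_le_sum fun l _ => ?_)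
      (mul_le_mul_of_nonneg_left (Real.arctan_lt_pi_div_two x).le hA0)
    calc ρ l * q l x ≤ |ρ l| * 1 :=
          mul_le_mul (le_abs_self _) (h.le_one l x) (h.nonneg l x) (abs_nonneg _)
      _ = |ρ l| := mul_one _
  have harctan : Tendsto Real.arctan atTop (𝓝 (Real.pi / 2)) :=
    Real.tendsto_arctan_atTop.mono_right nhdsWithin_le_nhds
  exact ⟨_, ((tendsto_atTop_ciSup hF hbdd).sub (harctan.const_mul A)).congr fun x => by simp [F]⟩

theorem exists_le_zpow_of_tendsto_mean (h : IsPerturbedReplicator ρ q e) {μ : ℝ}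
    (hμ : Tendsto (fun x => ∑ l, ρ l * q l x) atTop (𝓝 μ)) {k : ι} (hk : ρ k ≠ μ) (N : ℕ) :
    ∃ K, ∃ x₁ > 0, ∀ x ≥ x₁, q k x ≤ K * x ^ (-(N : ℤ)) := by
  obtain ⟨C, hC0, hC⟩ := h.exists_abs_error_le k N
  rcases lt_or_gt_of_ne hk with hlt | hgt
  · obtain ⟨x₀, hx₀⟩ := eventually_atTop.1 <| (eventually_ge_atTop 1).and <|
      hμ.eventually_const_lt (by linarith : (ρ k + μ) / 2 < μ)
    have hx₀' : 0 < x₀ := one_pos.trans_le (hx₀ x₀ le_rfl).1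
    obtain ⟨K, x₁, hx₁, hK⟩ := exists_le_zpow_of_deriv_le (q := q k) (δ := μ - ρ k)
      N hx₀' (sub_pos.2 hlt) (fun x _ => h.deriv k x) fun x hx =>
        add_le_add (mul_le_mul_of_nonneg_right (by linarith [(hx₀ x hx).2]) (h.nonneg k x))
          ((le_abs_self _).trans (hC x (hx₀'.trans_le hx)))
    exact ⟨K, x₁, hx₀'.trans_le hx₁, hK⟩
  · obtain ⟨x₀, hx₀⟩ := eventually_atTop.1 <| (eventually_ge_atTop 1).and <|
      hμ.eventually_lt_const (by linarith : μ < (ρ k + μ) / 2)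
    have hx₀' : 0 < x₀ := one_pos.trans_le (hx₀ x₀ le_rfl).1
    refine ⟨C / (ρ k - μ), x₀, hx₀', fun x hx => le_zpow_of_deriv_ge (q := q k) N hx₀'
      (sub_pos.2 hgt) hC0 (fun y _ => h.le_one k y) (fun y _ => h.deriv k y) (fun y hy => ?_) hx⟩
    have hgrowth : (ρ k - μ) * q k y ≤ 2 * (ρ k - ∑ l, ρ l * q l y) * q k y :=
      mul_le_mul_of_nonneg_right (by linarith [(hx₀ y hy).2]) (h.nonneg k y)
    linarith [(abs_le.1 (hC y (hx₀'.trans_le hy))).1]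

theorem exists_mul_le_zpow (h : IsPerturbedReplicator ρ q e) {k l : ι} (hkl : ρ k ≠ ρ l)
    (N : ℕ) : ∃ K, ∃ x₁ > 0, ∀ x ≥ x₁, q k x * q l x ≤ K * x ^ (-(N : ℤ)) := by
  obtain ⟨μ, hμ⟩ := h.exists_tendsto_mean
  by_cases hk : ρ k = μ
  · obtain ⟨K, x₁, hx₁, hK⟩ := h.exists_le_zpow_of_tendsto_mean hμ (hk ▸ hkl.symm) N
    exact ⟨K, x₁, hx₁, fun x hx =>
      (mul_le_of_le_one_left (h.nonneg l x) (h.le_one k x)).trans (hK x hx)⟩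
  · obtain ⟨K, x₁, hx₁, hK⟩ := h.exists_le_zpow_of_tendsto_mean hμ hk N
    exact ⟨K, x₁, hx₁, fun x hx =>
      (mul_le_of_le_one_right (h.nonneg k x) (h.le_one l x)).trans (hK x hx)⟩

theorem exists_pow_mul_le (h : IsPerturbedReplicator ρ q e) {k l : ι} (hkl : ρ k ≠ ρ l)
    (N : ℕ) : ∃ C, ∀ x, |x| ^ N * (q k x * q l x) ≤ C := by
  obtain ⟨K, x₁, hx₁, hK⟩ := h.exists_mul_le_zpow hkl N
  obtain ⟨K', x₂, hx₂, hK'⟩ := h.comp_neg.exists_mul_le_zpow (neg_injective.ne hkl) N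
  have hpow : ∀ {x s B : ℝ}, 0 < x → s ≤ B * x ^ (-(N : ℤ)) → x ^ N * s ≤ B := by
    intro x s B hx hs
    rw [zpow_neg, zpow_natCast, ← div_eq_mul_inv, le_div_iff₀ (by positivity)] at hs
    linarith
  refine ⟨max (max K K') ((max x₁ x₂) ^ N), fun x => ?_⟩
  rcases le_or_gt x₁ x with hx | hx
  · rw [abs_of_pos (hx₁.trans_le hx)]
    exact (hpow (hx₁.trans_le hx) (hK x hx)).trans (by simp)
  rcases le_or_gt x₂ (-x) with hx' | hx'
  · rw [abs_of_neg (by linarith)]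
    have hKx := hpow (hx₂.trans_le hx') (hK' (-x) hx')
    rw [neg_neg] at hKx
    exact hKx.trans (by simp)
  have hxmax : |x| ≤ max x₁ x₂ :=
    abs_le.2 ⟨by linarith [le_max_right x₁ x₂], hx.le.trans (le_max_left _ _)⟩
  calc |x| ^ N * (q k x * q l x) ≤ (max x₁ x₂) ^ N * 1 := by
        gcongr
        · exact mul_nonneg (h.nonneg k x) (h.nonneg l x)
        · exact mul_le_one₀ (h.le_one k x) (h.nonneg l x) (h.le_one l x)
    _ ≤ max (max K K') ((max x₁ x₂) ^ N) := by simp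

end IsPerturbedReplicator

/-! ### Rank one projections -/

/-- The squared length of a vector. -/
def sqLen (w : Fin n → ℂ) : ℝ := ∑ i, Complex.normSq (w i)

/-- The orthogonal projection onto the line spanned by `w`. -/
def rankOneProj (w : Fin n → ℂ) : Mat n := Matrix.of fun i j => (sqLen w : ℂ)⁻¹ * (w i * conj (w j))

section RankOne

variable {w : Fin n → ℂ}

theorem sqLen_pos (hw : w ≠ 0) : 0 < sqLen w := by
  obtain ⟨i, hi⟩ := Function.ne_iff.1 hw
  exact Finset.sum_pos' (fun i _ => Complex.normSq_nonneg _)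
    ⟨i, Finset.mem_univ i, Complex.normSq_pos.2 hi⟩

theorem sqLen_cast (w : Fin n → ℂ) : (sqLen w : ℂ) = ∑ i, w i * conj (w i) := by
  simp [sqLen, Complex.mul_conj]

theorem sqLen_ne_zero (hw : w ≠ 0) : (sqLen w : ℂ) ≠ 0 :=
  Complex.ofReal_ne_zero.2 (sqLen_pos hw).ne'

theorem conjTranspose_rankOneProj (w : Fin n → ℂ) : (rankOneProj w)ᴴ = rankOneProj w := by
  ext i j
  simp only [rankOneProj, Matrix.conjTranspose_apply, Matrix.of_apply, RCLike.star_def, map_mul,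
    map_inv₀, Complex.conj_ofReal, Complex.conj_conj]
  ring

theorem trace_rankOneProj (hw : w ≠ 0) : (rankOneProj w).trace = 1 := by
  simp only [Matrix.trace, Matrix.diag_apply, rankOneProj, Matrix.of_apply]
  rw [← Finset.mul_sum, ← sqLen_cast, inv_mul_cancel₀ (sqLen_ne_zero hw)]

theorem rankOneProj_mul_mul (w : Fin n → ℂ) (M : Mat n) :
    rankOneProj w * M * rankOneProj w = (M * rankOneProj w).trace • rankOneProj w := by
  ext i j
  simp only [Matrix.mul_apply, Matrix.trace, Matrix.diag_apply, rankOneProj, Matrix.of_apply,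
    Matrix.smul_apply, smul_eq_mul, Finset.sum_mul]
  rw [Finset.sum_comm]
  exact Finset.sum_congr rfl fun k _ => Finset.sum_congr rfl fun l _ => by ring

theorem rankOneProj_mul_self (hw : w ≠ 0) : rankOneProj w * rankOneProj w = rankOneProj w := by
  simpa only [Matrix.mul_one, Matrix.one_mul, trace_rankOneProj hw, one_smul] using
    rankOneProj_mul_mul w 1

theorem rankOneProj_diag (w : Fin n → ℂ) (k : Fin n) :
    rankOneProj w k k = ((Complex.normSq (w k) / sqLen w : ℝ) : ℂ) := by
  simp only [rankOneProj, Matrix.of_apply, Complex.mul_conj]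
  push_cast
  ring

theorem normSq_rankOneProj (w : Fin n → ℂ) (k l : Fin n) : Complex.normSq (rankOneProj w k l) =
    (rankOneProj w k k).re * (rankOneProj w l l).re := by
  rw [rankOneProj_diag, rankOneProj_diag, Complex.ofReal_re, Complex.ofReal_re]
  simp only [rankOneProj, Matrix.of_apply, map_mul, map_inv₀, Complex.normSq_ofReal,
    Complex.normSq_conj]
  ring

theorem rankOneProj_diag_nonneg (w : Fin n → ℂ) (k : Fin n) : 0 ≤ (rankOneProj w k k).re := by
  rw [rankOneProj_diag, Complex.ofReal_re]
  exact div_nonneg (Complex.normSq_nonneg _) (Finset.sum_nonneg fun i _ => Complex.normSq_nonneg _)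

theorem sum_rankOneProj_diag (hw : w ≠ 0) : ∑ k, (rankOneProj w k k).re = 1 := by
  rw [← Complex.re_sum]
  exact congrArg Complex.re (trace_rankOneProj hw)

theorem norm_rankOneProj_le (hw : w ≠ 0) (k l : Fin n) : ‖rankOneProj w k l‖ ≤ 1 := by
  have diag_le_one (k : Fin n) : (rankOneProj w k k).re ≤ 1 := by
    rw [← sum_rankOneProj_diag hw]
    exact Finset.single_le_sum (f := fun k => (rankOneProj w k k).re)
      (fun i _ => rankOneProj_diag_nonneg w i) (Finset.mem_univ k)
  rw [← sq_le_one_iff₀ (norm_nonneg _), ← Complex.normSq_eq_norm_sq, normSq_rankOneProj]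
  exact mul_le_one₀ (diag_le_one k) (rankOneProj_diag_nonneg w l) (diag_le_one l)

theorem mul_rankOneProj_apply (A : Mat n) (w : Fin n → ℂ) (i j : Fin n) :
    (A * rankOneProj w) i j = (sqLen w : ℂ)⁻¹ * (A.mulVec w i * conj (w j)) := by
  simp only [Matrix.mul_apply, rankOneProj, Matrix.of_apply, Matrix.mulVec, dotProduct,
    Finset.sum_mul, Finset.mul_sum]
  exact Finset.sum_congr rfl fun k _ => by ring

theorem rankOneProj_mul_conjTranspose_apply (A : Mat n) (w : Fin n → ℂ) (i j : Fin n) :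
    (rankOneProj w * Aᴴ) i j = (sqLen w : ℂ)⁻¹ * (w i * conj (A.mulVec w j)) := by
  have h : rankOneProj w * Aᴴ = (A * rankOneProj w)ᴴ := by
    rw [Matrix.conjTranspose_mul, conjTranspose_rankOneProj]
  rw [h, Matrix.conjTranspose_apply, mul_rankOneProj_apply]
  simp only [RCLike.star_def, map_mul, map_inv₀, Complex.conj_ofReal, Complex.conj_conj]
  ring

theorem trace_add_conjTranspose_mul_rankOneProj (A : Mat n) (w : Fin n → ℂ) :
    ((A + Aᴴ) * rankOneProj w).trace = (sqLen w : ℂ)⁻¹ *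
      ∑ i, (A.mulVec w i * conj (w i) + w i * conj (A.mulVec w i)) := by
  rw [Matrix.add_mul, Matrix.trace_add, Matrix.trace_mul_comm Aᴴ, Finset.sum_add_distrib, mul_add,
    Finset.mul_sum, Finset.mul_sum]
  simp only [Matrix.trace, Matrix.diag_apply, mul_rankOneProj_apply,
    rankOneProj_mul_conjTranspose_apply]

/-- The right hand side of the Riccati equation `π' = π (B - B') π - (B π - π B')`, which describes
the motion of the projection onto a line that moves by `w' = -B w`, where `B' = -Bᴴ`. -/
def riccati (π B B' : Mat n) : Mat n := π * (B - B') * π - (B * π - π * B')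

theorem riccati_of_conjTranspose {B B' : Mat n} (hB : Bᴴ = -B') (π : Mat n) :
    riccati π B B' = π * (B + Bᴴ) * π - (B * π + π * Bᴴ) := by
  rw [hB, riccati, ← sub_eq_add_neg, Matrix.mul_neg, ← sub_eq_add_neg]

theorem hasMatDerivAt_rankOneProj {w : ℝ → Fin n → ℂ} {B B' : Mat n} {x : ℝ}
    (hw : ∀ i, HasDerivAt (fun y => w y i) (-(B.mulVec (w x) i)) x) (hB : Bᴴ = -B')
    (h0 : w x ≠ 0) :
    HasMatDerivAt (fun y => rankOneProj (w y)) (riccati (rankOneProj (w x)) B B') x := by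
  have conj_deriv (i : Fin n) :
      HasDerivAt (fun y => conj (w y i)) (-conj (B.mulVec (w x) i)) x := by
    simpa using (hw i).star
  have sqLen_deriv : HasDerivAt (fun y => (sqLen (w y) : ℂ))
      (-∑ i, (B.mulVec (w x) i * conj (w x i) + w x i * conj (B.mulVec (w x) i))) x := by
    simp only [sqLen_cast]
    refine (HasDerivAt.fun_sum fun i _ => (hw i).mul (conj_deriv i)).congr_deriv ?_
    rw [← Finset.sum_neg_distrib]
    exact Finset.sum_congr rfl fun k _ => by ring
  have hne := sqLen_ne_zero h0
  intro i j
  refine ((sqLen_deriv.inv hne).mul ((hw i).mul (conj_deriv j))).congr_deriv ?_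
  rw [riccati_of_conjTranspose hB, Matrix.sub_apply, Matrix.add_apply, rankOneProj_mul_mul,
    Matrix.smul_apply, trace_add_conjTranspose_mul_rankOneProj, mul_rankOneProj_apply,
    rankOneProj_mul_conjTranspose_apply]
  generalize ∑ i, (B.mulVec (w x) i * conj (w x i) + w x i * conj (B.mulVec (w x) i)) = T
  simp only [rankOneProj, Matrix.of_apply, smul_eq_mul, Pi.mul_apply, Pi.inv_apply]
  field_simp
  ring

theorem contDiff_rankOneProj {w : ℝ × ℝ → Fin n → ℂ} (hw : ∀ i, ContDiff ℝ ∞ fun p => w p i)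
    (h0 : ∀ p, w p ≠ 0) (i j : Fin n) : ContDiff ℝ ∞ fun p => rankOneProj (w p) i j := by
  have conj_contDiff (i : Fin n) : ContDiff ℝ ∞ fun p => conj (w p i) :=
    Complex.conjCLE.contDiff.comp (hw i)
  simp only [rankOneProj, Matrix.of_apply]
  refine ContDiff.mul (ContDiff.inv ?_ fun p => sqLen_ne_zero (h0 p)) ((hw i).mul (conj_contDiff j))
  simp only [sqLen_cast]
  exact ContDiff.sum fun i _ => (hw i).mul (conj_contDiff i)

end RankOne

/-! ### Darboux matrices -/

/-- The matrix `S` such that `λ + S = (λ - z) π + (λ - z̄) (1 - π)`, where `π` is the projection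
onto the line spanned by `w`. -/
def darboux (z : ℂ) (w : Fin n → ℂ) : Mat n := (conj z - z) • rankOneProj w - conj z • 1

theorem darboux_comm_sub (z : ℂ) (w : Fin n → ℂ) (a : Fin n → ℂ) (k l : Fin n) :
    (darboux z w * Matrix.diagonal a - Matrix.diagonal a * darboux z w) k l =
      (conj z - z) * (a l - a k) * rankOneProj w k l := by
  have h : darboux z w * Matrix.diagonal a - Matrix.diagonal a * darboux z w =
      (conj z - z) • (rankOneProj w * Matrix.diagonal a - Matrix.diagonal a * rankOneProj w) := by
    simp only [darboux, Matrix.sub_mul, Matrix.mul_sub, Matrix.smul_mul, Matrix.mul_smul,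
      Matrix.one_mul, Matrix.mul_one]
    module
  rw [h, Matrix.smul_apply, Matrix.sub_apply, Matrix.mul_diagonal, Matrix.diagonal_mul, smul_eq_mul]
  ring

theorem conjTranspose_darboux_comm {a : Fin n → ℂ} (ha : ∀ i, (a i).re = 0) (z : ℂ)
    (w : Fin n → ℂ) :
    (darboux z w * Matrix.diagonal a - Matrix.diagonal a * darboux z w)ᴴ =
      -(darboux z w * Matrix.diagonal a - Matrix.diagonal a * darboux z w) := by
  have conj_a (i : Fin n) : conj (a i) = -a i := by apply Complex.ext <;> simp [ha i]
  have conj_proj (k l : Fin n) : conj (rankOneProj w l k) = rankOneProj w k l :=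
    congrFun (congrFun (conjTranspose_rankOneProj w) k) l
  ext k l
  rw [Matrix.conjTranspose_apply, Matrix.neg_apply, darboux_comm_sub, darboux_comm_sub]
  simp only [RCLike.star_def, map_mul, map_sub, Complex.conj_conj, conj_a, conj_proj]
  ring

theorem hasMatDerivAt_darboux {z : ℂ} {w : ℝ → Fin n → ℂ} {D : Mat n} {x : ℝ}
    (h : HasMatDerivAt (fun x => rankOneProj (w x)) D x) :
    HasMatDerivAt (fun x => darboux z (w x)) ((conj z - z) • D) x :=
  ((h.const_smul (conj z - z)).sub (.const (conj z • 1) x)).congr_deriv (sub_zero _)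

theorem riccati_darboux {a u π S : Mat n} {z z' : ℂ} (hπ : π * π = π)
    (hS : S = (z' - z) • π - z' • 1) :
    (z' - z) • riccati π (z • a + u) (z' • a + u) = S * u - (u + (S * a - a * S)) * S := by
  subst hS
  simp only [riccati, Matrix.mul_add, Matrix.add_mul, Matrix.mul_sub, Matrix.sub_mul,
    Matrix.smul_mul, Matrix.mul_smul, Matrix.mul_assoc, Matrix.one_mul, Matrix.mul_one, hπ]
  module

/-- `S` intertwines two sequences of coefficients: the series `∑ₖ qₖ λ⁻ᵏ` and `∑ₖ q'ₖ λ⁻ᵏ` are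
conjugate by `λ + S`. -/
structure IsDarbouxPair (S : Mat n) (q q' : ℕ → Mat n) : Prop where
  zero : q' 0 = q 0
  succ : ∀ k, q' (k + 1) + q' k * S = q (k + 1) + S * q k

theorem IsDarbouxPair.timeOp_mul_sub {q q' : ℕ → Mat n} {S : Mat n} (h : IsDarbouxPair S q q')
    (j : ℕ) (l : ℂ) :
    timeOp q' j l * (l • 1 + S) - (l • 1 + S) * timeOp q j l = q (j + 1) - q' (j + 1) := by
  have bracket (k : ℕ) : q' k * S - S * q k = q (k + 1) - q' (k + 1) := by
    rw [sub_eq_sub_iff_add_eq_add, add_comm, h.succ k]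
  induction j with
  | zero =>
    rw [← bracket, timeOp_zero, timeOp_zero, h.zero]
    simp only [Matrix.mul_add, Matrix.add_mul, Matrix.mul_smul, Matrix.smul_mul, Matrix.mul_one,
      Matrix.one_mul, add_sub_add_left_eq_sub]
  | succ j ih =>
    calc timeOp q' (j + 1) l * (l • 1 + S) - (l • 1 + S) * timeOp q (j + 1) l
        = l • (timeOp q' j l * (l • 1 + S) - (l • 1 + S) * timeOp q j l + (q' (j + 1) - q (j + 1)))
          + (q' (j + 1) * S - S * q (j + 1)) := by
          simp only [timeOp_succ, Matrix.add_mul, Matrix.mul_add, Matrix.smul_mul, Matrix.mul_smul,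
            Matrix.one_mul, Matrix.mul_one]
          module
      _ = q (j + 1 + 1) - q' (j + 1 + 1) := by
          rw [ih, bracket]
          module

/-- A matrix `W` for which `C (λ + S) - (λ + S) B = -W` holds at the two points where `λ + S` is
singular is determined by the kernels there. -/
theorem riccati_eq_of_intertwine {π W B B' C C' S : Mat n} {z z' : ℂ} (hπ : π * π = π)
    (hS : S = (z' - z) • π - z' • 1) (hz : C * (z • 1 + S) - (z • 1 + S) * B = -W)
    (hz' : C' * (z' • 1 + S) - (z' • 1 + S) * B' = -W) :
    (z' - z) • riccati π B B' = W := by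
  have mul_proj : W * π = (z' - z) • (π * B * π - B * π) := by
    rw [← neg_eq_iff_eq_neg.2 hz, hS]
    simp only [Matrix.neg_mul, Matrix.mul_add, Matrix.add_mul, Matrix.mul_sub, Matrix.sub_mul,
      Matrix.smul_mul, Matrix.mul_smul, Matrix.mul_assoc, Matrix.one_mul, Matrix.mul_one, hπ]
    module
  have mul_one_sub_proj : W * (1 - π) = (z' - z) • (π * B' - π * B' * π) := by
    rw [← neg_eq_iff_eq_neg.2 hz', hS]
    simp only [Matrix.neg_mul, Matrix.mul_add, Matrix.add_mul, Matrix.mul_sub, Matrix.sub_mul,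
      Matrix.smul_mul, Matrix.mul_smul, Matrix.mul_assoc, Matrix.one_mul, Matrix.mul_one, hπ]
    module
  calc (z' - z) • riccati π B B' = W * π + W * (1 - π) := by
        rw [mul_proj, mul_one_sub_proj, riccati, Matrix.mul_sub, Matrix.sub_mul]
        module
    _ = W := by rw [← Matrix.mul_add, add_sub_cancel, Matrix.mul_one]

/-! ### Decay of the Darboux transform -/

theorem riccati_lax (π A U : Mat n) (z z' : ℂ) :
    riccati π (z • A + U) (z' • A + U) =
      (z - z') • (π * A * π) - (z • (A * π) - z' • (π * A)) + (π * U - U * π) := by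
  simp only [riccati, Matrix.mul_add, Matrix.add_mul, Matrix.mul_sub, Matrix.sub_mul,
    Matrix.smul_mul, Matrix.mul_smul]
  module

theorem riccati_rankOneProj_diag {a : Fin n → ℂ} (ha : ∀ i, (a i).re = 0) (z : ℂ) (w : Fin n → ℂ)
    (U : Mat n) (k : Fin n) :
    riccati (rankOneProj w) (z • Matrix.diagonal a + U) (conj z • Matrix.diagonal a + U) k k =
      ((2 * (z.im * (a k).im - ∑ l, z.im * (a l).im * (rankOneProj w l l).re) *
        (rankOneProj w k k).re : ℝ) : ℂ) + (rankOneProj w * U - U * rankOneProj w) k k := by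
  have diag_re (l : Fin n) : rankOneProj w l l = ((rankOneProj w l l).re : ℂ) := by
    rw [rankOneProj_diag, Complex.ofReal_re]
  have sub_conj_mul (l : Fin n) : (z - conj z) * a l = -2 * ((z.im * (a l).im : ℝ) : ℂ) := by
    apply Complex.ext <;> simp [ha l]
    ring
  have trace_eq : (z - conj z) * (Matrix.diagonal a * rankOneProj w).trace =
      -2 * ∑ l, ((z.im * (a l).im * (rankOneProj w l l).re : ℝ) : ℂ) := by
    simp only [Matrix.trace, Matrix.diag_apply, Matrix.diagonal_mul, Finset.mul_sum]
    refine Finset.sum_congr rfl fun l _ => ?_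
    rw [← mul_assoc, sub_conj_mul, Complex.ofReal_mul (z.im * (a l).im), ← diag_re, mul_assoc]
  rw [riccati_lax, Matrix.add_apply, rankOneProj_mul_mul]
  congr 1
  simp only [Matrix.sub_apply, Matrix.smul_apply, Matrix.mul_diagonal, Matrix.diagonal_mul,
    smul_eq_mul]
  rw [Complex.ofReal_mul, ← diag_re k]
  push_cast at trace_eq sub_conj_mul ⊢
  linear_combination rankOneProj w k k * trace_eq - rankOneProj w k k * sub_conj_mul k

section Decay

variable {a : Fin n → ℂ} {u : ℝ → Mat n} {z : ℂ} {w : ℝ → Fin n → ℂ}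

theorem matDerivsIn_boundedFun_rankOneProj (hw : ∀ x, w x ≠ 0) :
    MatDerivsIn boundedFun 0 fun x => rankOneProj (w x) :=
  fun i j => ⟨1, fun x => norm_rankOneProj_le (hw x) i j⟩

theorem isPerturbedReplicator_rankOneProj (ha : ∀ i, (a i).re = 0) (hu : IsSchwartz u)
    (hw : ∀ x, w x ≠ 0)
    (hπ : ∀ x, HasMatDerivAt (fun x => rankOneProj (w x)) (riccati (rankOneProj (w x))
      (z • Matrix.diagonal a + u x) (conj z • Matrix.diagonal a + u x)) x) :
    IsPerturbedReplicator (fun k => z.im * (a k).im) (fun k x => (rankOneProj (w x) k k).re)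
      (fun k x => ((rankOneProj (w x) * u x - u x * rankOneProj (w x)) k k).re) where
  nonneg k x := rankOneProj_diag_nonneg (w x) k
  sum_eq_one x := sum_rankOneProj_diag (hw x)
  deriv k x := by
    refine (Complex.reCLM.hasFDerivAt.comp_hasDerivAt x (hπ x k k)).congr_deriv ?_
    rw [riccati_rankOneProj_diag ha, Complex.reCLM_apply, Complex.add_re, Complex.ofReal_re]
  rapid k N := by
    have hB := matDerivsIn_boundedFun_rankOneProj hw
    have hu₀ := isSchwartz_iff.1 hu 0
    obtain ⟨C, hC⟩ := ((hB.bounded_mul_rapid hu₀).sub (hu₀.rapid_mul_bounded hB)) k k N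
    exact ⟨C, fun x => le_trans (by gcongr; exact Complex.abs_re_le_norm _) (hC x)⟩

theorem rankOneProj_mem_rapidFun (ha : ∀ i, (a i).re = 0) (hz : z.im ≠ 0) (hu : IsSchwartz u)
    (hw : ∀ x, w x ≠ 0)
    (hπ : ∀ x, HasMatDerivAt (fun x => rankOneProj (w x)) (riccati (rankOneProj (w x))
      (z • Matrix.diagonal a + u x) (conj z • Matrix.diagonal a + u x)) x)
    {k l : Fin n} (hkl : a k ≠ a l) : (fun x => rankOneProj (w x) k l) ∈ rapidFun := by
  have rate_ne : z.im * (a k).im ≠ z.im * (a l).im := fun h =>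
    hkl (Complex.ext (by rw [ha, ha]) (mul_left_cancel₀ hz h))
  intro N
  obtain ⟨C, hC⟩ :=
    (isPerturbedReplicator_rankOneProj ha hu hw hπ).exists_pow_mul_le rate_ne (2 * N)
  refine ⟨√C, fun x => Real.le_sqrt_of_sq_le ?_⟩
  rw [mul_pow, ← Complex.normSq_eq_norm_sq, normSq_rankOneProj, ← pow_mul, mul_comm N 2]
  exact hC x

theorem matDerivsIn_boundedFun_darboux (hw : ∀ x, w x ≠ 0) :
    MatDerivsIn boundedFun 0 fun x => darboux z (w x) := fun i j =>
  ((matDerivsIn_boundedFun_rankOneProj hw i j).const_mul (conj z - z)).sub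
    (DerivsIn.const ((conj z • (1 : Mat n)) i j))

theorem matDerivsIn_rapidFun_darboux_comm (ha : ∀ i, (a i).re = 0) (hz : z.im ≠ 0)
    (hu : IsSchwartz u) (hw : ∀ x, w x ≠ 0)
    (hπ : ∀ x, HasMatDerivAt (fun x => rankOneProj (w x)) (riccati (rankOneProj (w x))
      (z • Matrix.diagonal a + u x) (conj z • Matrix.diagonal a + u x)) x) :
    MatDerivsIn rapidFun 0 fun x =>
      darboux z (w x) * Matrix.diagonal a - Matrix.diagonal a * darboux z (w x) := fun k l => by
  simp only [darboux_comm_sub]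
  by_cases hkl : a k = a l
  · simpa only [hkl, sub_self, mul_zero, zero_mul] using DerivsIn.zero
  · exact DerivsIn.const_mul (m := 0) _ (rankOneProj_mem_rapidFun ha hz hu hw hπ hkl)

theorem isSchwartz_darboux (ha : ∀ i, (a i).re = 0) (hz : z.im ≠ 0) (hu : IsSchwartz u)
    (hw : ∀ x, w x ≠ 0)
    (hπ : ∀ x, HasMatDerivAt (fun x => rankOneProj (w x)) (riccati (rankOneProj (w x))
      (z • Matrix.diagonal a + u x) (conj z • Matrix.diagonal a + u x)) x) :
    IsSchwartz fun x => u x + (darboux z (w x) * Matrix.diagonal a -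
      Matrix.diagonal a * darboux z (w x)) := by
  let S : ℝ → Mat n := fun x => darboux z (w x)
  let R : ℝ → Mat n := fun x => S x * Matrix.diagonal a - Matrix.diagonal a * S x
  have S_deriv (x : ℝ) : HasMatDerivAt S (S x * u x - (u x + R x) * S x) x :=
    (hasMatDerivAt_darboux (hπ x)).congr_deriv (riccati_darboux (rankOneProj_mul_self (hw x)) rfl)
  have S_zero : MatDerivsIn boundedFun 0 S := matDerivsIn_boundedFun_darboux hw
  have R_zero : MatDerivsIn rapidFun 0 R := matDerivsIn_rapidFun_darboux_comm ha hz hu hw hπ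
  have hu' := isSchwartz_iff.1 hu
  have bounded_and_rapid (m : ℕ) : MatDerivsIn boundedFun m S ∧ MatDerivsIn rapidFun m R := by
    induction m with
    | zero => exact ⟨S_zero, R_zero⟩
    | succ m ih =>
      have hS' : MatDerivsIn rapidFun m fun x => S x * u x - (u x + R x) * S x :=
        (ih.1.bounded_mul_rapid (hu' m)).sub (((hu' m).add ih.2).rapid_mul_bounded ih.1)
      exact ⟨S_zero.succ S_deriv (hS'.mono rapidFun_le_boundedFun),
        R_zero.succ (fun x => ((S_deriv x).mul_const _).sub ((S_deriv x).const_mul _))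
          ((hS'.rapid_mul_bounded (.const _)).sub ((MatDerivsIn.const _).bounded_mul_rapid hS'))⟩
  exact isSchwartz_iff.2 fun m => (hu' m).add (bounded_and_rapid m).2

end Decay

/-! ### Darboux transforms of solutions -/

section DarbouxTransform

variable {a : Fin n → ℂ} {b : Mat n} {j : ℕ} {u : ℝ → ℝ → Mat n} {E : ℝ → ℝ → ℂ → Mat n} {z : ℂ}
  {w : ℝ → ℝ → Fin n → ℂ}

/-- A field of lines, each spanned by the vector `w x t`, that is transported by the connection of
the solution `u` at the spectral parameter `z`. This is the datum of a Darboux transform of `u`. -/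
structure IsTransportedLine (a : Fin n → ℂ) (b : Mat n) (j : ℕ) (u : ℝ → ℝ → Mat n) (z : ℂ)
    (w : ℝ → ℝ → Fin n → ℂ) : Prop where
  smooth : ∀ i, ContDiff ℝ ∞ fun p : ℝ × ℝ => w p.1 p.2 i
  ne_zero : ∀ x t, w x t ≠ 0
  deriv_x : ∀ x t, HasMatDerivAt (fun x => rankOneProj (w x t)) (riccati (rankOneProj (w x t))
    (z • Matrix.diagonal a + u x t) (conj z • Matrix.diagonal a + u x t)) x
  deriv_t : ∀ x t, HasMatDerivAt (fun t => rankOneProj (w x t)) (riccati (rankOneProj (w x t))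
    (flowOp a b j u x t z) (flowOp a b j u x t (conj z))) t

theorem HasMatDerivAt.mulVec {F : ℝ → Mat n} {B : Mat n} {x : ℝ}
    (hF : HasMatDerivAt F (-(B * F x)) x) (v : Fin n → ℂ) (i : Fin n) :
    HasDerivAt (fun y => (F y).mulVec v i) (-(B.mulVec ((F x).mulVec v) i)) x := by
  simp only [Matrix.mulVec, dotProduct]
  refine (HasDerivAt.fun_sum fun k _ => (hF i k).mul_const (v k)).congr_deriv ?_
  change ((-(B * F x)).mulVec v) i = -(B.mulVec ((F x).mulVec v)) i
  rw [Matrix.mulVec_mulVec]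
  exact congrFun (Matrix.neg_mulVec v (B * F x)) i

/-- The vector is `E(x, t, z)⁻¹ v`, by the reality condition. -/
theorem IsTrivialization.isTransportedLine (ha : ∀ i, (a i).re = 0) (hb : IsSpectral a b)
    (hu : IsSolution a b j u) (hE : IsTrivialization a b j u E) (z : ℂ) {v : Fin n → ℂ}
    (hv : v ≠ 0) :
    IsTransportedLine a b j u z fun x t => (E x t (conj z))ᴴ.mulVec v := by
  have ne_zero (x t : ℝ) : (E x t (conj z))ᴴ.mulVec v ≠ 0 := fun h => hv <| by
    simpa only [Matrix.mulVec_mulVec, hE.mul_inv ha hb hu, Matrix.one_mulVec, Matrix.mulVec_zero]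
      using congrArg (E x t z).mulVec h
  refine ⟨fun i => ?_, ne_zero, fun x t => ?_, fun x t => ?_⟩
  · obtain ⟨E₀, hE₀, -, hsmooth⟩ := hu.exists_trivialization ha hb
    rw [hE₀.unique ha hb hu hE]
    simp only [Matrix.mulVec, dotProduct, Matrix.conjTranspose_apply]
    exact ContDiff.sum fun k _ =>
      (Complex.conjCLE.contDiff.comp (hsmooth (conj z) k i)).mul contDiff_const
  · exact hasMatDerivAt_rankOneProj (w := fun x => (E x t (conj z))ᴴ.mulVec v)
      ((hE.inv_deriv_x ha hu x t z).mulVec v)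
      (by simpa only [Complex.conj_conj] using hu.conjTranspose_lax ha x t (conj z)) (ne_zero x t)
  · exact hasMatDerivAt_rankOneProj (w := fun t => (E x t (conj z))ᴴ.mulVec v)
      ((hE.inv_deriv_t ha hb hu x t z).mulVec v)
      (by simpa only [Complex.conj_conj] using hu.conjTranspose_flowOp ha hb x t (conj z))
      (ne_zero x t)

/-- The potential `u + [S, a]`, where `S` is the Darboux matrix of the line spanned by `w`. -/
def darbouxPotential (a : Fin n → ℂ) (u : ℝ → ℝ → Mat n) (z : ℂ) (w : ℝ → ℝ → Fin n → ℂ)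
    (x t : ℝ) : Mat n :=
  u x t + (darboux z (w x t) * Matrix.diagonal a - Matrix.diagonal a * darboux z (w x t))

namespace IsTransportedLine

theorem darboux_deriv_x (hw : IsTransportedLine a b j u z w) (x t : ℝ) :
    HasMatDerivAt (fun x => darboux z (w x t))
      (darboux z (w x t) * u x t - darbouxPotential a u z w x t * darboux z (w x t)) x :=
  (hasMatDerivAt_darboux (hw.deriv_x x t)).congr_deriv
    (riccati_darboux (rankOneProj_mul_self (hw.ne_zero x t)) rfl)

theorem isPotential (hw : IsTransportedLine a b j u z w) (ha : ∀ i, (a i).re = 0) (hz : z.im ≠ 0)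
    (hu : IsSolution a b j u) (t : ℝ) : IsPotential a fun x => darbouxPotential a u z w x t where
  schwartz :=
    isSchwartz_darboux ha hz (hu.schwartz t) (fun x => hw.ne_zero x t) fun x => hw.deriv_x x t
  mem_perp x := by
    refine mem_centralizerPerp ?_ fun k l hkl => ?_
    · rw [darbouxPotential, Matrix.conjTranspose_add, (hu.mem_perp x t).1,
        conjTranspose_darboux_comm ha, neg_add]
    · rw [darbouxPotential, Matrix.add_apply, darboux_comm_sub,
        centralizerPerp_apply_eq_zero (hu.mem_perp x t) hkl, hkl, sub_self, mul_zero, zero_mul,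
        add_zero]

theorem isDarbouxPair (hw : IsTransportedLine a b j u z w) (ha : ∀ i, (a i).re = 0)
    (hb : IsSpectral a b) (hz : z.im ≠ 0) (hu : IsSolution a b j u) (x t : ℝ) :
    IsDarbouxPair (darboux z (w x t)) (fun k => Q a b (fun y => u y t) k x)
      (fun k => Q a b (fun y => darbouxPotential a u z w y t) k x) where
  zero := by rw [Q_zero, Q_zero]
  succ k := Q_darboux hb (hu.isPotential t) (hw.isPotential ha hz hu t)
    (fun x => hw.darboux_deriv_x x t) (fun _ => rfl) k x

theorem flowOp_mul_sub (hw : IsTransportedLine a b j u z w) (ha : ∀ i, (a i).re = 0)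
    (hb : IsSpectral a b) (hz : z.im ≠ 0) (hu : IsSolution a b j u) (x t : ℝ) (l : ℂ) :
    flowOp a b j (darbouxPotential a u z w) x t l * (l • 1 + darboux z (w x t)) -
      (l • 1 + darboux z (w x t)) * flowOp a b j u x t l =
      -(Q a b (fun y => darbouxPotential a u z w y t) (j + 1) x -
        Q a b (fun y => u y t) (j + 1) x) :=
  ((hw.isDarbouxPair ha hb hz hu x t).timeOp_mul_sub j l).trans (neg_sub _ _).symm

theorem darboux_deriv_t (hw : IsTransportedLine a b j u z w) (ha : ∀ i, (a i).re = 0)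
    (hb : IsSpectral a b) (hz : z.im ≠ 0) (hu : IsSolution a b j u) (x t : ℝ) :
    HasMatDerivAt (fun t => darboux z (w x t))
      (Q a b (fun y => darbouxPotential a u z w y t) (j + 1) x -
        Q a b (fun y => u y t) (j + 1) x) t :=
  (hasMatDerivAt_darboux (hw.deriv_t x t)).congr_deriv
    (riccati_eq_of_intertwine (rankOneProj_mul_self (hw.ne_zero x t)) rfl
      (hw.flowOp_mul_sub ha hb hz hu x t z) (hw.flowOp_mul_sub ha hb hz hu x t (conj z)))

theorem isSolution (hw : IsTransportedLine a b j u z w) (ha : ∀ i, (a i).re = 0)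
    (hb : IsSpectral a b) (hz : z.im ≠ 0) (hu : IsSolution a b j u) :
    IsSolution a b j (darbouxPotential a u z w) where
  smooth k l := by
    simp only [darbouxPotential, Matrix.add_apply, darboux_comm_sub]
    exact (hu.smooth k l).add (contDiff_const.mul
      (contDiff_rankOneProj (w := fun p : ℝ × ℝ => w p.1 p.2) hw.smooth
        (fun p => hw.ne_zero p.1 p.2) k l))
  mem_perp x t := (hw.isPotential ha hz hu t).mem_perp x
  schwartz t := (hw.isPotential ha hz hu t).schwartz
  flow x t := by
    have hS := hw.darboux_deriv_t ha hb hz hu x t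
    refine ((hu.hasMatDerivAt_flow hb x t).add ((hS.mul_const (Matrix.diagonal a)).sub
      (hS.const_mul (Matrix.diagonal a)))).congr_deriv ?_
    rw [(hasMatDerivAt_Q hb.comm (hw.isPotential ha hz hu t) j x).matDeriv]
    noncomm_ring

theorem intertwine (hw : IsTransportedLine a b j u z w) (ha : ∀ i, (a i).re = 0)
    (hb : IsSpectral a b) (hz : z.im ≠ 0) (hu : IsSolution a b j u)
    (hE : IsTrivialization a b j u E) {E' : ℝ → ℝ → ℂ → Mat n}
    (hE' : IsTrivialization a b j (darbouxPotential a u z w) E') (x t : ℝ) (l : ℂ) :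
    (l • 1 + darboux z (w 0 0)) * E x t l = E' x t l * (l • 1 + darboux z (w x t)) := by
  have h := hE.eq_mul ha hb hu (l := l)
    (F := fun x t => E' x t l * (l • 1 + darboux z (w x t)))
    (fun x t => ((hE'.deriv_x x t l).mul
      ((HasMatDerivAt.const (l • 1) x).add (hw.darboux_deriv_x x t))).congr_deriv ?_)
    (fun x t => ((hE'.deriv_t x t l).mul
      ((HasMatDerivAt.const (l • 1) t).add (hw.darboux_deriv_t ha hb hz hu x t))).congr_deriv ?_)
    x t
  · rw [h, hE'.base, Matrix.one_mul]
  · simp only [darbouxPotential, Matrix.mul_add, Matrix.add_mul, Matrix.mul_sub, Matrix.sub_mul,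
      Matrix.mul_smul, Matrix.smul_mul, Matrix.mul_one, Matrix.mul_assoc, zero_add]
    module
  · change E' x t l * flowOp a b j (darbouxPotential a u z w) x t l *
      (l • 1 + darboux z (w x t)) + _ = _
    rw [Matrix.mul_assoc, sub_eq_iff_eq_add.1 (hw.flowOp_mul_sub ha hb hz hu x t l),
      Matrix.mul_assoc]
    noncomm_ring

end IsTransportedLine

theorem IsSolution.exists_darboux (ha : ∀ i, (a i).re = 0) (hb : IsSpectral a b)
    (hu : IsSolution a b j u) (hE : IsTrivialization a b j u E) (hz : z.im ≠ 0)
    {v : Fin n → ℂ} (hv : v ≠ 0) :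
    ∃ (u' : ℝ → ℝ → Mat n) (E' : ℝ → ℝ → ℂ → Mat n) (w : ℝ → ℝ → Fin n → ℂ),
      IsSolution a b j u' ∧ IsTrivialization a b j u' E' ∧ (∀ x t, IsGPlus (E' x t)) ∧
      (∀ x t, w x t ≠ 0) ∧ ∀ x t l, (l • 1 + darboux z v) * E x t l =
        E' x t l * (l • 1 + darboux z (w x t)) := by
  have hw := hE.isTransportedLine ha hb hu z hv
  have hu' := hw.isSolution ha hb hz hu
  obtain ⟨E', hE', hplus, -⟩ := hu'.exists_trivialization ha hb
  refine ⟨_, E', _, hu', hE', hplus, hw.ne_zero, fun x t l => ?_⟩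
  simpa only [hE.base, Matrix.conjTranspose_one, Matrix.one_mulVec] using
    hw.intertwine ha hb hz hu hE hE' x t l

end DarbouxTransform

/-! ### Matrices of rational functions and their values -/

theorem infinite_of_eventually_cofinite {p : ℂ → Prop} (h : ∀ᶠ l in cofinite, p l) :
    {l | p l}.Infinite := by
  simpa only [Set.compl_ofPred, not_not] using (show {l | ¬p l}.Finite from h).infinite_compl

theorem eq_of_eventually_eq_cofinite {X : Type*} [TopologicalSpace X] [T2Space X] {f g : ℂ → X}
    (hf : Continuous f) (hg : Continuous g) (h : ∀ᶠ l in cofinite, f l = g l) : f = g := by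
  refine Continuous.ext_on (s := {l | f l = g l}) ?_ hf hg fun l hl => hl
  simpa only [Set.compl_ofPred, not_not] using
    (show {l | ¬f l = g l}.Finite from h).countable.dense_compl ℂ

theorem ratFunc_eq_of_eval {r s : RatFunc ℂ}
    (h : ∀ᶠ l in cofinite, RatFunc.eval (RingHom.id ℂ) l r = RatFunc.eval (RingHom.id ℂ) l s) :
    r = s := by
  have num_mul_denom : r.num * s.denom = s.num * r.denom := by
    refine Polynomial.eq_of_infinite_eval_eq _ _ (infinite_of_eventually_cofinite ?_)
    filter_upwards [h, eventually_denom_ne_zero r, eventually_denom_ne_zero s] with l hl hr hs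
    rw [RatFunc.eval, RatFunc.eval, div_eq_div_iff hr hs] at hl
    simpa [Polynomial.eval₂_id] using hl
  rw [← RatFunc.num_div_denom r, ← RatFunc.num_div_denom s, div_eq_div_iff
    (RatFunc.algebraMap_ne_zero r.denom_ne_zero) (RatFunc.algebraMap_ne_zero s.denom_ne_zero),
    ← map_mul, ← map_mul, num_mul_denom]

theorem eq_of_evalAt {g h : Matrix (Fin n) (Fin n) (RatFunc ℂ)}
    (hgh : ∀ᶠ l in cofinite, evalAt g l = evalAt h l) : g = h := by
  ext i j : 2
  refine ratFunc_eq_of_eval ?_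
  filter_upwards [hgh] with l hl
  exact congrFun (congrFun hl i) j

theorem GMinus.ext_evalAt {g h : GMinus n}
    (hgh : ∀ᶠ l in cofinite, evalAt g.1.val l = evalAt h.1.val l) : g = h :=
  Subtype.ext (Units.ext (eq_of_evalAt hgh))

theorem GMinus.eventually_evalAt_mul (g h : GMinus n) :
    ∀ᶠ l in cofinite, evalAt (g * h).1.val l = evalAt g.1.val l * evalAt h.1.val l :=
  UnHierarchy.eventually_evalAt_mul g.1.val h.1.val

theorem GMinus.eventually_mul_conjTranspose (g : GMinus n) :
    ∀ᶠ l in cofinite, evalAt g.1.val l * (evalAt g.1.val (conj l))ᴴ = 1 :=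
  g.2.1.mono fun _ => mul_eq_one_comm.1

theorem eval_div {p q : Polynomial ℂ} {l : ℂ} (hq : q.eval l ≠ 0) :
    RatFunc.eval (RingHom.id ℂ) l (algebraMap (Polynomial ℂ) (RatFunc ℂ) p / algebraMap _ _ q) =
      p.eval l / q.eval l := by
  have eval_algebraMap (r : Polynomial ℂ) :
      RatFunc.eval (RingHom.id ℂ) l (algebraMap (Polynomial ℂ) (RatFunc ℂ) r) = r.eval l := by
    simp [Polynomial.eval₂_id]
  have hq₀ : q ≠ 0 := by
    rintro rfl
    exact hq Polynomial.eval_zero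
  rw [eq_div_iff hq, ← eval_algebraMap q, ← RatFunc.eval_mul,
    div_mul_cancel₀ _ (RatFunc.algebraMap_ne_zero hq₀), eval_algebraMap]
  · rw [Polynomial.eval₂_id]
    exact fun h => hq (Polynomial.eval_eq_zero_of_dvd_of_eval_eq_zero (RatFunc.denom_div_dvd p q) h)
  · simp

/-! ### Simple elements -/

/-- The matrix `(λ + S) / (λ - z̄)`, where `S` is a Darboux matrix. -/
def simpleMat (z : ℂ) (w : Fin n → ℂ) : Matrix (Fin n) (Fin n) (RatFunc ℂ) :=
  Matrix.of fun i j => algebraMap (Polynomial ℂ) (RatFunc ℂ)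
    ((if i = j then Polynomial.X else 0) + Polynomial.C (darboux z w i j)) /
      algebraMap _ _ (Polynomial.X - Polynomial.C (conj z))

theorem evalAt_simpleMat (w : Fin n → ℂ) {z l : ℂ} (hl : l ≠ conj z) :
    evalAt (simpleMat z w) l = (l - conj z)⁻¹ • (l • 1 + darboux z w) := by
  ext i j
  have hq : (Polynomial.X - Polynomial.C (conj z)).eval l ≠ 0 := by simpa [sub_eq_zero] using hl
  simp only [evalAt, simpleMat, Matrix.map_apply, Matrix.of_apply, eval_div hq, Matrix.smul_apply,
    Matrix.add_apply, Matrix.one_apply, smul_eq_mul, Polynomial.eval_add, Polynomial.eval_C,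
    Polynomial.eval_sub, Polynomial.eval_X, apply_ite (Polynomial.eval l), Polynomial.eval_zero,
    mul_ite, mul_one, mul_zero]
  exact div_eq_inv_mul _ _

theorem darboux_mul_darboux_conj (z l : ℂ) {w : Fin n → ℂ} (hw : w ≠ 0) :
    (l • 1 + darboux z w) * (l • 1 + darboux (conj z) w) = ((l - conj z) * (l - z)) • 1 := by
  simp only [darboux, Complex.conj_conj, Matrix.mul_add, Matrix.add_mul, Matrix.mul_sub,
    Matrix.sub_mul, Matrix.smul_mul, Matrix.mul_smul, Matrix.mul_one, Matrix.one_mul,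
    rankOneProj_mul_self hw]
  module

theorem conjTranspose_darboux (z : ℂ) (w : Fin n → ℂ) :
    (darboux z w)ᴴ = darboux (conj z) w := by
  simp [darboux, Matrix.conjTranspose_sub, Matrix.conjTranspose_smul, conjTranspose_rankOneProj]

theorem smul_one_add_darboux (z l : ℂ) (w : Fin n → ℂ) :
    l • 1 + darboux z w = (l - conj z) • 1 + (conj z - z) • rankOneProj w := by
  rw [darboux]
  module

theorem evalAt_simpleMat_mul (z : ℂ) {w : Fin n → ℂ} (hw : w ≠ 0) {l : ℂ} (hz : l ≠ z)
    (hz' : l ≠ conj z) : evalAt (simpleMat z w) l * evalAt (simpleMat (conj z) w) l = 1 := by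
  have hz₀ := sub_ne_zero.2 hz
  have hz₀' := sub_ne_zero.2 hz'
  rw [evalAt_simpleMat w hz', evalAt_simpleMat w (by simpa using hz), Matrix.smul_mul,
    Matrix.mul_smul, darboux_mul_darboux_conj z l hw, smul_smul, smul_smul, Complex.conj_conj,
    show (l - conj z)⁻¹ * (l - z)⁻¹ * ((l - conj z) * (l - z)) = 1 by field_simp, one_smul]

theorem simpleMat_mul (z : ℂ) {w : Fin n → ℂ} (hw : w ≠ 0) :
    simpleMat z w * simpleMat (conj z) w = 1 := by
  refine eq_of_evalAt ?_
  filter_upwards [eventually_evalAt_mul (simpleMat z w) (simpleMat (conj z) w),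
    eventually_cofinite_ne z, eventually_cofinite_ne (conj z)] with l hl hz hz'
  rw [hl, evalAt_simpleMat_mul z hw hz hz', evalAt_one]

theorem conjTranspose_evalAt_simpleMat (w : Fin n → ℂ) {z l : ℂ} (hl : l ≠ z) :
    (evalAt (simpleMat z w) (conj l))ᴴ = evalAt (simpleMat (conj z) w) l := by
  have hconj : conj l ≠ conj z := star_injective.ne hl
  rw [evalAt_simpleMat w hconj, evalAt_simpleMat w (by simpa using hl),
    Matrix.conjTranspose_smul, Matrix.conjTranspose_add, conjTranspose_darboux,
    Matrix.conjTranspose_smul]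
  simp

theorem tendsto_inv_sub_cocompact (z : ℂ) :
    Tendsto (fun l : ℂ => (l - z)⁻¹) (cocompact ℂ) (𝓝 0) := by
  have hsub : Tendsto (fun l : ℂ => l - z) (cocompact ℂ) (cocompact ℂ) :=
    (Homeomorph.subRight z).isClosedEmbedding.tendsto_cocompact
  rw [← Metric.cobounded_eq_cocompact] at hsub ⊢
  exact tendsto_inv₀_cobounded.comp hsub

theorem tendsto_evalAt_simpleMat (z : ℂ) (w : Fin n → ℂ) :
    Tendsto (evalAt (simpleMat z w)) (cocompact ℂ) (𝓝 1) := by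
  have hlim : Tendsto
      (fun l : ℂ => (1 : Mat n) + (l - conj z)⁻¹ • ((conj z - z) • rankOneProj w))
      (cocompact ℂ) (𝓝 (1 + (0 : ℂ) • ((conj z - z) • rankOneProj w))) :=
    tendsto_const_nhds.add ((tendsto_inv_sub_cocompact (conj z)).smul tendsto_const_nhds)
  rw [zero_smul, add_zero] at hlim
  refine hlim.congr' ?_
  filter_upwards [cocompact_le_cofinite (eventually_cofinite_ne (conj z))] with l hl
  rw [evalAt_simpleMat w hl, smul_one_add_darboux, smul_add, inv_smul_smul₀ (sub_ne_zero.2 hl)]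

/-- The simple element `π^⊥ + (λ - z) / (λ - z̄) π` of `G_-^m`, where `π` is the projection onto the
line spanned by `w`. -/
def simpleElt (z : ℂ) (w : Fin n → ℂ) (hw : w ≠ 0) : GMinus n where
  val :=
    { val := simpleMat z w
      inv := simpleMat (conj z) w
      val_inv := simpleMat_mul z hw
      inv_val := by simpa using simpleMat_mul (conj z) hw }
  property := by
    refine ⟨?_, tendsto_evalAt_simpleMat z w⟩
    filter_upwards [eventually_cofinite_ne z, eventually_cofinite_ne (conj z)] with l hz hz'
    exact (congrArg (· * _) (conjTranspose_evalAt_simpleMat w hz)).trans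
      (mul_eq_one_comm.1 (evalAt_simpleMat_mul z hw hz hz'))

theorem evalAt_simpleElt {z : ℂ} {w : Fin n → ℂ} (hw : w ≠ 0) {l : ℂ} (hl : l ≠ conj z) :
    evalAt (simpleElt z w hw).1.val l = (l - conj z)⁻¹ • (l • 1 + darboux z w) :=
  evalAt_simpleMat w hl

theorem simpleElt_mul_conj (z : ℂ) {w : Fin n → ℂ} (hw : w ≠ 0) :
    simpleElt z w hw * simpleElt (conj z) w hw = 1 :=
  Subtype.ext (Units.ext (simpleMat_mul z hw))

/-! ### Generation of `G_-^m` by simple elements -/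

theorem eq_of_tendsto_cocompact {F : ℂ → Mat n} {A : Mat n}
    (hF : ∀ i j, Differentiable ℂ fun l => F l i j) (h : Tendsto F (cocompact ℂ) (𝓝 A)) (l : ℂ) :
    F l = A := by
  ext i j
  exact (hF i j).apply_eq_of_tendsto_cocompact l
    (((continuous_id.matrix_elem i j).tendsto A).comp h)

/-- `P` is a matrix of polynomials with `P = d g`. -/
def IsNumerator (g : GMinus n) (d : Polynomial ℂ) (P : Matrix (Fin n) (Fin n) (Polynomial ℂ)) :
    Prop :=
  ∀ᶠ l in cofinite, d.eval l • evalAt g.1.val l = P.map (Polynomial.eval l)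

theorem GMinus.exists_numerator (g : GMinus n) :
    ∃ (d : Polynomial ℂ) (P : Matrix (Fin n) (Fin n) (Polynomial ℂ)),
      d ≠ 0 ∧ IsNumerator g d P := by
  obtain ⟨d, hd⟩ := IsLocalization.exist_integer_multiples_of_finite
    (nonZeroDivisors (Polynomial ℂ)) fun ij : Fin n × Fin n => g.1.val ij.1 ij.2
  choose P hP using hd
  refine ⟨d, Matrix.of fun i j => P (i, j), nonZeroDivisors.coe_ne_zero d, ?_⟩
  have hdenom : ∀ᶠ l in cofinite, ∀ i j,
      Polynomial.eval₂ (RingHom.id ℂ) l (g.1.val i j).denom ≠ 0 :=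
    eventually_all.2 fun i => eventually_all.2 fun j => eventually_denom_ne_zero _
  filter_upwards [hdenom] with l hl
  ext i j
  have hPl := congrArg (RatFunc.eval (RingHom.id ℂ) l) (hP (i, j))
  rw [Algebra.smul_def, RatFunc.eval_mul _ _ (by simp) (hl i j), RatFunc.eval_algebraMap,
    RatFunc.eval_algebraMap] at hPl
  simpa [Polynomial.eval₂_id, evalAt] using hPl.symm

theorem map_eval_mul_map_C (P : Matrix (Fin n) (Fin n) (Polynomial ℂ)) (A : Mat n) (l : ℂ) :
    (P * A.map Polynomial.C).map (Polynomial.eval l) = P.map (Polynomial.eval l) * A := by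
  ext i j
  simp [Matrix.mul_apply, Polynomial.eval_finsetSum]

theorem exists_map_eval_eq_sub_smul {P : Matrix (Fin n) (Fin n) (Polynomial ℂ)} {z : ℂ}
    (hP : P.map (Polynomial.eval z) = 0) :
    ∃ R : Matrix (Fin n) (Fin n) (Polynomial ℂ),
      ∀ l, P.map (Polynomial.eval l) = (l - z) • R.map (Polynomial.eval l) := by
  choose R hR using fun i j => Polynomial.dvd_iff_isRoot.2 (congrFun (congrFun hP i) j)
  refine ⟨Matrix.of R, fun l => ?_⟩
  ext i j
  simp [hR]

theorem mul_rankOneProj_eq_zero {M : Mat n} {w : Fin n → ℂ} (h : M.mulVec w = 0) :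
    M * rankOneProj w = 0 := by
  ext i j
  rw [mul_rankOneProj_apply, h]
  simp

theorem conj_dotProduct_self (w : Fin n → ℂ) : (fun i => conj (w i)) ⬝ᵥ w = (sqLen w : ℂ) := by
  rw [sqLen_cast]
  exact Finset.sum_congr rfl fun i _ => mul_comm _ _

theorem rankOneProj_mulVec (w x : Fin n → ℂ) : (rankOneProj w).mulVec x =
    ((sqLen w : ℂ)⁻¹ * ((fun i => conj (w i)) ⬝ᵥ x)) • w := by
  ext i
  simp only [Matrix.mulVec, dotProduct, rankOneProj, Matrix.of_apply, Pi.smul_apply, smul_eq_mul,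
    Finset.mul_sum, Finset.sum_mul]
  exact Finset.sum_congr rfl fun k _ => by ring

theorem ker_lt_ker_mul_one_sub_rankOneProj {M : Mat n} {y : Fin n → ℂ} (hy : Mᴴ.mulVec y ≠ 0) :
    LinearMap.ker M.mulVecLin <
      LinearMap.ker (M * (1 - rankOneProj (Mᴴ.mulVec y))).mulVecLin := by
  set w := Mᴴ.mulVec y with hw
  have dotProduct_eq_zero {x : Fin n → ℂ} (hx : M.mulVec x = 0) :
      (fun i => conj (w i)) ⬝ᵥ x = 0 := by
    have hstar : (fun i => conj (w i)) = star y ᵥ* M := by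
      rw [← Matrix.conjTranspose_conjTranspose M, ← Matrix.star_mulVec, hw]
      rfl
    rw [hstar, ← Matrix.dotProduct_mulVec, hx, dotProduct_zero]
  refine SetLike.lt_iff_le_and_exists.2 ⟨fun x hx => ?_, w, ?_, fun h => ?_⟩
  · rw [LinearMap.mem_ker, Matrix.mulVecLin_apply] at hx ⊢
    rw [← Matrix.mulVec_mulVec, Matrix.sub_mulVec, Matrix.one_mulVec, rankOneProj_mulVec,
      dotProduct_eq_zero hx, mul_zero, zero_smul, sub_zero, hx]
  · rw [LinearMap.mem_ker, Matrix.mulVecLin_apply, ← Matrix.mulVec_mulVec, Matrix.sub_mulVec,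
      Matrix.one_mulVec, rankOneProj_mulVec, conj_dotProduct_self,
      inv_mul_cancel₀ (sqLen_ne_zero hy), one_smul, sub_self, Matrix.mulVec_zero]
  · rw [LinearMap.mem_ker, Matrix.mulVecLin_apply] at h
    exact sqLen_ne_zero hy ((conj_dotProduct_self w).symm.trans (dotProduct_eq_zero h))

section Numerator

variable {g : GMinus n} {d : Polynomial ℂ} {P : Matrix (Fin n) (Fin n) (Polynomial ℂ)} {z : ℂ}

theorem IsNumerator.mul_conjTranspose (h : IsNumerator g d P) (l : ℂ) :
    P.map (Polynomial.eval l) * (P.map (Polynomial.eval (conj l)))ᴴ =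
      (d.eval l * conj (d.eval (conj l))) • 1 := by
  have hP : Continuous fun l => P.map (Polynomial.eval l) :=
    continuous_matrix fun i j => (P i j).continuous
  have hconj : Continuous fun l : ℂ => conj l := Complex.continuous_conj
  refine congrFun (eq_of_eventually_eq_cofinite (f := fun l => P.map (Polynomial.eval l) *
    (P.map (Polynomial.eval (conj l)))ᴴ) (g := fun l => (d.eval l * conj (d.eval (conj l))) •
      (1 : Mat n)) (hP.matrix_mul (hP.comp hconj).matrix_conjTranspose) ?_ ?_) l
  · exact (d.continuous.mul (hconj.comp (d.continuous.comp hconj))).smul continuous_const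
  · filter_upwards [h, tendsto_conj_cofinite.eventually h, GMinus.eventually_mul_conjTranspose g]
      with l hl hl' hg
    rw [← hl, ← hl', Matrix.conjTranspose_smul, Matrix.smul_mul, Matrix.mul_smul, hg, smul_smul]
    rfl

theorem IsNumerator.eq_one_of_natDegree (h : IsNumerator g d P) (hd : d ≠ 0)
    (hdeg : d.natDegree = 0) : g = 1 := by
  obtain ⟨c, rfl⟩ := Polynomial.natDegree_eq_zero.1 hdeg
  have hc : c ≠ 0 := Polynomial.C_ne_zero.1 hd
  have hg : ∀ᶠ l in cofinite, evalAt g.1.val l = c⁻¹ • P.map (Polynomial.eval l) := by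
    filter_upwards [h] with l hl
    rw [← hl, Polynomial.eval_C, inv_smul_smul₀ hc]
  refine GMinus.ext_evalAt (hg.mono fun l hl => ?_)
  rw [hl, eq_of_tendsto_cocompact (F := fun l => c⁻¹ • P.map (Polynomial.eval l))
    (fun i j => (P i j).differentiable.const_mul c⁻¹)
    (g.2.2.congr' (cocompact_le_cofinite hg))]
  exact (evalAt_one l).symm

theorem IsNumerator.exists_of_map_eval_eq_zero (h : IsNumerator g d P) (hd : d.IsRoot z)
    (hP : P.map (Polynomial.eval z) = 0) :
    ∃ d' P', d = (Polynomial.X - Polynomial.C z) * d' ∧ IsNumerator g d' P' := by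
  obtain ⟨d', rfl⟩ := Polynomial.dvd_iff_isRoot.2 hd
  obtain ⟨P', hP'⟩ := exists_map_eval_eq_sub_smul hP
  refine ⟨d', P', rfl, ?_⟩
  filter_upwards [h, eventually_cofinite_ne z] with l hl hz
  refine smul_right_injective (Mat n) (sub_ne_zero.2 hz) ?_
  simpa [hP', mul_smul] using hl

theorem IsNumerator.mul_simpleElt {w : Fin n → ℂ} (hw : w ≠ 0) (h : IsNumerator g d P)
    (hP : (P.map (Polynomial.eval (conj z))).mulVec w = 0) :
    ∃ P' : Matrix (Fin n) (Fin n) (Polynomial ℂ), IsNumerator (g * simpleElt z w hw) d P' ∧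
      P'.map (Polynomial.eval z) = P.map (Polynomial.eval z) * (1 - rankOneProj w) := by
  obtain ⟨R, hR⟩ := exists_map_eval_eq_sub_smul (P := P * (rankOneProj w).map Polynomial.C)
    (by rw [map_eval_mul_map_C, mul_rankOneProj_eq_zero hP])
  simp only [map_eval_mul_map_C] at hR
  have hP' (l : ℂ) : (P + Polynomial.C (conj z - z) • R).map (Polynomial.eval l) =
      P.map (Polynomial.eval l) + (conj z - z) • R.map (Polynomial.eval l) := by
    ext i j
    simp
  refine ⟨P + Polynomial.C (conj z - z) • R, ?_, ?_⟩
  · filter_upwards [h, GMinus.eventually_evalAt_mul g (simpleElt z w hw),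
      eventually_cofinite_ne (conj z)] with l hl hmul hz
    have hz' : l - conj z ≠ 0 := sub_ne_zero.2 hz
    rw [hmul, ← Matrix.smul_mul, hl, evalAt_simpleElt hw hz, smul_one_add_darboux, hP', smul_add,
      inv_smul_smul₀ hz', Matrix.mul_add, Matrix.mul_one, Matrix.mul_smul, Matrix.mul_smul, hR,
      smul_comm (conj z - z), inv_smul_smul₀ hz']
  · rw [hP', Matrix.mul_sub, Matrix.mul_one, hR, ← neg_sub z, neg_smul,
      ← sub_eq_add_neg]

open ComplexOrder in
theorem IsNumerator.exists_mul_simpleElt (h : IsNumerator g d P) (hd : d.IsRoot z)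
    (hP : P.map (Polynomial.eval z) ≠ 0) :
    z.im ≠ 0 ∧ ∃ (w : Fin n → ℂ) (hw : w ≠ 0) (P' : Matrix (Fin n) (Fin n) (Polynomial ℂ)),
      IsNumerator (g * simpleElt z w hw) d P' ∧
      LinearMap.ker (P.map (Polynomial.eval z)).mulVecLin <
        LinearMap.ker (P'.map (Polynomial.eval z)).mulVecLin := by
  set M := P.map (Polynomial.eval z)
  have mul_eq_zero {l : ℂ} (hl : conj l = z) : P.map (Polynomial.eval l) * Mᴴ = 0 := by
    have hmul := h.mul_conjTranspose l
    rwa [hl, hd.eq_zero, map_zero, mul_zero, zero_smul] at hmul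
  obtain ⟨y, hy⟩ : ∃ y, Mᴴ.mulVec y ≠ 0 := by
    contrapose! hP
    exact Matrix.conjTranspose_eq_zero.1 <| Matrix.ext_iff_mulVec.2 fun v => by
      rw [hP, Matrix.zero_mulVec]
  obtain ⟨P', hP', hP'z⟩ := h.mul_simpleElt (z := z) hy <| by
    rw [Matrix.mulVec_mulVec, mul_eq_zero (Complex.conj_conj z), Matrix.zero_mulVec]
  refine ⟨fun him => hP ?_, _, hy, P', hP', ?_⟩
  · exact Matrix.self_mul_conjTranspose_eq_zero.1 (mul_eq_zero (Complex.conj_eq_iff_im.2 him))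
  · rw [hP'z]
    exact ker_lt_ker_mul_one_sub_rankOneProj hy

/-- Multiplying by simple elements with a pole at `z̄` enlarges the kernel of `P(z)` until `P(z)`
vanishes. -/
theorem IsNumerator.induction_at_root {p : GMinus n → Prop} (hd : d.IsRoot z)
    (mul_simpleElt : ∀ (g : GMinus n) (z : ℂ) (w : Fin n → ℂ) (hw : w ≠ 0), z.im ≠ 0 → p g →
      p (g * simpleElt z w hw))
    (of_map_eval_eq_zero : ∀ g P, IsNumerator g d P → P.map (Polynomial.eval z) = 0 → p g)
    (h : IsNumerator g d P) : p g := by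
  induction hK : LinearMap.ker (P.map (Polynomial.eval z)).mulVecLin using
    WellFoundedGT.induction generalizing g P with
  | _ K ih =>
    by_cases hP : P.map (Polynomial.eval z) = 0
    · exact of_map_eval_eq_zero g P h hP
    · obtain ⟨hz, w, hw, P', hP', hlt⟩ := h.exists_mul_simpleElt hd hP
      have hp := mul_simpleElt _ (conj z) w hw (by simpa using hz) (ih _ (hK ▸ hlt) hP' rfl)
      rwa [mul_assoc, simpleElt_mul_conj, mul_one] at hp

theorem GMinus.induction {p : GMinus n → Prop} (one : p 1)
    (mul_simpleElt : ∀ (g : GMinus n) (z : ℂ) (w : Fin n → ℂ) (hw : w ≠ 0), z.im ≠ 0 → p g →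
      p (g * simpleElt z w hw)) (g : GMinus n) : p g := by
  obtain ⟨d, P, hd, hP⟩ := GMinus.exists_numerator g
  induction hN : d.natDegree generalizing d g P with
  | zero => rwa [hP.eq_one_of_natDegree hd hN]
  | succ N ih =>
    obtain ⟨z, hz⟩ := Complex.exists_root (f := d)
      (Polynomial.natDegree_pos_iff_degree_pos.1 (by omega))
    refine hP.induction_at_root hz mul_simpleElt fun g P hP hPz => ?_
    obtain ⟨d', P', rfl, hP'⟩ := hP.exists_of_map_eval_eq_zero hz hPz
    have hd' : d' ≠ 0 := right_ne_zero_of_mul hd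
    rw [Polynomial.natDegree_mul (Polynomial.X_sub_C_ne_zero z) hd',
      Polynomial.natDegree_X_sub_C] at hN
    exact ih g d' P' hd' hP' (by omega)

end Numerator

/-! ### Uniqueness of factorizations -/

theorem IsGPlus.mul_conjTranspose {f : ℂ → Mat n} (hf : IsGPlus f) (l : ℂ) :
    f l * (f (conj l))ᴴ = 1 :=
  mul_eq_one_comm.1 (hf.reality l)

theorem IsGPlus.eq_of_tendsto_conjTranspose_mul {f f' : ℂ → Mat n} (hf : IsGPlus f)
    (hf' : IsGPlus f') (h : Tendsto (fun l => (f' (conj l))ᴴ * f l) (cocompact ℂ) (𝓝 1)) :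
    f = f' := by
  funext l
  have eq_one : (f' (conj l))ᴴ * f l = 1 := by
    refine eq_of_tendsto_cocompact (F := fun l => (f' (conj l))ᴴ * f l) (fun i j => ?_) h l
    simp only [Matrix.mul_apply, Matrix.conjTranspose_apply]
    refine Differentiable.fun_sum fun k _ => Differentiable.mul (fun l => ?_) (hf.holo k j)
    have hconj := (hf'.holo k i (conj l)).star_star
    rwa [show star (conj l) = l from Complex.conj_conj l] at hconj
  rw [← Matrix.one_mul (f l), ← hf'.mul_conjTranspose l, Matrix.mul_assoc, eq_one,
    Matrix.mul_one]

theorem IsGPlus.eventually_conjTranspose_mul_eq {f f' : ℂ → Mat n} (hf' : IsGPlus f')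
    {g g' : GMinus n}
    (h : ∀ᶠ l in cofinite, f l * evalAt g.1.val l = f' l * evalAt g'.1.val l) :
    ∀ᶠ l in cofinite, (f' (conj l))ᴴ * f l = evalAt (g' * g⁻¹).1.val l := by
  have hmul := GMinus.eventually_evalAt_mul (g' * g⁻¹) g
  rw [inv_mul_cancel_right] at hmul
  filter_upwards [h, hmul, GMinus.eventually_mul_conjTranspose g] with l hl hmul hg
  calc (f' (conj l))ᴴ * f l
      = (f' (conj l))ᴴ * (f l * evalAt g.1.val l) * (evalAt g.1.val (conj l))ᴴ := by
        rw [Matrix.mul_assoc, Matrix.mul_assoc (f l), hg, Matrix.mul_one]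
    _ = evalAt g'.1.val l * (evalAt g.1.val (conj l))ᴴ := by
        rw [hl, ← Matrix.mul_assoc _ (f' l), hf'.reality, Matrix.one_mul]
    _ = _ := by rw [hmul, Matrix.mul_assoc, hg, Matrix.mul_one]

theorem IsGPlus.eq_of_mul_evalAt_eq {f f' : ℂ → Mat n} (hf : IsGPlus f) (hf' : IsGPlus f')
    {g g' : GMinus n}
    (h : ∀ᶠ l in cofinite, f l * evalAt g.1.val l = f' l * evalAt g'.1.val l) :
    f = f' ∧ g = g' := by
  have quotient_eq := hf'.eventually_conjTranspose_mul_eq h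
  obtain rfl : f = f' := hf.eq_of_tendsto_conjTranspose_mul hf' <|
    (g' * g⁻¹).2.2.congr' (cocompact_le_cofinite (quotient_eq.mono fun l hl => hl.symm))
  refine ⟨rfl, GMinus.ext_evalAt (h.mono fun l hl => ?_)⟩
  simpa only [← Matrix.mul_assoc, hf.reality, Matrix.one_mul] using
    congrArg ((f (conj l))ᴴ * ·) hl

theorem IsFactorization.unique {g g₁ g₂ : GMinus n} {f f₁ f₂ : ℂ → Mat n}
    (h₁ : IsFactorization g f f₁ g₁) (h₂ : IsFactorization g f f₂ g₂) : f₁ = f₂ ∧ g₁ = g₂ :=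
  h₁.1.eq_of_mul_evalAt_eq h₂.1 (by filter_upwards [h₁.2, h₂.2] with l hl₁ hl₂ using hl₁ ▸ hl₂)

theorem IsFactorization.mul {g h g' h' : GMinus n} {f f' f'' : ℂ → Mat n}
    (h₁ : IsFactorization h f f' h') (h₂ : IsFactorization g f' f'' g') :
    IsFactorization (g * h) f f'' (g' * h') := by
  refine ⟨h₂.1, ?_⟩
  filter_upwards [h₁.2, h₂.2, GMinus.eventually_evalAt_mul g h,
    GMinus.eventually_evalAt_mul g' h'] with l hh hg hgh hgh'
  rw [hgh, hgh', Matrix.mul_assoc, hh, ← Matrix.mul_assoc, hg, Matrix.mul_assoc]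

/-! ### The dressing action -/

section Dressing

variable {a : Fin n → ℂ} {b : Mat n} {j : ℕ} {u u₁ u₂ : ℝ → ℝ → Mat n}

/-- The solution `u'` arises from `u` by factoring the product of `g` with the trivialization
of `u`. -/
def IsDressing (a : Fin n → ℂ) (b : Mat n) (j : ℕ) (g : GMinus n) (u u' : ℝ → ℝ → Mat n) : Prop :=
  ∀ E, IsTrivialization a b j u E → ∃ (E' : ℝ → ℝ → ℂ → Mat n) (g' : ℝ → ℝ → GMinus n),
    IsTrivialization a b j u' E' ∧ ∀ x t, IsFactorization g (E x t) (E' x t) (g' x t)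

theorem isDressing_one (ha : ∀ i, (a i).re = 0) (hb : IsSpectral a b)
    (hu : IsSolution a b j u) : IsDressing a b j 1 u u := by
  intro E hE
  obtain ⟨E₀, hE₀, hplus, -⟩ := hu.exists_trivialization ha hb
  rw [← hE.unique ha hb hu hE₀] at *
  refine ⟨E₀, fun _ _ => 1, hE₀, fun x t => ⟨hplus x t, Eventually.of_forall fun l => ?_⟩⟩
  rw [show evalAt (1 : GMinus n).1.val l = 1 from evalAt_one l, Matrix.one_mul, Matrix.mul_one]

theorem IsDressing.mul {g h : GMinus n} (h₁ : IsDressing a b j h u u₁)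
    (h₂ : IsDressing a b j g u₁ u₂) : IsDressing a b j (g * h) u u₂ := by
  intro E hE
  obtain ⟨E₁, h', hE₁, hf₁⟩ := h₁ E hE
  obtain ⟨E₂, g', hE₂, hf₂⟩ := h₂ E₁ hE₁
  exact ⟨E₂, fun x t => g' x t * h' x t, hE₂, fun x t => (hf₁ x t).mul (hf₂ x t)⟩

theorem IsDressing.unique (ha : ∀ i, (a i).re = 0) (hb : IsSpectral a b)
    (hu : IsSolution a b j u) (hu₁ : IsSolution a b j u₁) {g : GMinus n}
    (h₁ : IsDressing a b j g u u₁) (h₂ : IsDressing a b j g u u₂) : u₁ = u₂ := by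
  obtain ⟨E, hE, -⟩ := hu.exists_trivialization ha hb
  obtain ⟨E₁, g₁, hE₁, hf₁⟩ := h₁ E hE
  obtain ⟨E₂, g₂, hE₂, hf₂⟩ := h₂ E hE
  obtain rfl : E₁ = E₂ := by
    funext x t
    exact ((hf₁ x t).unique (hf₂ x t)).1
  funext x t
  have h := (hE₁.deriv_x x t 0).unique (hE₂.deriv_x x t 0)
  have h' := congrArg (fun M => (E₁ x t (conj 0))ᴴ * M) h
  simpa only [← Matrix.mul_assoc, hE₁.inv_mul ha hb hu₁, Matrix.one_mul, zero_smul, zero_add]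
    using h'

theorem exists_isDressing_simpleElt (ha : ∀ i, (a i).re = 0) (hb : IsSpectral a b)
    (hu : IsSolution a b j u) {z : ℂ} (hz : z.im ≠ 0) {v : Fin n → ℂ} (hv : v ≠ 0) :
    ∃ u', IsSolution a b j u' ∧ IsDressing a b j (simpleElt z v hv) u u' := by
  obtain ⟨E, hE, -⟩ := hu.exists_trivialization ha hb
  obtain ⟨u', E', w, hu', hE', hplus, hw, h⟩ := hu.exists_darboux ha hb hE hz hv
  refine ⟨u', hu', fun F hF => ⟨E', fun x t => simpleElt z (w x t) (hw x t), hE', fun x t =>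
    ⟨hplus x t, ?_⟩⟩⟩
  rw [hE.unique ha hb hu hF]
  filter_upwards [eventually_cofinite_ne (conj z)] with l hl
  rw [evalAt_simpleElt hv hl, evalAt_simpleElt (hw x t) hl, Matrix.smul_mul, h, Matrix.mul_smul]

theorem exists_isDressing (ha : ∀ i, (a i).re = 0) (hb : IsSpectral a b) (g : GMinus n) :
    ∀ u, IsSolution a b j u → ∃ u', IsSolution a b j u' ∧ IsDressing a b j g u u' := by
  induction g using GMinus.induction with
  | one => exact fun u hu => ⟨u, hu, isDressing_one ha hb hu⟩
  | mul_simpleElt g z w hw hz ih =>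
    intro u hu
    obtain ⟨u₁, hu₁, h₁⟩ := exists_isDressing_simpleElt ha hb hu hz hw
    obtain ⟨u₂, hu₂, h₂⟩ := ih u₁ hu₁
    exact ⟨u₂, hu₂, h₁.mul h₂⟩

theorem exists_mulAction_isDressing (ha : ∀ i, (a i).re = 0) (hb : IsSpectral a b) (j : ℕ) :
    ∃ act : MulAction (GMinus n) (solutionSpace a b j),
      ∀ g (u : solutionSpace a b j), IsDressing a b j g u.1 (act.smul g u).1 := by
  choose d hd using fun (g : GMinus n) (u : solutionSpace a b j) =>
    exists_isDressing ha hb g u.1 u.2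
  let act : MulAction (GMinus n) (solutionSpace a b j) :=
    { smul := fun g u => ⟨d g u, (hd g u).1⟩
      one_smul := fun u => Subtype.ext
        ((hd 1 u).2.unique ha hb u.2 (hd 1 u).1 (isDressing_one ha hb u.2))
      mul_smul := fun g h u => Subtype.ext
        ((hd (g * h) u).2.unique ha hb u.2 (hd (g * h) u).1
          ((hd h u).2.mul (hd g ⟨d h u, (hd h u).1⟩).2)) }
  exact ⟨act, fun g u => (hd g u).2⟩

end Dressing

end UnHierarchy

end

theorem theorem5p9 {n : ℕ} (a : Fin n → ℂ) (ha : ∀ i, (a i).re = 0)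
    (b : UnHierarchy.Mat n) (hb : bᴴ = -b)
    (hab : ∃ p : Polynomial ℂ, b = Polynomial.aeval (Matrix.diagonal a) p)
    (j : ℕ) (hj : 1 ≤ j) :
    (∀ u ∈ UnHierarchy.solutionSpace a b j, ∃! E : ℝ → ℝ → ℂ → UnHierarchy.Mat n,
      UnHierarchy.IsTrivialization a b j u E) ∧
    ∃ act : MulAction (UnHierarchy.GMinus n) (UnHierarchy.solutionSpace a b j),
      ∀ (g : UnHierarchy.GMinus n) (u : UnHierarchy.solutionSpace a b j)
        (E : ℝ → ℝ → ℂ → UnHierarchy.Mat n), UnHierarchy.IsTrivialization a b j u.1 E →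
        ∃ (E' : ℝ → ℝ → ℂ → UnHierarchy.Mat n) (g' : ℝ → ℝ → UnHierarchy.GMinus n),
          (∀ x t, UnHierarchy.IsFactorization g (E x t) (E' x t) (g' x t)) ∧
          (∀ x t (f : ℂ → UnHierarchy.Mat n) (h : UnHierarchy.GMinus n),
            UnHierarchy.IsFactorization g (E x t) f h → f = E' x t ∧ h = g' x t) ∧
          (∀ l, E' 0 0 l = 1) ∧
          (∀ x t l, UnHierarchy.HasMatDerivAt (fun y => E' y t l)
            (E' x t l * (l • Matrix.diagonal a + (act.smul g u).1 x t)) x) ∧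
          UnHierarchy.IsTrivialization a b j (act.smul g u).1 E' := by
  obtain ⟨p, hp⟩ := hab
  have hs := UnHierarchy.isSpectral_aeval (a := a) hb hp
  refine ⟨fun u hu => ?_, ?_⟩
  · obtain ⟨E, hE, -⟩ := UnHierarchy.IsSolution.exists_trivialization ha hs hu
    exact ⟨E, hE, fun E' hE' => hE.unique ha hs hu hE'⟩
  · obtain ⟨act, hact⟩ := UnHierarchy.exists_mulAction_isDressing ha hs j
    refine ⟨act, fun g u E hE => ?_⟩
    obtain ⟨E', g', hE', hf⟩ := hact g u E hE
    exact ⟨E', g', hf, fun x t f h hfh => hfh.unique (hf x t), hE'.base, hE'.deriv_x, hE'⟩
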